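/- Let $\Bbbk$ be a field. A Hopf-algebra-invariant algebra map $(H,A\xleftarrow{\varphi_A}B)$ consists of a Hopf algebra $H$ over $\Bbbk$, a right $H$-comodule algebra $A$ with coaction $a\mapsto a_{(0)}\otimes a_{(1)}$, an algebra $B$ with trivial coaction and an $H$-colinear algebra map $\varphi_A:B\to A$ (that is, $\varphi_A(b)_{(0)}\otimes\varphi_A(b)_{(1)}=\varphi_A(b)\otimes 1$). Let $(H',A'\xleftarrow{\varphi_{A'}}B')\leftarrow(H,A\xleftarrow{\varphi_A}B)$ be a morphism, i.e. a Hopf algebra map $\chi:H\to H'$, an $H'$-colinear algebra map $\alpha:A\to A'$ ($A$ being an $H'$-comodule through $\chi$) and an algebra map $\beta:B\to B'$ with $\varphi_{A'}\circ\beta=\alpha\circ\varphi_A$. Let $A'\Box^{H'}H\subseteq A'\otimes H$ be the cotensor product, i.e. the subalgebra of all $\sum_i a'_i\otimes h_i$ with $\sum_i a'_{i(0)}\otimes a'_{i(1)}\otimes h_i=\sum_i a'_i\otimes\chi(h_{i(1)})\otimes h_{i(2)}$; it is an $H$-comodule algebra with coaction $\sum_i a'_i\otimes h_i\mapsto\sum_i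 (a'_i\otimes h_{i(1)})\otimes h_{i(2)}$, and a $B$-bimodule through $b\mapsto\varphi_{A'}(\beta(b))\otimes1$. The generalized canonical map is $$\kappa:B'\otimes_BA\to A'\Box^{H'}H,\qquad b'\otimes_Ba\mapsto b'\alpha(a_{(0)})\otimes a_{(1)}.$$ Assume that $\chi$ is left coflat (the functor $(-)\Box^{H'}H$ on right $H'$-comodules is exact), that the antipode $S$ of $H$ is bijective, and that $\kappa$ is bijective. View $A\otimes_BB'$ and $B'\otimes_BA$ as $B$-bimodules and right $H$-comodules, with trivial coaction on $B'$ and the given coaction on $A$. Write $\mathcal M_B$, $\mathcal M_{B'}$ for categories of right modules and $\mathcal M_A^H$, $\mathcal M_{A'}^{H'}$ for categories of right relative Hopf modules; let $$\widetilde f^*=(-)\otimes_AA'\ \dashv\ \widetilde f_*=(-)\Box^{H'}H,\qquad f^*=(-)\otimes_BB'\ \dashv\ f_*=\text{restriction along }\beta,\qquad q_*=(-)^{\mathrm{co}H},\qquad q'_*=(-)^{\mathrm{co}H'}.$$ Then the following hold. (1) The mate $f^*q_*\Rightarrow q'_*\widetilde f^*$ (with respect to these two adjunctions) of the inverse $q_*\widetilde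 f_*\cong f_*q'_*$ of the natural isomorphism $f_*q'_*\cong q_*\widetilde f_*$, $m'\mapsto m'\otimes1$, induces a morphism of $B$-bimodules and right $H$-comodules $$\widetilde\kappa:A\otimes_BB'\to A'\Box^{H'}H,\qquad a\otimes_Bb'\mapsto\alpha(a_{(0)})b'\otimes a_{(1)},$$ namely: $\widetilde\kappa$ is the component of the mate at $H\otimes A\in\mathcal M^H_A$ (diagonal coaction, action on the factor $A$), transported along the isomorphisms $A\cong(H\otimes A)^{\mathrm{co}H}$, $a\mapsto S^{-1}(a_{(1)})\otimes a_{(0)}$, of right $B$-modules, $(H\otimes A)\otimes_AA'\cong H\otimes A'$, $(h\otimes a)\otimes a'\mapsto h\otimes\alpha(a)a'$, in $\mathcal M^{H'}_{A'}$, and $(H\otimes A')^{\mathrm{co}H'}\cong A'\Box^{H'}H$, $\sum_ih_i\otimes a'_i\mapsto\sum_ia'_i\otimes S(h_i)$, of right $B'$-modules. The map $\kappa$ is also a morphism of $B$-bimodules and right $H$-comodules, hence so is $\varphi:=\kappa^{-1}\circ\widetilde\kappa:A\otimes_BB'\to B'\otimes_BA$, which satisfies $\kappa\circ\varphi=\widetilde\kappa$.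 (2) $\varphi$ is a distributive law between the monads $(-)\otimes_BA$ and $(-)\otimes_BB'$ on $\mathcal M_B$: the maps $N\otimes_BA\otimes_BB'\to N\otimes_BB'\otimes_BA$, $n\otimes a\otimes b'\mapsto n\otimes\varphi(a\otimes b')$, are the components of a distributive law. (3) The resulting monad structure on the composition $(-)\otimes_B(B'\otimes_BA)=((-)\otimes_BA)\circ((-)\otimes_BB')$ comes from a monoid structure on $B'\otimes_BA$ in the monoidal category of $B$-bimodules right $H$-comodules, with multiplication $(b'\otimes a)(\tilde b'\otimes\tilde a)=b'\cdot\varphi(a\otimes_B\tilde b')\cdot\tilde a$ and unit $b\mapsto\beta(b)\otimes1$. In this way $B'\otimes_BA$ becomes a right $H$-comodule algebra equipped with an $H$-invariant algebra map $B\to B'\otimes_BA$. (4) With respect to this structure $\kappa$ is an isomorphism of right $H$-comodule algebras, and the maps $A\to B'\otimes_BA$, $a\mapsto1\otimes a$; $B'\to B'\otimes_BA$, $b'\mapsto b'\otimes1$; $B\to B'\otimes_BA$, $b\mapsto\beta(b)\otimes 1$; $A\to A'\Box^{H'}H$, $a\mapsto\alpha(a_{(0)})\otimes a_{(1)}$;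 $B'\to A'\Box^{H'}H$, $b'\mapsto b'1_{A'}\otimes1_H$, are $H$-colinear algebra maps ($B$, $B'$ with trivial coaction), while $A'\Box^{H'}H\to A'$, $\sum_i a'_i\otimes h_i\mapsto\sum_i a'_i\varepsilon(h_i)$, is an algebra map which is $H'$-colinear (through $\chi$). Together with $\alpha$, $\beta$, $\varphi_A$, $\varphi_{A'}$ and $\kappa$ they form a commutative diagram: the composites of $\kappa$ with $A\to B'\otimes_BA$ and with $B'\to B'\otimes_BA$ are the maps $A\to A'\Box^{H'}H$ and $B'\to A'\Box^{H'}H$; the composites $B\to A\to B'\otimes_BA$ and $B\to B'\to B'\otimes_BA$ both equal the map $B\to B'\otimes_BA$; and the composites $A\to A'\Box^{H'}H\to A'$ and $B'\to A'\Box^{H'}H\to A'$ are $\alpha$ and $\varphi_{A'}$. -/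

import Mathlib

open CategoryTheory TensorProduct

universe u

namespace HopfInv

section Coactions

variable {k : Type u} [Field k]

/-- A right coaction of the coalgebra `H` on the `k`-vector space `M`. -/
structure Coaction (k H M : Type u) [Field k] [Ring H] [Bialgebra k H]
    [AddCommGroup M] [Module k M] where
  ρ : M →ₗ[k] M ⊗[k] H
  coassoc : ∀ m, TensorProduct.assoc k M H H (ρ.rTensor H (ρ m)) =
    (Coalgebra.comul (R := k) (A := H)).lTensor M (ρ m)
  counit : ∀ m, TensorProduct.rid k M ((Coalgebra.counit (R := k) (A := H)).lTensor M (ρ m)) = m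

variable {H H' : Type u} [Ring H] [Bialgebra k H] [Ring H'] [Bialgebra k H']
variable {X Y Z : Type u} [AddCommGroup X] [Module k X] [AddCommGroup Y] [Module k Y]
  [AddCommGroup Z] [Module k Z]

/-- `IsColinear cX cY f`: the linear map `f` is a map of right `H`-comodules. -/
def IsColinear (cX : Coaction k H X) (cY : Coaction k H Y) (f : X →ₗ[k] Y) : Prop :=
  ∀ x, cY.ρ (f x) = f.rTensor H (cX.ρ x)

/-- For a bilinear map `p : X × Y → Z`, the bilinear map
`(x ⊗ h, y ⊗ g) ↦ p x y ⊗ h g`. -/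
def star (H : Type u) [Ring H] [Bialgebra k H] (p : X →ₗ[k] Y →ₗ[k] Z) :
    X ⊗[k] H →ₗ[k] Y ⊗[k] H →ₗ[k] Z ⊗[k] H :=
  TensorProduct.map₂ p (LinearMap.mul k H)

@[simp] lemma star_tmul (p : X →ₗ[k] Y →ₗ[k] Z) (x : X) (y : Y) (h g : H) :
    star H p (x ⊗ₜ h) (y ⊗ₜ g) = p x y ⊗ₜ[k] (h * g) := by
  simp [star, TensorProduct.map₂_apply_tmul]

lemma coassoc_star (p : X →ₗ[k] Y →ₗ[k] Z) (cX : Coaction k H X) (cY : Coaction k H Y)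
    (ρ : Z →ₗ[k] Z ⊗[k] H) (hρ : ∀ x y, ρ (p x y) = star H p (cX.ρ x) (cY.ρ y)) (x : X) (y : Y) :
    TensorProduct.assoc k Z H H (ρ.rTensor H (ρ (p x y))) =
      (Coalgebra.comul (R := k) (A := H)).lTensor Z (ρ (p x y)) := by
  let Ψ : X ⊗[k] (H ⊗[k] H) →ₗ[k] Y ⊗[k] (H ⊗[k] H) →ₗ[k] Z ⊗[k] (H ⊗[k] H) :=
    TensorProduct.map₂ p (LinearMap.mul k (H ⊗[k] H))
  have hΨ : ∀ x y s t, Ψ (x ⊗ₜ s) (y ⊗ₜ t) = p x y ⊗ₜ (s * t) := fun x y s t => by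
    simp [Ψ, TensorProduct.map₂_apply_tmul]
  have c1 : ∀ u v, TensorProduct.assoc k Z H H (ρ.rTensor H (star H p u v)) =
      Ψ (TensorProduct.assoc k X H H (cX.ρ.rTensor H u))
        (TensorProduct.assoc k Y H H (cY.ρ.rTensor H v)) := by
    intro u v
    induction u with
    | zero => simp
    | add a b ha hb => simp [ha, hb]
    | tmul x h =>
      induction v with
      | zero => simp
      | add a b ha hb => simp [ha, hb]
      | tmul y g =>
        simp only [star_tmul, LinearMap.rTensor_tmul, hρ]
        generalize cX.ρ x = s
        generalize cY.ρ y = t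
        induction s with
        | zero => simp
        | add a b ha hb => simp [ha, hb, add_tmul]
        | tmul x' h' =>
          induction t with
          | zero => simp
          | add a b ha hb => simp [ha, hb, add_tmul]
          | tmul y' g' => simp [hΨ]
  have c2 : ∀ u v, (Coalgebra.comul (R := k) (A := H)).lTensor Z (star H p u v) =
      Ψ ((Coalgebra.comul (R := k) (A := H)).lTensor X u)
        ((Coalgebra.comul (R := k) (A := H)).lTensor Y v) := by
    intro u v
    induction u with
    | zero => simp
    | add a b ha hb => simp [ha, hb]
    | tmul x h =>
      induction v with
      | zero => simp
      | add a b ha hb => simp [ha, hb]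
      | tmul y g => simp [hΨ]
  rw [hρ, c1, c2, cX.coassoc, cY.coassoc]

lemma counit_star (p : X →ₗ[k] Y →ₗ[k] Z) (cX : Coaction k H X) (cY : Coaction k H Y)
    (x : X) (y : Y) :
    TensorProduct.rid k Z ((Coalgebra.counit (R := k) (A := H)).lTensor Z
      (star H p (cX.ρ x) (cY.ρ y))) = p x y := by
  have c : ∀ u v, TensorProduct.rid k Z ((Coalgebra.counit (R := k) (A := H)).lTensor Z
      (star H p u v)) =
      p (TensorProduct.rid k X ((Coalgebra.counit (R := k) (A := H)).lTensor X u))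
        (TensorProduct.rid k Y ((Coalgebra.counit (R := k) (A := H)).lTensor Y v)) := by
    intro u v
    induction u with
    | zero => simp
    | add a b ha hb => simp [ha, hb]
    | tmul x h =>
      induction v with
      | zero => simp
      | add a b ha hb => simp [ha, hb]
      | tmul y g =>
        simp only [star_tmul, LinearMap.lTensor_tmul, TensorProduct.rid_tmul, map_smul,
          LinearMap.smul_apply, Bialgebra.counit_mul]
        rw [mul_comm, mul_smul]
  rw [c, cX.counit, cY.counit]

lemma star_rTensor {X' Y' Z' : Type u} [AddCommGroup X'] [Module k X'] [AddCommGroup Y']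
    [Module k Y'] [AddCommGroup Z'] [Module k Z']
    (p : X →ₗ[k] Y →ₗ[k] Z) (q : X' →ₗ[k] Y' →ₗ[k] Z')
    (f : X →ₗ[k] X') (g : Y →ₗ[k] Y') (l : Z →ₗ[k] Z')
    (hl : ∀ x y, l (p x y) = q (f x) (g y)) (u : X ⊗[k] H) (v : Y ⊗[k] H) :
    l.rTensor H (star H p u v) = star H q (f.rTensor H u) (g.rTensor H v) := by
  induction u with
  | zero => simp
  | add a b ha hb => simp [ha, hb]
  | tmul x h =>
    induction v with
    | zero => simp
    | add a b ha hb => simp [ha, hb]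
    | tmul y g => simp [hl]

lemma star_lTensor (p : X →ₗ[k] Y →ₗ[k] Z) (χ : H →ₐc[k] H') (u : X ⊗[k] H) (v : Y ⊗[k] H) :
    (χ : H →ₗ[k] H').lTensor Z (star H p u v) =
      star H' p ((χ : H →ₗ[k] H').lTensor X u) ((χ : H →ₗ[k] H').lTensor Y v) := by
  induction u with
  | zero => simp
  | add a b ha hb => simp [ha, hb]
  | tmul x h =>
    induction v with
    | zero => simp
    | add a b ha hb => simp [ha, hb]
    | tmul y g => simp

lemma star_assoc {W XY YW V : Type u} [AddCommGroup W] [Module k W] [AddCommGroup XY]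
    [Module k XY] [AddCommGroup YW] [Module k YW] [AddCommGroup V] [Module k V]
    (p : XY →ₗ[k] W →ₗ[k] V) (q : X →ₗ[k] Y →ₗ[k] XY)
    (r : X →ₗ[k] YW →ₗ[k] V) (s : Y →ₗ[k] W →ₗ[k] YW)
    (hh : ∀ x y w, p (q x y) w = r x (s y w))
    (u : X ⊗[k] H) (v : Y ⊗[k] H) (w : W ⊗[k] H) :
    star H p (star H q u v) w = star H r u (star H s v w) := by
  induction u with
  | zero => simp
  | add a b ha hb => simp [ha, hb]
  | tmul x h =>
    induction v with
    | zero => simp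
    | add a b ha hb => simp [ha, hb]
    | tmul y g =>
      induction w with
      | zero => simp
      | add a b ha hb => simp only [map_add, ha, hb]
      | tmul w g => simp [hh, mul_assoc]

/-- The `H'`-coaction induced by an `H`-coaction and `χ : H → H'`. -/
def Coaction.push (c : Coaction k H X) (χ : H →ₐc[k] H') : Coaction k H' X where
  ρ := (χ : H →ₗ[k] H').lTensor X ∘ₗ c.ρ
  coassoc m := by
    have h1 : ∀ u : X ⊗[k] H, TensorProduct.assoc k X H' H'
        (((χ : H →ₗ[k] H').lTensor X ∘ₗ c.ρ).rTensor H' ((χ : H →ₗ[k] H').lTensor X u)) =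
        (TensorProduct.map (χ : H →ₗ[k] H') (χ : H →ₗ[k] H')).lTensor X
          (TensorProduct.assoc k X H H (c.ρ.rTensor H u)) := by
      intro u
      induction u with
      | zero => simp
      | add a b ha hb => simp only [map_add, ha, hb]
      | tmul x h =>
        simp only [LinearMap.lTensor_tmul, LinearMap.rTensor_tmul, LinearMap.comp_apply]
        generalize c.ρ x = s
        induction s with
        | zero => simp
        | add a b ha hb => simp only [map_add, add_tmul, ha, hb]
        | tmul x' h' => simp
    have h2 : ∀ u : X ⊗[k] H, (Coalgebra.comul (R := k) (A := H')).lTensor X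
        ((χ : H →ₗ[k] H').lTensor X u) =
        (TensorProduct.map (χ : H →ₗ[k] H') (χ : H →ₗ[k] H')).lTensor X
          ((Coalgebra.comul (R := k) (A := H)).lTensor X u) := by
      intro u
      induction u with
      | zero => simp
      | add a b ha hb => simp only [map_add, ha, hb]
      | tmul x h =>
        simp only [LinearMap.lTensor_tmul]
        congr 1
        exact (CoalgHomClass.map_comp_comul_apply χ h).symm
    rw [LinearMap.comp_apply, h1, h2, c.coassoc]
  counit m := by
    have h : ∀ u : X ⊗[k] H, (Coalgebra.counit (R := k) (A := H')).lTensor X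
        ((χ : H →ₗ[k] H').lTensor X u) = (Coalgebra.counit (R := k) (A := H)).lTensor X u := by
      intro u
      induction u with
      | zero => simp
      | add a b ha hb => simp only [map_add, ha, hb]
      | tmul x h => simp
    rw [LinearMap.comp_apply, h, c.counit]

/-- The regular coaction of `H` on itself. -/
def Coaction.regular (k H : Type u) [Field k] [Ring H] [Bialgebra k H] : Coaction k H H where
  ρ := Coalgebra.comul
  coassoc m := Coalgebra.coassoc_apply m
  counit m := by simp

/-- The trivial coaction `m ↦ m ⊗ 1`. -/
def Coaction.trivial (k H M : Type u) [Field k] [Ring H] [Bialgebra k H]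
    [AddCommGroup M] [Module k M] : Coaction k H M where
  ρ := (TensorProduct.mk k M H).flip 1
  coassoc m := by simp [Algebra.TensorProduct.one_def]
  counit m := by simp

/-- The coaction on `M ⊗ H` through the second factor. -/
def Coaction.cofree (k H M : Type u) [Field k] [Ring H] [Bialgebra k H]
    [AddCommGroup M] [Module k M] : Coaction k H (M ⊗[k] H) where
  ρ := (TensorProduct.assoc k M H H).symm.toLinearMap ∘ₗ
    (Coalgebra.comul (R := k) (A := H)).lTensor M
  coassoc m := by
    induction m with
    | zero => simp
    | add a b ha hb => simp only [map_add, ha, hb]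
    | tmul x h =>
      have := congrArg (fun t => (TensorProduct.assoc k M H (H ⊗[k] H)).symm (x ⊗ₜ t))
        (Coalgebra.coassoc_apply (R := k) h)
      simp only [LinearMap.comp_apply, LinearMap.lTensor_tmul, LinearEquiv.coe_coe]
      have h1 : ∀ s : H ⊗[k] H, TensorProduct.assoc k (M ⊗[k] H) H H
          (LinearMap.rTensor H ((TensorProduct.assoc k M H H).symm.toLinearMap ∘ₗ
            (Coalgebra.comul (R := k) (A := H)).lTensor M)
            ((TensorProduct.assoc k M H H).symm (x ⊗ₜ s))) =
          (TensorProduct.assoc k M H (H ⊗[k] H)).symm (x ⊗ₜ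
            (TensorProduct.assoc k H H H) ((Coalgebra.comul (R := k) (A := H)).rTensor H s)) := by
        intro s
        induction s with
        | zero => simp
        | add a b ha hb => simp only [map_add, tmul_add, ha, hb]
        | tmul a b =>
          simp only [TensorProduct.assoc_symm_tmul, LinearMap.rTensor_tmul, LinearMap.comp_apply,
            LinearMap.lTensor_tmul, LinearEquiv.coe_coe]
          generalize (Coalgebra.comul (R := k) a) = r
          induction r with
          | zero => simp
          | add a b ha hb => simp only [map_add, tmul_add, add_tmul, ha, hb]
          | tmul a b => simp
      have h2 : ∀ s : H ⊗[k] H, (Coalgebra.comul (R := k) (A := H)).lTensor (M ⊗[k] H)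
            ((TensorProduct.assoc k M H H).symm (x ⊗ₜ s)) =
          (TensorProduct.assoc k M H (H ⊗[k] H)).symm (x ⊗ₜ
            ((Coalgebra.comul (R := k) (A := H)).lTensor H s)) := by
        intro s
        induction s with
        | zero => simp
        | add a b ha hb => simp only [map_add, tmul_add, ha, hb]
        | tmul a b => simp
      rw [h1, h2]
      exact this
  counit m := by
    induction m with
    | zero => simp
    | add a b ha hb => simp only [map_add, ha, hb]
    | tmul x h =>
      simp only [LinearMap.comp_apply, LinearMap.lTensor_tmul, LinearEquiv.coe_coe]
      have h1 : ∀ s : H ⊗[k] H, TensorProduct.rid k (M ⊗[k] H)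
          ((Coalgebra.counit (R := k) (A := H)).lTensor (M ⊗[k] H)
            ((TensorProduct.assoc k M H H).symm (x ⊗ₜ s))) =
          x ⊗ₜ (TensorProduct.rid k H ((Coalgebra.counit (R := k) (A := H)).lTensor H s)) := by
        intro s
        induction s with
        | zero => simp
        | add a b ha hb => simp only [map_add, tmul_add, ha, hb]
        | tmul a b => simp
      rw [h1]; simp

/-- A coaction restricts along an injective map that intertwines the candidate coaction. -/
def Coaction.ofInjective (c : Coaction k H Y) (i : X →ₗ[k] Y) (hi : Function.Injective i)
    (ρ : X →ₗ[k] X ⊗[k] H) (hρ : ∀ x, i.rTensor H (ρ x) = c.ρ (i x)) : Coaction k H X where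
  ρ := ρ
  coassoc m := by
    have hj : Function.Injective (i.rTensor (H ⊗[k] H)) :=
      Module.Flat.rTensor_preserves_injective_linearMap i hi
    apply hj
    have h1 : ∀ u : X ⊗[k] H, i.rTensor (H ⊗[k] H)
        (TensorProduct.assoc k X H H (ρ.rTensor H u)) =
        TensorProduct.assoc k Y H H (c.ρ.rTensor H (i.rTensor H u)) := by
      intro u
      induction u with
      | zero => simp
      | add a b ha hb => simp only [map_add, ha, hb]
      | tmul x h =>
        simp only [LinearMap.rTensor_tmul, ← hρ]
        generalize ρ x = s
        induction s with
        | zero => simp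
        | add a b ha hb => simp only [map_add, add_tmul, ha, hb]
        | tmul a b => simp
    have h2 : ∀ u : X ⊗[k] H, i.rTensor (H ⊗[k] H)
        ((Coalgebra.comul (R := k) (A := H)).lTensor X u) =
        (Coalgebra.comul (R := k) (A := H)).lTensor Y (i.rTensor H u) := by
      intro u
      induction u with
      | zero => simp
      | add a b ha hb => simp only [map_add, ha, hb]
      | tmul x h => simp
    rw [h1, h2, hρ, c.coassoc]
  counit m := by
    apply hi
    have h2 : ∀ u : X ⊗[k] H, i (TensorProduct.rid k X
        ((Coalgebra.counit (R := k) (A := H)).lTensor X u)) =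
        TensorProduct.rid k Y ((Coalgebra.counit (R := k) (A := H)).lTensor Y (i.rTensor H u)) := by
      intro u
      induction u with
      | zero => simp
      | add a b ha hb => simp only [map_add, ha, hb]
      | tmul x h => simp
    rw [h2, hρ, c.counit]

/-- The diagonal coaction `(x ⊗ y)₀ ⊗ (x ⊗ y)₁ = (x₀ ⊗ y₀) ⊗ x₁ y₁`. -/
def Coaction.diag (cX : Coaction k H X) (cY : Coaction k H Y) : Coaction k H (X ⊗[k] Y) where
  ρ := TensorProduct.lift ((star H (TensorProduct.mk k X Y)).compl₁₂ cX.ρ cY.ρ)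
  coassoc m := by
    induction m with
    | zero => simp
    | add a b ha hb => simp only [map_add, ha, hb]
    | tmul x y =>
      exact coassoc_star (TensorProduct.mk k X Y) cX cY _ (fun x y => by simp) x y
  counit m := by
    induction m with
    | zero => simp
    | add a b ha hb => simp only [map_add, ha, hb]
    | tmul x y =>
      simpa using counit_star (TensorProduct.mk k X Y) cX cY x y

/-- The cotensor product `M □^{H'} H`, the subspace of those `Σ m ⊗ h` in `M ⊗ H` with
`Σ m₀ ⊗ m₁ ⊗ h = Σ m ⊗ χ(h₁) ⊗ h₂`. -/
def cotensor (c : Coaction k H' X) (χ : H →ₐc[k] H') : Submodule k (X ⊗[k] H) :=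
  LinearMap.eqLocus ((TensorProduct.assoc k X H' H).toLinearMap ∘ₗ c.ρ.rTensor H)
    (((χ : H →ₗ[k] H').rTensor H ∘ₗ Coalgebra.comul).lTensor X)

lemma mem_cotensor (c : Coaction k H' X) (χ : H →ₐc[k] H') (x : X ⊗[k] H) :
    x ∈ cotensor c χ ↔ TensorProduct.assoc k X H' H (c.ρ.rTensor H x) =
      ((χ : H →ₗ[k] H').rTensor H ∘ₗ Coalgebra.comul).lTensor X x := Iff.rfl

/-- Functoriality of the cotensor product. -/
def cotensorMap {cX : Coaction k H' X} {cY : Coaction k H' Y} (χ : H →ₐc[k] H')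
    (f : X →ₗ[k] Y) (hf : IsColinear cX cY f) : cotensor cX χ →ₗ[k] cotensor cY χ :=
  (f.rTensor H).restrict (fun x hx => by
    rw [mem_cotensor] at hx ⊢
    have h1 : ∀ u : X ⊗[k] H, TensorProduct.assoc k Y H' H (cY.ρ.rTensor H (f.rTensor H u)) =
        f.rTensor (H' ⊗[k] H) (TensorProduct.assoc k X H' H (cX.ρ.rTensor H u)) := by
      intro u
      induction u with
      | zero => simp
      | add a b ha hb => simp only [map_add, ha, hb]
      | tmul x h =>
        simp only [LinearMap.rTensor_tmul, hf x]
        generalize cX.ρ x = s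
        induction s with
        | zero => simp
        | add a b ha hb => simp only [map_add, add_tmul, ha, hb]
        | tmul a b => simp
    rw [h1, hx, ← LinearMap.comp_apply, ← LinearMap.comp_apply, LinearMap.rTensor_comp_lTensor,
      LinearMap.lTensor_comp_rTensor])

@[simp] lemma cotensorMap_coe {cX : Coaction k H' X} {cY : Coaction k H' Y} (χ : H →ₐc[k] H')
    (f : X →ₗ[k] Y) (hf : IsColinear cX cY f) (x : cotensor cX χ) :
    (cotensorMap χ f hf x : Y ⊗[k] H) = f.rTensor H (x : X ⊗[k] H) := rfl

/-- `χ : H → H'` is left coflat: `H`, as a left `H'`-comodule through `χ`, is coflat, i.e.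
`(-) □^{H'} H` preserves short exact sequences of right `H'`-comodules. -/
def LeftCoflat (χ : H →ₐc[k] H') : Prop :=
  ∀ (L M N : Type u) [AddCommGroup L] [Module k L] [AddCommGroup M] [Module k M]
    [AddCommGroup N] [Module k N]
    (cL : Coaction k H' L) (cM : Coaction k H' M) (cN : Coaction k H' N)
    (f : L →ₗ[k] M) (g : M →ₗ[k] N) (hf : IsColinear cL cM f) (hg : IsColinear cM cN g),
    Function.Injective f → Function.Exact f g → Function.Surjective g →
    Function.Injective (cotensorMap χ f hf) ∧
      Function.Exact (cotensorMap χ f hf) (cotensorMap χ g hg) ∧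
      Function.Surjective (cotensorMap χ g hg)

lemma cofree_mem_range (c : Coaction k H' X) (χ : H →ₐc[k] H') (x : cotensor c χ) :
    (Coaction.cofree k H X).ρ x ∈ LinearMap.range ((cotensor c χ).subtype.rTensor H) := by
  set f := (TensorProduct.assoc k X H' H).toLinearMap ∘ₗ c.ρ.rTensor H with hf
  set g := ((χ : H →ₗ[k] H').rTensor H ∘ₗ Coalgebra.comul).lTensor X with hg
  have hex : Function.Exact (cotensor c χ).subtype (f - g) := by
    intro y
    simp [sub_eq_zero, mem_cotensor, hf, hg]
  have hex' := Module.Flat.rTensor_exact H hex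
  refine (hex' _).1 ?_
  let T : X ⊗[k] (H' ⊗[k] H) →ₗ[k] (X ⊗[k] (H' ⊗[k] H)) ⊗[k] H :=
    (TensorProduct.assoc k X (H' ⊗[k] H) H).symm.toLinearMap ∘ₗ
      ((TensorProduct.assoc k H' H H).symm.toLinearMap ∘ₗ
        (Coalgebra.comul (R := k) (A := H)).lTensor H').lTensor X
  have h1 : ∀ u : X ⊗[k] H, f.rTensor H ((Coaction.cofree k H X).ρ u) = T (f u) := by
    intro u
    induction u with
    | zero => simp
    | add a b ha hb => simp only [map_add, ha, hb]
    | tmul y h =>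
      simp only [Coaction.cofree, hf, LinearMap.comp_apply, LinearMap.lTensor_tmul,
        LinearMap.rTensor_tmul, LinearEquiv.coe_coe, T]
      have : ∀ s : H ⊗[k] H, ((TensorProduct.assoc k X H' H).toLinearMap ∘ₗ
          c.ρ.rTensor H).rTensor H ((TensorProduct.assoc k X H H).symm (y ⊗ₜ s)) =
          (TensorProduct.assoc k X (H' ⊗[k] H) H).symm
            (((TensorProduct.assoc k H' H H).symm.toLinearMap).lTensor X
              (TensorProduct.assoc k X H' (H ⊗[k] H) (c.ρ y ⊗ₜ s))) := by
        intro s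
        induction s with
        | zero => simp
        | add a b ha hb => simp only [map_add, tmul_add, ha, hb]
        | tmul a b =>
          simp only [TensorProduct.assoc_symm_tmul, LinearMap.rTensor_tmul, LinearMap.comp_apply,
            LinearEquiv.coe_coe]
          generalize c.ρ y = r
          induction r with
          | zero => simp
          | add a b ha hb => simp only [map_add, add_tmul, ha, hb]
          | tmul a b => simp
      rw [this]
      generalize c.ρ y = r
      induction r with
      | zero => simp
      | add a b ha hb => simp only [map_add, add_tmul, ha, hb]
      | tmul a b => simp
  have h2 : ∀ u : X ⊗[k] H, g.rTensor H ((Coaction.cofree k H X).ρ u) = T (g u) := by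
    intro u
    induction u with
    | zero => simp
    | add a b ha hb => simp only [map_add, ha, hb]
    | tmul y h =>
      simp only [Coaction.cofree, hg, LinearMap.comp_apply, LinearMap.lTensor_tmul,
        LinearEquiv.coe_coe, T]
      have e1 : ∀ s : H ⊗[k] H, (((χ : H →ₗ[k] H').rTensor H ∘ₗ
          Coalgebra.comul).lTensor X).rTensor H ((TensorProduct.assoc k X H H).symm (y ⊗ₜ s)) =
          (TensorProduct.assoc k X (H' ⊗[k] H) H).symm (y ⊗ₜ
            ((χ : H →ₗ[k] H').rTensor H).rTensor H (Coalgebra.comul.rTensor H s)) := by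
        intro s
        induction s with
        | zero => simp
        | add a b ha hb => simp only [map_add, tmul_add, ha, hb]
        | tmul a b => simp
      have e2 : ∀ s : H ⊗[k] H, (TensorProduct.assoc k H' H H).symm
          ((Coalgebra.comul (R := k) (A := H)).lTensor H' ((χ : H →ₗ[k] H').rTensor H s)) =
          ((χ : H →ₗ[k] H').rTensor H).rTensor H ((TensorProduct.assoc k H H H).symm
            (Coalgebra.comul.lTensor H s)) := by
        intro s
        induction s with
        | zero => simp
        | add a b ha hb => simp only [map_add, ha, hb]
        | tmul a b =>
          simp only [LinearMap.rTensor_tmul, LinearMap.lTensor_tmul]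
          generalize (Coalgebra.comul (R := k) b) = r
          induction r with
          | zero => simp
          | add a b ha hb => simp only [map_add, tmul_add, ha, hb]
          | tmul a b => simp
      rw [e1, e2, Coalgebra.coassoc_symm_apply]
  rw [LinearMap.rTensor_sub, LinearMap.sub_apply, h1, h2, ← map_sub]
  have : f (x : X ⊗[k] H) = g x := x.2
  rw [this, sub_self, map_zero]

lemma cotensor_rTensor_injective (c : Coaction k H' X) (χ : H →ₐc[k] H') :
    Function.Injective ((cotensor c χ).subtype.rTensor H) :=
  Module.Flat.rTensor_preserves_injective_linearMap _ (Submodule.subtype_injective _)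

/-- The `H`-coaction on `M □^{H'} H` through the second factor. -/
noncomputable def cotensorCoaction (c : Coaction k H' X) (χ : H →ₐc[k] H') :
    Coaction k H (cotensor c χ) :=
  Coaction.ofInjective (Coaction.cofree k H X) (cotensor c χ).subtype
    (Submodule.subtype_injective _)
    ((LinearEquiv.ofInjective _ (cotensor_rTensor_injective c χ)).symm.toLinearMap ∘ₗ
      LinearMap.codRestrict _ ((Coaction.cofree k H X).ρ ∘ₗ (cotensor c χ).subtype)
        (cofree_mem_range c χ))
    (fun x => by
      have := LinearEquiv.apply_symm_apply
        (LinearEquiv.ofInjective _ (cotensor_rTensor_injective c χ))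
        (⟨_, cofree_mem_range c χ x⟩)
      exact congrArg Subtype.val this)

lemma cotensorCoaction_spec (c : Coaction k H' X) (χ : H →ₐc[k] H') (x : cotensor c χ) :
    (cotensor c χ).subtype.rTensor H ((cotensorCoaction c χ).ρ x) =
      (Coaction.cofree k H X).ρ x := by
  have := LinearEquiv.apply_symm_apply
    (LinearEquiv.ofInjective _ (cotensor_rTensor_injective c χ))
    (⟨_, cofree_mem_range c χ x⟩)
  exact congrArg Subtype.val this

lemma Coaction.rho_mem_cotensor (c : Coaction k H X) (χ : H →ₐc[k] H') (x : X) :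
    c.ρ x ∈ cotensor (c.push χ) χ := by
  rw [mem_cotensor, LinearMap.lTensor_comp, LinearMap.comp_apply, ← c.coassoc]
  generalize c.ρ x = u
  induction u with
  | zero => simp
  | add a b ha hb => simp only [map_add, ha, hb]
  | tmul y h =>
    simp only [Coaction.push, LinearMap.rTensor_tmul, LinearMap.comp_apply]
    generalize c.ρ y = s
    induction s with
    | zero => simp
    | add a b ha hb => simp only [map_add, add_tmul, ha, hb]
    | tmul a b => simp

lemma star_mem_cotensor (p : X →ₗ[k] Y →ₗ[k] Z) (cX : Coaction k H' X) (cY : Coaction k H' Y)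
    (cZ : Coaction k H' Z) (χ : H →ₐc[k] H')
    (hρ : ∀ x y, cZ.ρ (p x y) = star H' p (cX.ρ x) (cY.ρ y))
    {u : X ⊗[k] H} {v : Y ⊗[k] H} (hu : u ∈ cotensor cX χ) (hv : v ∈ cotensor cY χ) :
    star H p u v ∈ cotensor cZ χ := by
  rw [mem_cotensor] at *
  let Ψ : X ⊗[k] (H' ⊗[k] H) →ₗ[k] Y ⊗[k] (H' ⊗[k] H) →ₗ[k] Z ⊗[k] (H' ⊗[k] H) :=
    TensorProduct.map₂ p (LinearMap.mul k (H' ⊗[k] H))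
  have hΨ : ∀ x y s t, Ψ (x ⊗ₜ s) (y ⊗ₜ t) = p x y ⊗ₜ (s * t) := fun x y s t => by
    simp [Ψ, TensorProduct.map₂_apply_tmul]
  have c1 : ∀ u v, TensorProduct.assoc k Z H' H (cZ.ρ.rTensor H (star H p u v)) =
      Ψ (TensorProduct.assoc k X H' H (cX.ρ.rTensor H u))
        (TensorProduct.assoc k Y H' H (cY.ρ.rTensor H v)) := by
    intro u v
    induction u with
    | zero => simp
    | add a b ha hb => simp [ha, hb]
    | tmul x h =>
      induction v with
      | zero => simp
      | add a b ha hb => simp [ha, hb]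
      | tmul y g =>
        simp only [star_tmul, LinearMap.rTensor_tmul, hρ]
        generalize cX.ρ x = s
        generalize cY.ρ y = t
        induction s with
        | zero => simp
        | add a b ha hb => simp [ha, hb, add_tmul]
        | tmul x' h' =>
          induction t with
          | zero => simp
          | add a b ha hb => simp [ha, hb, add_tmul]
          | tmul y' g' => simp [hΨ]
  have hmul : ∀ s t : H ⊗[k] H, (χ : H →ₗ[k] H').rTensor H (s * t) =
      (χ : H →ₗ[k] H').rTensor H s * (χ : H →ₗ[k] H').rTensor H t := fun s t =>
    map_mul (Algebra.TensorProduct.map (χ : H →ₐ[k] H') (AlgHom.id k H)) s t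
  have c2 : ∀ u v, ((χ : H →ₗ[k] H').rTensor H ∘ₗ Coalgebra.comul).lTensor Z (star H p u v) =
      Ψ (((χ : H →ₗ[k] H').rTensor H ∘ₗ Coalgebra.comul).lTensor X u)
        (((χ : H →ₗ[k] H').rTensor H ∘ₗ Coalgebra.comul).lTensor Y v) := by
    intro u v
    induction u with
    | zero => simp
    | add a b ha hb => simp [ha, hb]
    | tmul x h =>
      induction v with
      | zero => simp
      | add a b ha hb => simp [ha, hb]
      | tmul y g =>
        simp only [star_tmul, LinearMap.lTensor_tmul, LinearMap.comp_apply, hΨ,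
          Bialgebra.comul_mul, hmul]
  rw [c1, c2, hu, hv]

lemma cofree_star (p : X →ₗ[k] Y →ₗ[k] Z) (u : X ⊗[k] H) (v : Y ⊗[k] H) :
    (Coaction.cofree k H Z).ρ (star H p u v) =
      star H (star H p) ((Coaction.cofree k H X).ρ u) ((Coaction.cofree k H Y).ρ v) := by
  induction u with
  | zero => simp
  | add a b ha hb => simp [ha, hb]
  | tmul x h =>
    induction v with
    | zero => simp
    | add a b ha hb => simp [ha, hb]
    | tmul y g =>
      simp only [Coaction.cofree, star_tmul, LinearMap.comp_apply, LinearMap.lTensor_tmul,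
        LinearEquiv.coe_coe, Bialgebra.comul_mul]
      generalize Coalgebra.comul (R := k) h = s
      generalize Coalgebra.comul (R := k) g = t
      induction s with
      | zero => simp
      | add a b ha hb => simp only [map_add, tmul_add, add_mul, LinearMap.add_apply, ha, hb]
      | tmul x' h' =>
        induction t with
        | zero => simp
        | add a b ha hb => simp only [map_add, tmul_add, mul_add, ha, hb]
        | tmul y' g' => simp

lemma Coaction.cofree_rho (c : Coaction k H X) (x : X) :
    (Coaction.cofree k H X).ρ (c.ρ x) = c.ρ.rTensor H (c.ρ x) := by
  simp only [Coaction.cofree, LinearMap.comp_apply, LinearEquiv.coe_coe, ← c.coassoc,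
    LinearEquiv.symm_apply_apply]

/-- `Σ m ⊗ h ↦ Σ m ε(h)`. -/
def augment (k H X : Type u) [Field k] [Ring H] [Bialgebra k H] [AddCommGroup X] [Module k X] :
    X ⊗[k] H →ₗ[k] X :=
  (TensorProduct.rid k X).toLinearMap ∘ₗ (Coalgebra.counit (R := k) (A := H)).lTensor X

@[simp] lemma augment_tmul (x : X) (h : H) :
    augment k H X (x ⊗ₜ h) = Coalgebra.counit (R := k) h • x := by
  simp [augment]

lemma Coaction.augment_rho (c : Coaction k H X) (x : X) : augment k H X (c.ρ x) = x := c.counit x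

lemma augment_star (p : X →ₗ[k] Y →ₗ[k] Z) (u : X ⊗[k] H) (v : Y ⊗[k] H) :
    augment k H Z (star H p u v) = p (augment k H X u) (augment k H Y v) := by
  induction u with
  | zero => simp
  | add a b ha hb => simp [ha, hb]
  | tmul x h =>
    induction v with
    | zero => simp
    | add a b ha hb => simp [ha, hb]
    | tmul y g =>
      simp only [star_tmul, augment_tmul, map_smul, LinearMap.smul_apply, Bialgebra.counit_mul]
      rw [mul_comm, mul_smul]

lemma augment_rTensor (f : X →ₗ[k] Y) (u : X ⊗[k] H) :
    augment k H Y (f.rTensor H u) = f (augment k H X u) := by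
  induction u with
  | zero => simp
  | add a b ha hb => simp [ha, hb]
  | tmul x h => simp

lemma augment_cofree (u : X ⊗[k] H) :
    (augment k H X).rTensor H ((Coaction.cofree k H X).ρ u) = u := by
  induction u with
  | zero => simp
  | add a b ha hb => simp only [map_add, ha, hb]
  | tmul x h =>
    simp only [Coaction.cofree, LinearMap.comp_apply, LinearMap.lTensor_tmul, LinearEquiv.coe_coe]
    have : ∀ s : H ⊗[k] H, (augment k H X).rTensor H
        ((TensorProduct.assoc k X H H).symm (x ⊗ₜ s)) =
        x ⊗ₜ (TensorProduct.lid k H ((Coalgebra.counit (R := k) (A := H)).rTensor H s)) := by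
      intro s
      induction s with
      | zero => simp
      | add a b ha hb => simp only [map_add, tmul_add, ha, hb]
      | tmul a b => simp [TensorProduct.smul_tmul]
    rw [this]; simp

lemma rho_augment (c : Coaction k H' X) (χ : H →ₐc[k] H') {u : X ⊗[k] H}
    (hu : u ∈ cotensor c χ) : c.ρ (augment k H X u) = (χ : H →ₗ[k] H').lTensor X u := by
  rw [mem_cotensor] at hu
  have h0 := congrArg ((augment k H H').lTensor X) hu
  have h1 : ∀ u : X ⊗[k] H, (augment k H H').lTensor X
      (TensorProduct.assoc k X H' H (c.ρ.rTensor H u)) = c.ρ (augment k H X u) := by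
    intro u
    induction u with
    | zero => simp
    | add a b ha hb => simp only [map_add, ha, hb]
    | tmul x h =>
      simp only [LinearMap.rTensor_tmul, augment_tmul, map_smul]
      generalize c.ρ x = s
      induction s with
      | zero => simp
      | add a b ha hb => simp only [map_add, add_tmul, smul_add, ha, hb]
      | tmul a b => simp
  have h2 : ∀ u : X ⊗[k] H, (augment k H H').lTensor X
      (((χ : H →ₗ[k] H').rTensor H ∘ₗ Coalgebra.comul).lTensor X u) =
      (χ : H →ₗ[k] H').lTensor X u := by
    intro u
    induction u with
    | zero => simp
    | add a b ha hb => simp only [map_add, ha, hb]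
    | tmul x h =>
      simp only [LinearMap.lTensor_tmul, LinearMap.comp_apply, augment_rTensor]
      congr 2
      exact (Coaction.regular k H).counit h
  rw [h1, h2] at h0
  exact h0

end Coactions

section Modules

/-- A right module over the `k`-algebra `B`. -/
structure RMod (k B : Type u) [Field k] [Ring B] [Algebra k B] where
  carrier : Type u
  [grp : AddCommGroup carrier]
  [mod : Module k carrier]
  /-- `act m b` is `m · b`. -/
  act : carrier →ₗ[k] B →ₗ[k] carrier
  act_one : ∀ m, act m 1 = m
  act_mul : ∀ m b c, act m (b * c) = act (act m b) c

attribute [instance] RMod.grp RMod.mod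

variable {k B A : Type u} [Field k] [Ring B] [Algebra k B] [Ring A] [Algebra k A]

/-- A map of right modules. -/
@[ext]
structure RMod.Hom (M N : RMod k B) where
  lin : M.carrier →ₗ[k] N.carrier
  map_act : ∀ m b, lin (M.act m b) = N.act (lin m) b

/-- The category of right `B`-modules. -/
instance RMod.category : Category.{u} (RMod k B) where
  Hom M N := RMod.Hom M N
  id M := ⟨LinearMap.id, fun _ _ => rfl⟩
  comp f g := ⟨g.lin ∘ₗ f.lin, fun m b => by simp [f.map_act, g.map_act]⟩

@[ext] lemma RMod.hom_ext {M N : RMod k B} {f g : M ⟶ N} (h : f.lin = g.lin) : f = g :=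
  RMod.Hom.ext h

@[simp] lemma RMod.id_lin (M : RMod k B) : RMod.Hom.lin (𝟙 M) = LinearMap.id := rfl
@[simp] lemma RMod.comp_lin {M N P : RMod k B} (f : M ⟶ N) (g : N ⟶ P) :
    (f ≫ g).lin = g.lin ∘ₗ f.lin := rfl

/-- An algebra as a right module over itself. -/
def RMod.regular (k A : Type u) [Field k] [Ring A] [Algebra k A] : RMod k A where
  carrier := A
  act := LinearMap.mul k A
  act_one := by simp
  act_mul := by simp [mul_assoc]

/-- Restriction of scalars along `φ : B → A`, on objects. -/
def RMod.resObj (φ : B →ₐ[k] A) (M : RMod k A) : RMod k B where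
  carrier := M.carrier
  act := M.act.compl₂ φ.toLinearMap
  act_one := by simp [M.act_one]
  act_mul := by simp [M.act_mul]

/-- Restriction of scalars along `φ : B → A`. -/
def RMod.res (φ : B →ₐ[k] A) : RMod k A ⥤ RMod k B where
  obj M := M.resObj φ
  map f := ⟨f.lin, fun m b => f.map_act m (φ b)⟩

/-- The balanced tensor product `M ⊗_B L` of a right `B`-module and a left `B`-module, with
actions `r` and `l`. -/
def Bal {M L : Type u} [AddCommGroup M] [Module k M] [AddCommGroup L] [Module k L]
    (r : M →ₗ[k] B →ₗ[k] M) (l : B →ₗ[k] L →ₗ[k] L) : Type u :=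
  (M ⊗[k] L) ⧸ Submodule.span k
    {x : M ⊗[k] L | ∃ m b y, x = r m b ⊗ₜ[k] y - m ⊗ₜ[k] l b y}

section Bal

variable {M L P : Type u} [AddCommGroup M] [Module k M] [AddCommGroup L] [Module k L]
  [AddCommGroup P] [Module k P] (r : M →ₗ[k] B →ₗ[k] M) (l : B →ₗ[k] L →ₗ[k] L)

instance Bal.addCommGroup : AddCommGroup (Bal r l) :=
  inferInstanceAs (AddCommGroup ((M ⊗[k] L) ⧸ Submodule.span k
    {x : M ⊗[k] L | ∃ m b y, x = r m b ⊗ₜ[k] y - m ⊗ₜ[k] l b y}))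

instance Bal.module : Module k (Bal r l) :=
  inferInstanceAs (Module k ((M ⊗[k] L) ⧸ Submodule.span k
    {x : M ⊗[k] L | ∃ m b y, x = r m b ⊗ₜ[k] y - m ⊗ₜ[k] l b y}))

/-- The quotient map from `M ⊗ L`. -/
def Bal.proj : M ⊗[k] L →ₗ[k] Bal r l :=
  Submodule.mkQ (Submodule.span k
    {x : M ⊗[k] L | ∃ m b y, x = r m b ⊗ₜ[k] y - m ⊗ₜ[k] l b y})

/-- `Bal.mk r l m y` is `m ⊗_B y`. -/
def Bal.mk : M →ₗ[k] L →ₗ[k] Bal r l :=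
  (TensorProduct.mk k M L).compr₂ (Bal.proj r l)

lemma Bal.mk_balanced (m : M) (b : B) (y : L) :
    Bal.mk r l (r m b) y = Bal.mk r l m (l b y) := by
  refine (Submodule.Quotient.eq (Submodule.span k
    {x : M ⊗[k] L | ∃ m b y, x = r m b ⊗ₜ[k] y - m ⊗ₜ[k] l b y})).2 (Submodule.subset_span ⟨m, b, y, rfl⟩)

variable {r l}

/-- The linear map out of `M ⊗_B L` given by a balanced bilinear map. -/
def Bal.lift (g : M →ₗ[k] L →ₗ[k] P) (hg : ∀ m b y, g (r m b) y = g m (l b y)) :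
    Bal r l →ₗ[k] P :=
  Submodule.liftQ (Submodule.span k
    {x : M ⊗[k] L | ∃ m b y, x = r m b ⊗ₜ[k] y - m ⊗ₜ[k] l b y}) (TensorProduct.lift g) (by
    rw [Submodule.span_le]
    rintro _ ⟨m, b, y, rfl⟩
    simp [hg])

@[simp] lemma Bal.lift_mk (g : M →ₗ[k] L →ₗ[k] P) (hg : ∀ m b y, g (r m b) y = g m (l b y))
    (m : M) (y : L) : Bal.lift g hg (Bal.mk r l m y) = g m y :=
  TensorProduct.lift.tmul m y

lemma Bal.lin_ext {f g : Bal r l →ₗ[k] P} (h : ∀ m y, f (Bal.mk r l m y) = g (Bal.mk r l m y)) :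
    f = g := by
  refine Submodule.linearMap_qext (Submodule.span k
    {x : M ⊗[k] L | ∃ m b y, x = r m b ⊗ₜ[k] y - m ⊗ₜ[k] l b y}) ?_
  exact TensorProduct.ext' h

lemma Bal.induction {p : Bal r l → Prop} (h0 : p 0) (ha : ∀ x y, p x → p y → p (x + y))
    (hm : ∀ m y, p (Bal.mk r l m y)) (x : Bal r l) : p x := by
  obtain ⟨x, rfl⟩ := Submodule.Quotient.mk_surjective _ x
  induction x with
  | zero => exact h0
  | add a b h1 h2 => exact ha _ _ h1 h2
  | tmul m y => exact hm m y

end Bal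

/-- The left action of `B` on `A` through `φ : B → A`. -/
abbrev leftAct (φ : B →ₐ[k] A) : B →ₗ[k] A →ₗ[k] A := LinearMap.mul k A ∘ₗ φ.toLinearMap

section

variable (φ : B →ₐ[k] A) {P : Type u} [AddCommGroup P] [Module k P]

/-- The right action of `A` on `N ⊗_B A`, `(n ⊗ a) · c = n ⊗ a c`. -/
def indAct (N : RMod k B) :
    Bal N.act (leftAct φ) →ₗ[k] A →ₗ[k] Bal N.act (leftAct φ) :=
  Bal.lift (LinearMap.mk₂ k
      (fun n a => Bal.mk N.act (leftAct φ) n ∘ₗ LinearMap.mul k A a)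
      (fun _ _ _ => by ext; simp) (fun _ _ _ => by ext; simp)
      (fun _ _ _ => by ext; simp) (fun _ _ _ => by ext; simp))
    (fun n b a => by ext c; simp [Bal.mk_balanced, mul_assoc])

@[simp] lemma indAct_mk (N : RMod k B) (n : N.carrier) (a c : A) :
    indAct φ N (Bal.mk N.act (leftAct φ) n a) c = Bal.mk N.act (leftAct φ) n (a * c) := by
  simp [indAct]

/-- The right `A`-module `N ⊗_B A`. -/
def RMod.indObj (N : RMod k B) : RMod k A where
  carrier := Bal N.act (leftAct φ)
  act := indAct φ N
  act_one m := by
    induction m using Bal.induction with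
    | h0 => simp
    | ha x y hx hy => simp only [map_add, LinearMap.add_apply, hx, hy]
    | hm n a => simp
  act_mul m b c := by
    induction m using Bal.induction with
    | h0 => simp
    | ha x y hx hy => simp only [map_add, LinearMap.add_apply, hx, hy]
    | hm n a => simp [mul_assoc]

/-- `tmul φ N n a` is `n ⊗_B a` in `N ⊗_B A`. -/
def tmul (N : RMod k B) : N.carrier →ₗ[k] A →ₗ[k] (N.indObj φ).carrier :=
  Bal.mk N.act (leftAct φ)

lemma tmul_act (N : RMod k B) (n : N.carrier) (a c : A) :
    (N.indObj φ).act (tmul φ N n a) c = tmul φ N n (a * c) :=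
  indAct_mk φ N n a c

lemma tmul_balanced (N : RMod k B) (n : N.carrier) (b : B) (a : A) :
    tmul φ N (N.act n b) a = tmul φ N n (φ b * a) := Bal.mk_balanced _ _ _ _ _

variable {φ}

/-- The linear map out of `N ⊗_B A` given by a balanced bilinear map. -/
def indLift {N : RMod k B} (g : N.carrier →ₗ[k] A →ₗ[k] P)
    (hg : ∀ m b y, g (N.act m b) y = g m (φ b * y)) : (N.indObj φ).carrier →ₗ[k] P :=
  Bal.lift g hg

@[simp] lemma indLift_tmul {N : RMod k B} (g : N.carrier →ₗ[k] A →ₗ[k] P)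
    (hg : ∀ m b y, g (N.act m b) y = g m (φ b * y)) (n : N.carrier) (a : A) :
    indLift g hg (tmul φ N n a) = g n a := Bal.lift_mk _ _ _ _

lemma indLin_ext {N : RMod k B} {f g : (N.indObj φ).carrier →ₗ[k] P}
    (h : ∀ n a, f (tmul φ N n a) = g (tmul φ N n a)) : f = g := Bal.lin_ext h

lemma ind_induction {N : RMod k B} {p : (N.indObj φ).carrier → Prop} (h0 : p 0)
    (ha : ∀ x y, p x → p y → p (x + y)) (hm : ∀ n a, p (tmul φ N n a))
    (x : (N.indObj φ).carrier) : p x := Bal.induction h0 ha hm x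

lemma RMod.ind_hom_ext {N : RMod k B} {M : RMod k A} {f g : N.indObj φ ⟶ M}
    (h : ∀ n a, f.lin (tmul φ N n a) = g.lin (tmul φ N n a)) : f = g :=
  RMod.hom_ext (indLin_ext h)

/-- The map of right `A`-modules out of `N ⊗_B A` given by a suitable bilinear map. -/
def indLiftHom {N : RMod k B} {M : RMod k A} (g : N.carrier →ₗ[k] A →ₗ[k] M.carrier)
    (hg : ∀ m b y, g (N.act m b) y = g m (φ b * y))
    (hg' : ∀ m a c, g m (a * c) = M.act (g m a) c) : N.indObj φ ⟶ M where
  lin := indLift g hg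
  map_act m c := by
    induction m using ind_induction with
    | h0 => simp
    | ha x y hx hy => simp only [map_add, LinearMap.add_apply, hx, hy]
    | hm n a => rw [tmul_act, indLift_tmul, indLift_tmul, hg']

@[simp] lemma indLiftHom_tmul {N : RMod k B} {M : RMod k A}
    (g : N.carrier →ₗ[k] A →ₗ[k] M.carrier)
    (hg : ∀ m b y, g (N.act m b) y = g m (φ b * y))
    (hg' : ∀ m a c, g m (a * c) = M.act (g m a) c) (n : N.carrier) (a : A) :
    (indLiftHom g hg hg').lin (tmul φ N n a) = g n a := indLift_tmul g hg n a

variable (φ)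

/-- Functoriality of `N ⊗_B A` in `N`. -/
def RMod.indMap {M N : RMod k B} (f : M ⟶ N) : M.indObj φ ⟶ N.indObj φ :=
  indLiftHom (tmul φ N ∘ₗ f.lin)
    (fun m b a => by simp only [LinearMap.comp_apply, f.map_act, tmul_balanced])
    (fun m a c => by simp only [LinearMap.comp_apply, tmul_act])

@[simp] lemma RMod.indMap_tmul {M N : RMod k B} (f : M ⟶ N) (m : M.carrier) (a : A) :
    (RMod.indMap φ f).lin (tmul φ M m a) = tmul φ N (f.lin m) a := by
  simp [RMod.indMap]

/-- The functor `N ↦ N ⊗_B A`. -/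
def RMod.ind : RMod k B ⥤ RMod k A where
  obj N := N.indObj φ
  map f := RMod.indMap φ f
  map_id M := RMod.ind_hom_ext fun n a => by simp
  map_comp f g := RMod.ind_hom_ext fun n a => by simp

/-- The unit `n ↦ n ⊗ 1`. -/
def RMod.indUnit (N : RMod k B) : N ⟶ (N.indObj φ).resObj φ where
  lin := (tmul φ N).flip 1
  map_act n b := by
    change tmul φ N (N.act n b) 1 = (N.indObj φ).act (tmul φ N n 1) (φ b)
    rw [tmul_balanced, tmul_act, mul_one, one_mul]

/-- The counit `m ⊗ a ↦ m · a`. -/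
def RMod.indCounit (M : RMod k A) : (M.resObj φ).indObj φ ⟶ M :=
  indLiftHom (N := M.resObj φ) M.act (fun m b a => (M.act_mul m (φ b) a).symm) M.act_mul

@[simp] lemma RMod.indCounit_tmul (M : RMod k A) (m : (M.resObj φ).carrier) (a : A) :
    (RMod.indCounit φ M).lin (tmul φ (M.resObj φ) m a) = M.act m a :=
  indLiftHom_tmul (N := M.resObj φ) M.act (fun m b a => (M.act_mul m (φ b) a).symm) M.act_mul m a

/-- The adjunction between `- ⊗_B A` and restriction of scalars, with unit `n ↦ n ⊗ 1` and
counit `m ⊗ a ↦ m · a`. -/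
def RMod.indRes : RMod.ind φ ⊣ RMod.res φ :=
  Adjunction.mkOfUnitCounit
    { unit :=
        { app := fun N => RMod.indUnit φ N
          naturality := fun M N f => by
            apply RMod.hom_ext
            ext m
            exact (RMod.indMap_tmul φ f m 1).symm }
      counit :=
        { app := fun M => RMod.indCounit φ M
          naturality := fun M N f => RMod.ind_hom_ext (N := M.resObj φ) fun m a => by
            refine (congrArg (RMod.indCounit φ N).lin
              (RMod.indMap_tmul φ ((RMod.res φ).map f) m a)).trans ?_
            refine (RMod.indCounit_tmul φ N _ a).trans ?_
            exact (f.map_act m a).symm.trans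
              (congrArg f.lin (RMod.indCounit_tmul φ M m a)).symm }
      left_triangle := by
        ext N : 2
        refine RMod.ind_hom_ext (N := N) fun n a => ?_
        refine (congrArg (RMod.indCounit φ (N.indObj φ)).lin
          (RMod.indMap_tmul φ (RMod.indUnit φ N) n a)).trans ?_
        refine (RMod.indCounit_tmul φ (N.indObj φ) _ a).trans ?_
        exact (tmul_act φ N n 1 a).trans (congrArg (tmul φ N n) (one_mul a))
      right_triangle := by
        ext M : 2
        apply RMod.hom_ext
        ext m
        exact (RMod.indCounit_tmul φ M m 1).trans (M.act_one m) }

end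

/-- The monad `- ⊗_B A` on right `B`-modules given by `φ : B → A`, with unit `n ↦ n ⊗ 1` and
multiplication `(n ⊗ a) ⊗ c ↦ n ⊗ a c`. -/
abbrev tensorMonad (φ : B →ₐ[k] A) : CategoryTheory.Monad (RMod k B) := (RMod.indRes φ).toMonad

end Modules

section Monads

universe v w

variable {C : Type w} [Category.{v} C]

/-- A distributive law `S T ⟹ T S` between the monads `T` and `S`; here `T ⋙ S` is the
functor `X ↦ S (T X)`. -/
structure DistribLaw (T S : CategoryTheory.Monad C) where
  nat : T.toFunctor ⋙ S.toFunctor ⟶ S.toFunctor ⋙ T.toFunctor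
  unit_left : ∀ X, S.map (T.η.app X) ≫ nat.app X = T.η.app (S.obj X)
  unit_right : ∀ X, S.η.app (T.obj X) ≫ nat.app X = T.map (S.η.app X)
  mul_left : ∀ X, S.map (T.μ.app X) ≫ nat.app X =
    nat.app (T.obj X) ≫ T.map (nat.app X) ≫ T.μ.app (S.obj X)
  mul_right : ∀ X, S.μ.app (T.obj X) ≫ nat.app X =
    S.map (nat.app X) ≫ nat.app (S.obj X) ≫ T.map (S.μ.app X)

variable {T S : CategoryTheory.Monad C}

lemma DistribLaw.naturality (d : DistribLaw T S) {X Y : C} (f : X ⟶ Y) :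
    S.map (T.map f) ≫ d.nat.app Y = d.nat.app X ≫ T.map (S.map f) := d.nat.naturality f

/-- The composite monad `X ↦ T (S X)` given by a distributive law. -/
def DistribLaw.compMonad (d : DistribLaw T S) : CategoryTheory.Monad C where
  toFunctor := S.toFunctor ⋙ T.toFunctor
  η :=
    { app := fun X => S.η.app X ≫ T.η.app (S.obj X)
      naturality := fun X Y f => by
        have h1 := S.η.naturality f
        have h2 := T.η.naturality (S.map f)
        dsimp at h1 h2 ⊢
        rw [Category.assoc, ← h2, ← Category.assoc, h1, Category.assoc] }
  μ :=
    { app := fun X => T.map (d.nat.app (S.obj X)) ≫ T.μ.app (S.obj (S.obj X)) ≫ T.map (S.μ.app X)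
      naturality := fun X Y f => by
        have h1 := d.naturality (S.map f)
        have h2 := T.μ.naturality (S.map (S.map f))
        have h3 := S.μ.naturality f
        dsimp at h2 h3 ⊢
        simp only [Category.assoc]
        rw [← T.map_comp_assoc, h1, T.map_comp_assoc, reassoc_of% h2, ← T.map_comp, h3,
          T.map_comp] }
  assoc X := by
    have e1 := d.mul_left (S.obj X)
    have e2 := d.mul_right (S.obj X)
    have e3 := d.mul_left (S.obj (S.obj X))
    have n1 := d.naturality (S.μ.app X)
    have n5 := d.naturality (d.nat.app (S.obj X))
    have n2 := T.μ.naturality (S.map (d.nat.app (S.obj X)))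
    have n6 := T.μ.naturality (d.nat.app (S.obj (S.obj X)))
    have n3 := T.μ.naturality (S.map (S.μ.app X))
    have n4 := T.μ.naturality (S.μ.app (S.obj X))
    have a1 := T.assoc (S.obj (S.obj (S.obj X)))
    have a2 := S.assoc X
    dsimp at *
    simp only [Category.assoc, Functor.map_comp]
    rw [← T.map_comp_assoc (S.map (T.map (S.μ.app X))), n1, T.map_comp_assoc,
      ← T.map_comp_assoc (S.map (T.μ.app _)), e3]
    simp only [Category.assoc, Functor.map_comp]
    rw [← T.map_comp_assoc (S.map (T.map (d.nat.app (S.obj X)))), n5, T.map_comp_assoc,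
      reassoc_of% n3, reassoc_of% a1, ← T.map_comp (S.map (S.μ.app X)), a2]
    rw [← T.map_comp_assoc (S.μ.app (T.obj (S.obj X))), e2]
    simp only [Category.assoc, Functor.map_comp]
    rw [← reassoc_of% n2, ← reassoc_of% n6, reassoc_of% n4]
  left_unit X := by
    have h1 := d.unit_right (S.obj X)
    have n1 := T.η.naturality (d.nat.app (S.obj X))
    have u1 := T.left_unit (S.obj (S.obj X))
    have u2 := S.left_unit X
    dsimp at *
    simp only [Category.assoc]
    rw [← reassoc_of% n1, reassoc_of% u1, reassoc_of% h1, ← T.map_comp, u2, T.map_id]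
  right_unit X := by
    have h1 := d.unit_left (S.obj X)
    have n1 := d.naturality (S.η.app X)
    have u1 := T.right_unit (S.obj (S.obj X))
    have u2 := S.right_unit X
    dsimp at *
    simp only [Category.assoc, S.map_comp, T.map_comp]
    rw [← T.map_comp_assoc (S.map (T.η.app (S.obj X))), h1, reassoc_of% u1, ← T.map_comp, u2,
      T.map_id]

end Monads

section HopfModules

/-- A right `H`-comodule algebra structure on the algebra `A`. -/
structure ComodAlg (k H A : Type u) [Field k] [Ring H] [Bialgebra k H] [Ring A] [Algebra k A]
    extends Coaction k H A where
  map_one : ρ 1 = 1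
  map_mul : ∀ a b, ρ (a * b) = ρ a * ρ b

variable {k H H' A A' B B' : Type u} [Field k] [Ring H] [HopfAlgebra k H]
  [Ring H'] [HopfAlgebra k H'] [Ring A] [Algebra k A] [Ring A'] [Algebra k A']
  [Ring B] [Algebra k B] [Ring B'] [Algebra k B']

lemma star_mul (u v : A ⊗[k] H) : star H (LinearMap.mul k A) u v = u * v := by
  induction u with
  | zero => simp
  | add a b ha hb => simp only [map_add, LinearMap.add_apply, ha, hb, add_mul]
  | tmul x h =>
    induction v with
    | zero => simp
    | add a b ha hb => simp only [map_add, ha, hb, mul_add]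
    | tmul y g => simp

/-- A relative Hopf module: a right `A`-module and right `H`-comodule with
`(m a)₀ ⊗ (m a)₁ = m₀ a₀ ⊗ m₁ a₁`. -/
structure RelHopf (cA : ComodAlg k H A) extends RMod k A where
  coaction : Coaction k H carrier
  compat : ∀ m a, coaction.ρ (act m a) = star H act (coaction.ρ m) (cA.ρ a)

/-- A map of relative Hopf modules: right `A`-linear and right `H`-colinear. -/
@[ext]
structure RelHopf.Hom {cA : ComodAlg k H A} (M N : RelHopf cA) where
  hom : M.toRMod ⟶ N.toRMod
  colin : IsColinear M.coaction N.coaction hom.lin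

lemma IsColinear.comp {X Y Z : Type u} [AddCommGroup X] [Module k X] [AddCommGroup Y] [Module k Y]
    [AddCommGroup Z] [Module k Z] {cX : Coaction k H X} {cY : Coaction k H Y}
    {cZ : Coaction k H Z} {f : X →ₗ[k] Y} {g : Y →ₗ[k] Z} (hg : IsColinear cY cZ g)
    (hf : IsColinear cX cY f) : IsColinear cX cZ (g ∘ₗ f) := fun x => by
  rw [LinearMap.comp_apply, hg, hf, LinearMap.rTensor_comp, LinearMap.comp_apply]

/-- The category of relative `(A, H)`-Hopf modules. -/
instance RelHopf.category (cA : ComodAlg k H A) : Category.{u} (RelHopf cA) where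
  Hom M N := RelHopf.Hom M N
  id M := ⟨𝟙 _, fun x => by simp⟩
  comp f g := ⟨f.hom ≫ g.hom, g.colin.comp f.colin⟩

lemma RelHopf.hom_ext {cA : ComodAlg k H A} {M N : RelHopf cA} {f g : M ⟶ N}
    (h : ∀ x, f.hom.lin x = g.hom.lin x) : f = g :=
  RelHopf.Hom.ext (RMod.hom_ext (LinearMap.ext h))

/-- A Hopf-algebra-invariant algebra map `(H, A ← B)`: a right `H`-comodule algebra `A` and an
algebra map `B → A` which is colinear for the trivial coaction on `B`. -/
structure InvMap (k H A B : Type u) [Field k] [Ring H] [HopfAlgebra k H] [Ring A] [Algebra k A]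
    [Ring B] [Algebra k B] where
  comod : ComodAlg k H A
  incl : B →ₐ[k] A
  inv : ∀ b, comod.ρ (incl b) = incl b ⊗ₜ 1

/-- A morphism `(H', A' ← B') ← (H, A ← B)` of Hopf-algebra-invariant algebra maps. -/
structure InvMap.Mor (X : InvMap k H A B) (X' : InvMap k H' A' B') where
  χ : H →ₐc[k] H'
  α : A →ₐ[k] A'
  β : B →ₐ[k] B'
  colin : IsColinear (X.comod.push χ) X'.comod.toCoaction α.toLinearMap
  comm : ∀ b, X'.incl (β b) = α (X.incl b)

section

variable (φ : B →ₐ[k] A) (N : RMod k B) (cN : Coaction k H N.carrier) (cA : Coaction k H A)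
  (hb : ∀ n b a, star H (tmul φ N) (cN.ρ (N.act n b)) (cA.ρ a) =
    star H (tmul φ N) (cN.ρ n) (cA.ρ (φ b * a)))

/-- The linear map `n ⊗ a ↦ (n₀ ⊗ a₀) ⊗ n₁ a₁`. -/
def balRho : (N.indObj φ).carrier →ₗ[k] (N.indObj φ).carrier ⊗[k] H :=
  indLift ((star H (tmul φ N)).compl₁₂ cN.ρ cA.ρ) (by
    intro m b y
    simp only [LinearMap.compl₁₂_apply]
    exact hb m b y)

lemma balRho_tmul (n : N.carrier) (a : A) :
    balRho φ N cN cA hb (tmul φ N n a) = star H (tmul φ N) (cN.ρ n) (cA.ρ a) := by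
  simp [balRho]

/-- The diagonal coaction `(n ⊗ a)₀ ⊗ (n ⊗ a)₁ = (n₀ ⊗ a₀) ⊗ n₁ a₁` on a balanced tensor product
`N ⊗_B A`, when it is well defined. -/
def balCoaction : Coaction k H (N.indObj φ).carrier where
  ρ := balRho φ N cN cA hb
  coassoc m := by
    induction m using ind_induction with
    | h0 => simp
    | ha x y hx hy => simp only [map_add, hx, hy]
    | hm m a =>
      exact coassoc_star _ cN cA _ (fun x y => balRho_tmul φ N cN cA hb x y) m a
  counit m := by
    induction m using ind_induction with
    | h0 => simp
    | ha x y hx hy => simp only [map_add, hx, hy]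
    | hm m a =>
      rw [balRho_tmul]
      exact counit_star _ cN cA m a

lemma balCoaction_tmul (n : N.carrier) (a : A) :
    (balCoaction φ N cN cA hb).ρ (tmul φ N n a) = star H (tmul φ N) (cN.ρ n) (cA.ρ a) :=
  balRho_tmul φ N cN cA hb n a

end

section Functors

variable {X : InvMap k H A B} {X' : InvMap k H' A' B'} (F : (X.Mor X' : Type u))

lemma InvMap.Mor.rho_alpha (a : A) :
    X'.comod.ρ (F.α a) = F.α.toLinearMap.rTensor H' ((X.comod.push F.χ).ρ a) := F.colin a

lemma star_balanced (M : RelHopf X.comod) (m : M.carrier) (b : A) (y : A') :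
    star H' (tmul F.α M.toRMod) ((M.coaction.push F.χ).ρ (M.act m b)) (X'.comod.ρ y) =
      star H' (tmul F.α M.toRMod) ((M.coaction.push F.χ).ρ m) (X'.comod.ρ (F.α b * y)) := by
  have e1 : (M.coaction.push F.χ).ρ (M.act m b) =
      star H' M.act ((M.coaction.push F.χ).ρ m) ((X.comod.push F.χ).ρ b) := by
    simp only [Coaction.push, LinearMap.comp_apply, M.compat, star_lTensor]
  rw [e1, X'.comod.map_mul, ← star_mul, F.rho_alpha,
    star_assoc (tmul F.α M.toRMod) M.act (tmul F.α M.toRMod) (leftAct F.α)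
      (fun x y w => tmul_balanced _ _ _ _ _)]
  congr 1
  have := star_rTensor (H := H') (leftAct F.α) (LinearMap.mul k A') F.α.toLinearMap LinearMap.id
    LinearMap.id (fun x y => rfl) ((X.comod.push F.χ).ρ b) (X'.comod.ρ y)
  simpa using this

/-- The coaction `(m ⊗ a')₀ ⊗ (m ⊗ a')₁ = (m₀ ⊗ a'₀) ⊗ χ(m₁) a'₁` on `M ⊗_A A'`. -/
def indCoaction (M : RelHopf X.comod) : Coaction k H' (M.toRMod.indObj F.α).carrier :=
  balCoaction F.α M.toRMod (M.coaction.push F.χ) X'.comod.toCoaction (star_balanced F M)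

lemma indCoaction_tmul (M : RelHopf X.comod) (m : M.carrier) (a : A') :
    (indCoaction F M).ρ (tmul F.α M.toRMod m a) =
      star H' (tmul F.α M.toRMod) ((M.coaction.push F.χ).ρ m) (X'.comod.ρ a) :=
  balCoaction_tmul _ _ _ _ (star_balanced F M) m a

lemma IsColinear.push {Y Z : Type u} [AddCommGroup Y] [Module k Y] [AddCommGroup Z] [Module k Z]
    {cY : Coaction k H Y} {cZ : Coaction k H Z} {f : Y →ₗ[k] Z} (hf : IsColinear cY cZ f)
    (χ : H →ₐc[k] H') : IsColinear (cY.push χ) (cZ.push χ) f := fun m => by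
  simp only [Coaction.push, LinearMap.comp_apply, hf m]
  generalize cY.ρ m = u
  induction u with
  | zero => simp
  | add a b ha hb => simp only [map_add, ha, hb]
  | tmul x h => simp

lemma indMap_colin {M N : RelHopf X.comod} (f : M ⟶ N) :
    IsColinear (indCoaction F M) (indCoaction F N) (RMod.indMap F.α f.hom).lin := fun x => by
  induction x using ind_induction with
  | h0 => simp
  | ha x y hx hy => simp only [map_add, hx, hy]
  | hm m c =>
    rw [RMod.indMap_tmul, indCoaction_tmul, indCoaction_tmul, f.colin.push F.χ m]
    have := star_rTensor (H := H') (tmul F.α M.toRMod) (tmul F.α N.toRMod) f.hom.lin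
      LinearMap.id (RMod.indMap F.α f.hom).lin (fun x y => RMod.indMap_tmul _ _ _ _)
      ((M.coaction.push F.χ).ρ m) (X'.comod.ρ c)
    rw [this]
    simp

/-- The relative Hopf module `M ⊗_A A'`. -/
def pullObj (M : RelHopf X.comod) : RelHopf X'.comod where
  toRMod := M.toRMod.indObj F.α
  coaction := indCoaction F M
  compat m a := by
    induction m using ind_induction with
    | h0 => simp
    | ha x y hx hy => simp only [map_add, LinearMap.add_apply, hx, hy]
    | hm m c =>
      rw [tmul_act, indCoaction_tmul, indCoaction_tmul, X'.comod.map_mul, ← star_mul,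
        star_assoc _ (tmul F.α M.toRMod) (tmul F.α M.toRMod) (LinearMap.mul k A')
          (fun x y w => tmul_act _ _ _ _ _)]

/-- The functor `M ↦ M ⊗_A A'` from relative `(A, H)`-Hopf modules to relative
`(A', H')`-Hopf modules. -/
def pull : RelHopf X.comod ⥤ RelHopf X'.comod where
  obj M := pullObj F M
  map f := ⟨RMod.indMap F.α f.hom, indMap_colin F f⟩
  map_id M := RelHopf.hom_ext fun x => by
    exact LinearMap.congr_fun (congrArg RMod.Hom.lin ((RMod.ind F.α).map_id M.toRMod)) x
  map_comp f g := RelHopf.hom_ext fun x => by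
    exact LinearMap.congr_fun (congrArg RMod.Hom.lin ((RMod.ind F.α).map_comp f.hom g.hom)) x

lemma star_act_mem (M : RelHopf X'.comod) (x : cotensor (H := H) M.coaction F.χ) (a : A) :
    star H (M.act.compl₂ F.α.toLinearMap) (x : M.carrier ⊗[k] H) (X.comod.ρ a) ∈
      cotensor M.coaction F.χ := by
  refine star_mem_cotensor _ M.coaction (X.comod.push F.χ) M.coaction F.χ (fun m a => ?_)
    x.2 (X.comod.rho_mem_cotensor F.χ a)
  rw [LinearMap.compl₂_apply]
  refine (M.compat m (F.α a)).trans ?_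
  rw [F.rho_alpha]
  have := star_rTensor (H := H') (M.act.compl₂ F.α.toLinearMap) M.act LinearMap.id
    F.α.toLinearMap LinearMap.id (fun x y => rfl) (M.coaction.ρ m) ((X.comod.push F.χ).ρ a)
  simpa using this.symm

/-- The right action `(Σ m' ⊗ h) a = Σ m' α(a₀) ⊗ h a₁` of `A` on `M' □^{H'} H`. -/
def cotAct (M : RelHopf X'.comod) :
    cotensor (H := H) M.coaction F.χ →ₗ[k] A →ₗ[k] cotensor (H := H) M.coaction F.χ :=
  LinearMap.mk₂ k (fun x a => ⟨_, star_act_mem F M x a⟩)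
    (fun _ _ _ => by ext1; simp) (fun _ _ _ => by ext1; simp)
    (fun _ _ _ => by ext1; simp) (fun _ _ _ => by ext1; simp)

@[simp] lemma cotAct_coe (M : RelHopf X'.comod) (x : cotensor (H := H) M.coaction F.χ) (a : A) :
    (cotAct F M x a : M.carrier ⊗[k] H) =
      star H (M.act.compl₂ F.α.toLinearMap) (x : M.carrier ⊗[k] H) (X.comod.ρ a) := rfl

/-- The relative Hopf module `M' □^{H'} H`. -/
noncomputable def pushObj (M : RelHopf X'.comod) : RelHopf X.comod where
  carrier := cotensor (H := H) M.coaction F.χ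
  act := cotAct F M
  act_one x := by
    ext1
    rw [cotAct_coe, X.comod.map_one]
    generalize (x : M.carrier ⊗[k] H) = u
    induction u with
    | zero => simp
    | add a b ha hb => simp only [map_add, LinearMap.add_apply, ha, hb]
    | tmul m h => simp [Algebra.TensorProduct.one_def, M.act_one]
  act_mul x a b := by
    ext1
    rw [cotAct_coe, cotAct_coe, cotAct_coe, X.comod.map_mul, ← star_mul]
    exact (star_assoc _ _ _ _ (fun x y w => by simp [M.act_mul]) _ _ _).symm
  coaction := cotensorCoaction M.coaction F.χ
  compat x a := by
    apply cotensor_rTensor_injective M.coaction F.χ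
    rw [cotensorCoaction_spec, cotAct_coe, cofree_star, X.comod.cofree_rho,
      ← cotensorCoaction_spec]
    rw [star_rTensor (cotAct F M)
      ((star H (M.act.compl₂ F.α.toLinearMap)).compl₂ X.comod.ρ)
      (cotensor M.coaction F.χ).subtype LinearMap.id _ (fun x y => rfl)]
    have := star_rTensor (H := H) ((star H (M.act.compl₂ F.α.toLinearMap)).compl₂ X.comod.ρ)
      (star H (M.act.compl₂ F.α.toLinearMap)) LinearMap.id X.comod.ρ LinearMap.id
      (fun x y => rfl) ((cotensor M.coaction F.χ).subtype.rTensor H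
        ((cotensorCoaction M.coaction F.χ).ρ x)) (X.comod.ρ a)
    simpa using this.symm

lemma cotensorMap_colin {Y Z : Type u} [AddCommGroup Y] [Module k Y] [AddCommGroup Z]
    [Module k Z] {cY : Coaction k H' Y} {cZ : Coaction k H' Z} (χ : H →ₐc[k] H') (f : Y →ₗ[k] Z)
    (hf : IsColinear cY cZ f) :
    IsColinear (cotensorCoaction cY χ) (cotensorCoaction cZ χ) (cotensorMap χ f hf) := fun x => by
  apply cotensor_rTensor_injective cZ χ
  rw [cotensorCoaction_spec, ← LinearMap.comp_apply, ← LinearMap.rTensor_comp]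
  have e : (cotensor cZ χ).subtype ∘ₗ cotensorMap χ f hf =
    f.rTensor H ∘ₗ (cotensor cY χ).subtype := rfl
  rw [e, LinearMap.rTensor_comp, LinearMap.comp_apply, cotensorCoaction_spec, cotensorMap_coe]
  generalize (x : Y ⊗[k] H) = u
  induction u with
  | zero => simp
  | add a b ha hb => simp only [map_add, ha, hb]
  | tmul m h =>
    simp only [Coaction.cofree, LinearMap.comp_apply, LinearMap.rTensor_tmul,
      LinearMap.lTensor_tmul, LinearEquiv.coe_coe]
    generalize Coalgebra.comul (R := k) h = s
    induction s with
    | zero => simp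
    | add a b ha hb => simp only [map_add, tmul_add, ha, hb]
    | tmul a b => simp

/-- The functor `M' ↦ M' □^{H'} H` from relative `(A', H')`-Hopf modules to relative
`(A, H)`-Hopf modules. -/
noncomputable def push : RelHopf X'.comod ⥤ RelHopf X.comod where
  obj M := pushObj F M
  map {M N} f :=
    { hom :=
        { lin := cotensorMap F.χ f.hom.lin f.colin
          map_act := fun (x : cotensor (H := H) M.coaction F.χ) a => by
            apply Subtype.ext
            change f.hom.lin.rTensor H (star H (M.act.compl₂ F.α.toLinearMap)
              (x : M.carrier ⊗[k] H) (X.comod.ρ a)) = star H (N.act.compl₂ F.α.toLinearMap)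
              (f.hom.lin.rTensor H (x : M.carrier ⊗[k] H)) (X.comod.ρ a)
            rw [star_rTensor _ (N.act.compl₂ F.α.toLinearMap) f.hom.lin LinearMap.id _
              (fun x y => f.hom.map_act _ _)]
            simp }
      colin := cotensorMap_colin F.χ f.hom.lin f.colin }
  map_id M := RelHopf.hom_ext fun x => by
    apply Subtype.ext
    exact LinearMap.congr_fun (LinearMap.rTensor_id H M.carrier) _
  map_comp f g := RelHopf.hom_ext fun x => by
    apply Subtype.ext
    exact LinearMap.congr_fun (LinearMap.rTensor_comp H g.hom.lin f.hom.lin) _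

/-- The map `m ↦ m ⊗ 1` from `M` to `M ⊗_A A'`. -/
def insOne (M : RelHopf X.comod) : M.carrier →ₗ[k] (M.toRMod.indObj F.α).carrier :=
  (tmul F.α M.toRMod).flip 1

lemma insOne_apply (M : RelHopf X.comod) (m : M.carrier) :
    insOne F M m = tmul F.α M.toRMod m 1 := rfl

lemma insOne_colin (M : RelHopf X.comod) :
    IsColinear (M.coaction.push F.χ) (indCoaction F M) (insOne F M) := fun m => by
  rw [insOne_apply, indCoaction_tmul, X'.comod.map_one]
  generalize (M.coaction.push F.χ).ρ m = u
  induction u with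
  | zero => simp
  | add a b ha hb => simp only [map_add, LinearMap.add_apply, ha, hb]
  | tmul x h => simp [Algebra.TensorProduct.one_def, insOne_apply]

lemma insOne_act (M : RelHopf X.comod) (m : M.carrier) (a : A) :
    insOne F M (M.act m a) = (M.toRMod.indObj F.α).act (insOne F M m) (F.α a) := by
  rw [insOne_apply, insOne_apply, tmul_balanced, tmul_act, mul_one, one_mul]

/-- The linear map `m ↦ (m₀ ⊗ 1) ⊗ m₁`. -/
noncomputable def pushUnitLin (M : RelHopf X.comod) :
    M.carrier →ₗ[k] cotensor (H := H) (indCoaction F M) F.χ :=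
  cotensorMap F.χ (insOne F M) (insOne_colin F M) ∘ₗ
    M.coaction.ρ.codRestrict _ (M.coaction.rho_mem_cotensor F.χ)

lemma pushUnitLin_coe (M : RelHopf X.comod) (m : M.carrier) :
    (pushUnitLin F M m : (M.toRMod.indObj F.α).carrier ⊗[k] H) =
      (insOne F M).rTensor H (M.coaction.ρ m) := rfl

lemma pushUnitLin_act (M : RelHopf X.comod) (m : M.carrier) (a : A) :
    pushUnitLin F M (M.act m a) = cotAct F (pullObj F M) (pushUnitLin F M m) a := by
  apply Subtype.ext
  change (insOne F M).rTensor H (M.coaction.ρ (M.act m a)) =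
    star H ((M.toRMod.indObj F.α).act.compl₂ F.α.toLinearMap)
      ((insOne F M).rTensor H (M.coaction.ρ m)) (X.comod.ρ a)
  rw [M.compat,
    star_rTensor M.act ((M.toRMod.indObj F.α).act.compl₂ F.α.toLinearMap) (insOne F M)
      LinearMap.id _ (insOne_act F M), LinearMap.rTensor_id]
  rfl

/-- The unit `m ↦ (m₀ ⊗ 1) ⊗ m₁`. -/
noncomputable def pushUnit (M : RelHopf X.comod) : M ⟶ pushObj F (pullObj F M) where
  hom :=
    { lin := pushUnitLin F M
      map_act := pushUnitLin_act F M }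
  colin := (cotensorMap_colin F.χ _ (insOne_colin F M)).comp (fun m => by
    apply cotensor_rTensor_injective (M.coaction.push F.χ) F.χ
    rw [cotensorCoaction_spec, ← LinearMap.comp_apply, ← LinearMap.rTensor_comp]
    exact M.coaction.cofree_rho m)

/-- The map `Σ m' ⊗ h ↦ Σ m' ε(h)` from `M' □^{H'} H` to `M'`. -/
noncomputable def evalCot (M : RelHopf X'.comod) : (pushObj F M).carrier →ₗ[k] M.carrier :=
  augment k H M.carrier ∘ₗ (cotensor (H := H) M.coaction F.χ).subtype

lemma eval_cotensorCoaction (M : RelHopf X'.comod) (x : cotensor (H := H) M.coaction F.χ) :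
    (augment k H M.carrier ∘ₗ (cotensor (H := H) M.coaction F.χ).subtype).rTensor H
      ((cotensorCoaction M.coaction F.χ).ρ x) = x := by
  rw [LinearMap.rTensor_comp, LinearMap.comp_apply, cotensorCoaction_spec, augment_cofree]

lemma evalCot_act (M : RelHopf X'.comod) (x : (pushObj F M).carrier) (a : A) :
    evalCot F M ((pushObj F M).act x a) = M.act (evalCot F M x) (F.α a) := by
  have : ∀ x : cotensor (H := H) M.coaction F.χ, augment k H M.carrier (cotAct F M x a) =
      M.act (augment k H M.carrier (x : M.carrier ⊗[k] H)) (F.α a) := fun x => by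
    rw [cotAct_coe, augment_star, X.comod.augment_rho]
    rfl
  exact this x

lemma evalCot_colin (M : RelHopf X'.comod) :
    IsColinear ((pushObj F M).coaction.push F.χ) M.coaction (evalCot F M) := by
  have h1 : ∀ u : cotensor (H := H) M.coaction F.χ ⊗[k] H,
      (augment k H M.carrier ∘ₗ (cotensor (H := H) M.coaction F.χ).subtype).rTensor H'
        ((F.χ : H →ₗ[k] H').lTensor _ u) = (F.χ : H →ₗ[k] H').lTensor _
          ((augment k H M.carrier ∘ₗ (cotensor (H := H) M.coaction F.χ).subtype).rTensor H u) := by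
    intro u
    induction u with
    | zero => simp
    | add a b ha hb => simp only [map_add, ha, hb]
    | tmul x h => simp
  intro x
  refine (rho_augment M.coaction F.χ x.2).trans ?_
  refine Eq.trans ?_ (h1 ((cotensorCoaction M.coaction F.χ).ρ x)).symm
  exact congrArg _ (eval_cotensorCoaction F M x).symm

/-- The map `(Σ m' ⊗ h) ⊗ a' ↦ Σ m' ε(h) a'`. -/
noncomputable def pushCounitHom (M : RelHopf X'.comod) :
    (pushObj F M).toRMod.indObj F.α ⟶ M.toRMod :=
  indLiftHom (M.act ∘ₗ evalCot F M)
    (fun x a c => by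
      simp only [LinearMap.comp_apply]
      rw [evalCot_act, M.act_mul])
    (fun x a c => M.act_mul _ _ _)

lemma pushCounitHom_tmul (M : RelHopf X'.comod) (x : (pushObj F M).carrier) (a : A') :
    (pushCounitHom F M).lin (tmul F.α (pushObj F M).toRMod x a) = M.act (evalCot F M x) a := by
  simp [pushCounitHom]

/-- The counit `(Σ m' ⊗ h) ⊗ a' ↦ Σ m' ε(h) a'`. -/
noncomputable def pushCounit (M : RelHopf X'.comod) : pullObj F (pushObj F M) ⟶ M where
  hom := pushCounitHom F M
  colin := by
    have : IsColinear (indCoaction F (pushObj F M)) M.coaction (pushCounitHom F M).lin := by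
      intro x
      induction x using ind_induction with
      | h0 => simp
      | ha x y hx hy => simp only [map_add, hx, hy]
      | hm x c =>
        rw [pushCounitHom_tmul, indCoaction_tmul,
          star_rTensor (tmul F.α (pushObj F M).toRMod) M.act (evalCot F M) LinearMap.id _
            (pushCounitHom_tmul F M), M.compat, evalCot_colin F M x, LinearMap.rTensor_id]
        rfl
    exact this

/-- The adjunction between `- ⊗_A A'` and `- □^{H'} H`. -/
noncomputable def pullPush : pull F ⊣ push F :=
  Adjunction.mkOfUnitCounit
    { unit :=
        { app := fun M => pushUnit F M
          naturality := fun M N f => RelHopf.hom_ext fun m => by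
            apply Subtype.ext
            have h1 : (insOne F N).rTensor H (N.coaction.ρ (f.hom.lin m)) =
                (RMod.indMap F.α f.hom).lin.rTensor H
                  ((insOne F M).rTensor H (M.coaction.ρ m)) := by
              rw [f.colin m]
              generalize M.coaction.ρ m = u
              induction u with
              | zero => simp
              | add a b ha hb => simp only [map_add, ha, hb]
              | tmul x h => simp [insOne_apply]
            exact h1 }
      counit :=
        { app := fun M => pushCounit F M
          naturality := fun M N f => by
            apply RelHopf.Hom.ext
            refine RMod.ind_hom_ext (N := (pushObj F M).toRMod) fun x a => ?_
            refine (congrArg (pushCounitHom F N).lin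
              (RMod.indMap_tmul F.α ((push F).map f).hom x a)).trans ?_
            refine (pushCounitHom_tmul F N _ a).trans ?_
            refine Eq.trans ?_ (congrArg f.hom.lin (pushCounitHom_tmul F M x a)).symm
            rw [f.hom.map_act]
            congr 2
            exact augment_rTensor f.hom.lin _ }
      left_triangle := by
        ext M : 2
        apply RelHopf.Hom.ext
        refine RMod.ind_hom_ext (N := M.toRMod) fun m a => ?_
        refine (congrArg (pushCounitHom F (pullObj F M)).lin
          (RMod.indMap_tmul F.α (pushUnit F M).hom m a)).trans ?_
        refine (pushCounitHom_tmul F (pullObj F M) _ a).trans ?_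
        have h1 : augment k H _ ((insOne F M).rTensor H (M.coaction.ρ m)) = tmul F.α M.toRMod m 1 := by
          rw [augment_rTensor, M.coaction.augment_rho, insOne_apply]
        have h2 : (M.toRMod.indObj F.α).act
            (augment k H _ ((insOne F M).rTensor H (M.coaction.ρ m))) a =
            tmul F.α M.toRMod m a := by
          rw [h1, tmul_act, one_mul]
        exact h2
      right_triangle := by
        ext M : 2
        refine RelHopf.hom_ext fun x => ?_
        apply Subtype.ext
        have h1 : ∀ u : (pushObj F M).carrier ⊗[k] H, (pushCounitHom F M).lin.rTensor H
            ((insOne F (pushObj F M)).rTensor H u) = (evalCot F M).rTensor H u := by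
          intro u
          induction u with
          | zero => simp
          | add a b ha hb => simp only [map_add, ha, hb]
          | tmul x h =>
            simp only [LinearMap.rTensor_tmul, insOne_apply, pushCounitHom_tmul, M.act_one]
        refine (h1 ((pushObj F M).coaction.ρ x)).trans ?_
        exact eval_cotensorCoaction F M x }

end Functors

end HopfModules

section Coinvariants

variable {k H H' A A' B B' : Type u} [Field k] [Ring H] [HopfAlgebra k H]
  [Ring H'] [HopfAlgebra k H'] [Ring A] [Algebra k A] [Ring A'] [Algebra k A']
  [Ring B'] [Algebra k B'] [Ring B] [Algebra k B]

/-- The coinvariants `M^{co H} = {m | m₀ ⊗ m₁ = m ⊗ 1}`. -/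
def coinvSub {M : Type u} [AddCommGroup M] [Module k M] (c : Coaction k H M) : Submodule k M :=
  LinearMap.eqLocus c.ρ ((TensorProduct.mk k M H).flip 1)

lemma mem_coinvSub {M : Type u} [AddCommGroup M] [Module k M] (c : Coaction k H M) (m : M) :
    m ∈ coinvSub c ↔ c.ρ m = m ⊗ₜ[k] (1 : H) := Iff.rfl

section

variable (X : InvMap k H A B)

/-- The right `B`-module `M^{co H}` of a relative `(A, H)`-Hopf module `M`. -/
def coinvObj (M : RelHopf X.comod) : RMod k B where
  carrier := coinvSub M.coaction
  act := LinearMap.mk₂ k (fun m b => ⟨M.act m (X.incl b), by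
      have h := (mem_coinvSub _ _).1 m.2
      rw [mem_coinvSub, M.compat, h, X.inv, star_tmul, mul_one]⟩)
    (fun _ _ _ => by ext1; simp) (fun _ _ _ => by ext1; simp)
    (fun _ _ _ => by ext1; simp) (fun _ _ _ => by ext1; simp)
  act_one m := by ext1; simp [M.act_one]
  act_mul m b c := by ext1; simp [M.act_mul]

/-- The coinvariants functor from relative `(A, H)`-Hopf modules to right `B`-modules. -/
def coinv : RelHopf X.comod ⥤ RMod k B where
  obj M := coinvObj X M
  map {M N} f :=
    { lin := f.hom.lin.restrict (p := coinvSub M.coaction) (q := coinvSub N.coaction)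
        (fun m hm => by
          rw [mem_coinvSub] at hm ⊢
          rw [f.colin m, hm, LinearMap.rTensor_tmul])
      map_act := fun m b => Subtype.ext (f.hom.map_act _ _) }

end

variable {X : InvMap k H A B} {X' : InvMap k H' A' B'} (F : (X.Mor X' : Type u))

lemma tmul_one_mem_cotensor {M : Type u} [AddCommGroup M] [Module k M] (c : Coaction k H' M)
    (χ : H →ₐc[k] H') {m : M} (hm : m ∈ coinvSub c) : m ⊗ₜ[k] (1 : H) ∈ cotensor c χ := by
  rw [mem_coinvSub] at hm
  simp [mem_cotensor, hm, Algebra.TensorProduct.one_def]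

lemma tmul_one_mem_coinv (M : RelHopf X'.comod) (m : coinvSub M.coaction) :
    (⟨(m : M.carrier) ⊗ₜ 1, tmul_one_mem_cotensor _ F.χ m.2⟩ : cotensor (H := H) M.coaction F.χ) ∈
      coinvSub (cotensorCoaction M.coaction F.χ) := by
  rw [mem_coinvSub]
  apply cotensor_rTensor_injective M.coaction F.χ
  rw [cotensorCoaction_spec]
  simp [Coaction.cofree, Algebra.TensorProduct.one_def]

lemma cofree_eq_of_mem_coinv (M : RelHopf X'.comod) {x : cotensor (H := H) M.coaction F.χ}
    (hx : x ∈ coinvSub (cotensorCoaction M.coaction F.χ)) :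
    (x : M.carrier ⊗[k] H) = augment k H M.carrier (x : M.carrier ⊗[k] H) ⊗ₜ 1 := by
  rw [mem_coinvSub] at hx
  have h := congrArg ((augment k H M.carrier ∘ₗ
    (cotensor (H := H) M.coaction F.χ).subtype).rTensor H) hx
  rw [eval_cotensorCoaction] at h
  exact h

lemma augment_mem_coinv (M : RelHopf X'.comod) {x : cotensor (H := H) M.coaction F.χ}
    (hx : x ∈ coinvSub (cotensorCoaction M.coaction F.χ)) :
    augment k H M.carrier (x : M.carrier ⊗[k] H) ∈ coinvSub M.coaction := by
  have h := rho_augment M.coaction F.χ x.2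
  rw [mem_coinvSub, h]
  conv_lhs => rw [cofree_eq_of_mem_coinv F M hx]
  simp

/-- The isomorphism `M'^{co H'} ≅ (M' □^{H'} H)^{co H}`, `m' ↦ m' ⊗ 1`, with inverse
`Σ m' ⊗ h ↦ Σ m' ε(h)`. -/
noncomputable def squareIsoApp (M : RelHopf X'.comod) :
    (coinvObj X' M).resObj F.β ≅ coinvObj X (pushObj F M) where
  hom :=
    { lin := LinearMap.codRestrict (coinvSub (cotensorCoaction M.coaction F.χ))
        (LinearMap.codRestrict (cotensor (H := H) M.coaction F.χ)
          ((TensorProduct.mk k M.carrier H).flip 1 ∘ₗ (coinvSub M.coaction).subtype)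
          (fun m => tmul_one_mem_cotensor _ F.χ m.2))
        (tmul_one_mem_coinv F M)
      map_act := fun (m : coinvSub M.coaction) b => by
        apply Subtype.ext
        apply Subtype.ext
        change M.act m (X'.incl (F.β b)) ⊗ₜ[k] (1 : H) =
          star H (M.act.compl₂ F.α.toLinearMap) ((m : M.carrier) ⊗ₜ 1) (X.comod.ρ (X.incl b))
        rw [X.inv, star_tmul, F.comm]
        simp }
  inv :=
    { lin := LinearMap.codRestrict (coinvSub M.coaction)
        (augment k H M.carrier ∘ₗ (cotensor (H := H) M.coaction F.χ).subtype ∘ₗ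
          (coinvSub (cotensorCoaction M.coaction F.χ)).subtype)
        (fun x => augment_mem_coinv F M x.2)
      map_act := fun (x : coinvSub (cotensorCoaction M.coaction F.χ)) b => by
        apply Subtype.ext
        change augment k H M.carrier (star H (M.act.compl₂ F.α.toLinearMap)
          (x : cotensor (H := H) M.coaction F.χ) (X.comod.ρ (X.incl b))) =
          M.act (augment k H M.carrier (x : cotensor (H := H) M.coaction F.χ)) (X'.incl (F.β b))
        rw [augment_star, X.comod.augment_rho, F.comm]
        rfl }
  hom_inv_id := by
    apply RMod.hom_ext
    ext (m : coinvSub M.coaction)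
    apply Subtype.ext
    change augment k H M.carrier ((m : M.carrier) ⊗ₜ 1) = m
    simp
  inv_hom_id := by
    apply RMod.hom_ext
    ext (x : coinvSub (cotensorCoaction M.coaction F.χ))
    apply Subtype.ext
    apply Subtype.ext
    exact (cofree_eq_of_mem_coinv F M x.2).symm

/-- The natural isomorphism `f_* q'_* ≅ q_* f̃_*` making the square of right adjoints commute. -/
noncomputable def squareIso : coinv X' ⋙ RMod.res F.β ≅ push F ⋙ coinv X :=
  NatIso.ofComponents (fun M => squareIsoApp F M) (fun {M N} f => by
    apply RMod.hom_ext
    ext (m : coinvSub M.coaction)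
    apply Subtype.ext
    apply Subtype.ext
    exact (LinearMap.rTensor_tmul H f.hom.lin (1 : H) (m : M.carrier)).symm)

/-- The mate `f^* q_* ⟹ q'_* f̃^*` of the square, with respect to the adjunctions `f̃^* ⊣ f̃_*` and
`f^* ⊣ f_*`; on `M` it is a map `M^{co H} ⊗_B B' ⟶ (M ⊗_A A')^{co H'}`. -/
noncomputable def otherMate : coinv X ⋙ RMod.ind F.β ⟶ pull F ⋙ coinv X' :=
  ((mateEquiv (pullPush F) (RMod.indRes F.β)).symm
    (TwoSquare.mk _ _ _ _ (squareIso F).inv)).natTrans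

/-- For a comodule `V` and a comodule algebra `A`, the relative Hopf module `V ⊗ A` with diagonal
coaction and `(v ⊗ a) c = v ⊗ a c`. -/
def RelHopf.tensor (V : Type u) [AddCommGroup V] [Module k V] (cV : Coaction k H V)
    (cA : ComodAlg k H A) : RelHopf cA where
  carrier := V ⊗[k] A
  act := TensorProduct.lift (LinearMap.mk₂ k
      (fun v a => TensorProduct.mk k V A v ∘ₗ LinearMap.mul k A a)
      (fun _ _ _ => by ext; simp) (fun _ _ _ => by ext; simp [smul_tmul'])
      (fun _ _ _ => by ext; simp [tmul_add]) (fun _ _ _ => by ext; simp))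
  act_one m := by
    induction m with
    | zero => simp
    | add x y hx hy => simp only [map_add, LinearMap.add_apply, hx, hy]
    | tmul v a => simp
  act_mul m b c := by
    induction m with
    | zero => simp
    | add x y hx hy => simp only [map_add, LinearMap.add_apply, hx, hy]
    | tmul v a => simp [mul_assoc]
  coaction := Coaction.diag cV cA.toCoaction
  compat m c := by
    induction m with
    | zero => simp
    | add x y hx hy => simp only [map_add, LinearMap.add_apply, hx, hy]
    | tmul v a =>
      have h := star_assoc (H := H) (TensorProduct.lift (LinearMap.mk₂ k
          (fun v a => TensorProduct.mk k V A v ∘ₗ LinearMap.mul k A a)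
          (fun _ _ _ => by ext; simp) (fun _ _ _ => by ext; simp [smul_tmul'])
          (fun _ _ _ => by ext; simp [tmul_add]) (fun _ _ _ => by ext; simp)))
        (TensorProduct.mk k V A) (TensorProduct.mk k V A) (LinearMap.mul k A)
        (fun x y w => by simp) (cV.ρ v) (cA.ρ a) (cA.ρ c)
      simp only [Coaction.diag, TensorProduct.lift.tmul, LinearMap.mk₂_apply,
        LinearMap.comp_apply, TensorProduct.mk_apply, LinearMap.mul_apply',
        LinearMap.compl₁₂_apply, cA.map_mul, ← star_mul]
      exact h.symm

/-- The comodule algebra `A` as a relative Hopf module over itself. -/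
def RelHopf.regular (cA : ComodAlg k H A) : RelHopf cA where
  toRMod := RMod.regular k A
  coaction := cA.toCoaction
  compat a c := (cA.map_mul a c).trans (star_mul _ _).symm

end Coinvariants

section Bimodules

variable {k H B : Type u} [Field k] [Ring H] [Bialgebra k H] [Ring B] [Algebra k B]

/-- An object of the category of `B`-bimodules right `H`-comodules: the coaction is `B`-bilinear
(`B` has the trivial coaction). -/
structure BimodComod (k H B : Type u) [Field k] [Ring H] [Bialgebra k H] [Ring B] [Algebra k B]
    extends RMod k B where
  /-- `lact b m` is `b · m`. -/
  lact : B →ₗ[k] carrier →ₗ[k] carrier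
  one_lact : ∀ m, lact 1 m = m
  mul_lact : ∀ b c m, lact (b * c) m = lact b (lact c m)
  lact_act : ∀ b m c, lact b (act m c) = act (lact b m) c
  coaction : Coaction k H carrier
  coaction_lact : ∀ b m, coaction.ρ (lact b m) = (lact b).rTensor H (coaction.ρ m)
  coaction_act : ∀ m b, coaction.ρ (act m b) = (act.flip b).rTensor H (coaction.ρ m)

/-- Being a map of `B`-bimodules and right `H`-comodules. -/
structure BimodComod.IsHom (M N : BimodComod k H B) (f : M.carrier →ₗ[k] N.carrier) : Prop where
  map_lact : ∀ b m, f (M.lact b m) = N.lact b (f m)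
  map_act : ∀ m b, f (M.act m b) = N.act (f m) b
  colin : IsColinear M.coaction N.coaction f

/-- A monoid structure on `E` in the monoidal category of `B`-bimodules right `H`-comodules, with
tensor product `⊗_B` carrying the diagonal coaction and with unit object `B`: a multiplication
`E ⊗_B E → E` and a unit `B → E` which are maps of `B`-bimodules right `H`-comodules, associative
and unital. -/
structure BimodComod.Mon (E : BimodComod k H B) where
  mul : Bal E.act E.lact →ₗ[k] E.carrier
  one : B →ₗ[k] E.carrier
  mul_lact : ∀ b x y, mul (Bal.mk E.act E.lact (E.lact b x) y) =
    E.lact b (mul (Bal.mk E.act E.lact x y))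
  mul_act : ∀ x y b, mul (Bal.mk E.act E.lact x (E.act y b)) =
    E.act (mul (Bal.mk E.act E.lact x y)) b
  coaction_mul : ∀ x y, E.coaction.ρ (mul (Bal.mk E.act E.lact x y)) =
    star H ((Bal.mk E.act E.lact).compr₂ mul) (E.coaction.ρ x) (E.coaction.ρ y)
  one_lact : ∀ b c, one (b * c) = E.lact b (one c)
  one_act : ∀ b c, one (b * c) = E.act (one b) c
  coaction_one : ∀ b, E.coaction.ρ (one b) = one b ⊗ₜ 1
  mul_assoc : ∀ x y z, mul (Bal.mk E.act E.lact (mul (Bal.mk E.act E.lact x y)) z) =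
    mul (Bal.mk E.act E.lact x (mul (Bal.mk E.act E.lact y z)))
  one_mul : ∀ b x, mul (Bal.mk E.act E.lact (one b) x) = E.lact b x
  mul_one : ∀ x b, mul (Bal.mk E.act E.lact x (one b)) = E.act x b

variable {E : BimodComod k H B} (S : E.Mon)

/-- The algebra underlying a monoid, with product `x y = mul (x ⊗_B y)` and unit `one 1`. -/
def BimodComod.Mon.Alg (_ : E.Mon) : Type u := E.carrier

instance BimodComod.Mon.addCommGroup : AddCommGroup S.Alg := inferInstanceAs (AddCommGroup E.carrier)

instance BimodComod.Mon.module : Module k S.Alg := inferInstanceAs (Module k E.carrier)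

/-- The product as a bilinear map. -/
def BimodComod.Mon.mulBil : S.Alg →ₗ[k] S.Alg →ₗ[k] S.Alg := (Bal.mk E.act E.lact).compr₂ S.mul

instance BimodComod.Mon.ring : Ring S.Alg :=
  { BimodComod.Mon.addCommGroup S with
    mul := fun x y => S.mulBil x y
    one := S.one 1
    left_distrib := fun x y z => map_add (S.mulBil x) y z
    right_distrib := fun x y z => LinearMap.map_add₂ S.mulBil x y z
    zero_mul := fun x => LinearMap.map_zero₂ S.mulBil x
    mul_zero := fun x => map_zero (S.mulBil x)
    mul_assoc := S.mul_assoc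
    one_mul := fun x => (S.one_mul 1 x).trans (E.one_lact x)
    mul_one := fun x => (S.mul_one x 1).trans (E.act_one x) }

lemma BimodComod.Mon.mul_def (x y : S.Alg) : x * y = S.mulBil x y := rfl

instance BimodComod.Mon.algebra : Algebra k S.Alg :=
  Algebra.ofModule (fun r x y => LinearMap.map_smul₂ S.mulBil r x y)
    (fun r x y => map_smul (S.mulBil x) r y)

lemma BimodComod.Mon.mul_eq : LinearMap.mul k S.Alg = S.mulBil :=
  LinearMap.ext₂ fun _ _ => rfl

lemma BimodComod.Mon.star_mulBil (u v : S.Alg ⊗[k] H) : star H S.mulBil u v = u * v := by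
  rw [← S.mul_eq]
  induction u with
  | zero => simp
  | add a b ha hb => simp only [map_add, LinearMap.add_apply, ha, hb, add_mul]
  | tmul x h =>
    induction v with
    | zero => simp
    | add a b ha hb => simp only [map_add, ha, hb, mul_add]
    | tmul y g => simp

/-- The coaction on the algebra underlying a monoid. -/
def BimodComod.Mon.algRho : S.Alg →ₗ[k] S.Alg ⊗[k] H := E.coaction.ρ

lemma BimodComod.Mon.algRho_mul (x y : S.Alg) :
    S.algRho (x * y) = S.algRho x * S.algRho y := by
  rw [← S.star_mulBil]
  exact S.coaction_mul x y

/-- The underlying comodule algebra of a monoid. -/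
def BimodComod.Mon.comodAlg : ComodAlg k H S.Alg where
  ρ := S.algRho
  coassoc := E.coaction.coassoc
  counit := E.coaction.counit
  map_one := S.coaction_one 1
  map_mul := S.algRho_mul

/-- The unit of a monoid, as a function `B → S.Alg`. -/
def BimodComod.Mon.oneFun (b : B) : S.Alg := S.one b

lemma BimodComod.Mon.oneFun_mul (b c : B) : S.oneFun (b * c) = S.oneFun b * S.oneFun c :=
  (S.one_act b c).trans (S.mul_one (S.one b) c).symm

/-- The unit of a monoid, as an algebra map `B → S.Alg`. -/
def BimodComod.Mon.unitHom : B →ₐ[k] S.Alg where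
  toFun b := S.oneFun b
  map_one' := rfl
  map_mul' b c := S.oneFun_mul b c
  map_zero' := map_zero S.one
  map_add' b c := map_add S.one b c
  commutes' r := by
    rw [Algebra.algebraMap_eq_smul_one, Algebra.algebraMap_eq_smul_one]
    exact map_smul S.one r 1

/-- The Hopf-algebra-invariant algebra map `B → S.Alg` given by a monoid. -/
def BimodComod.Mon.invMap {H : Type u} [Ring H] [HopfAlgebra k H] {E : BimodComod k H B}
    (S : E.Mon) : InvMap k H S.Alg B where
  comod := S.comodAlg
  incl := S.unitHom
  inv b := S.coaction_one b

end Bimodules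

section TensorBimod

variable {k H B R C : Type u} [Field k] [Ring H] [HopfAlgebra k H] [Ring B] [Algebra k B]
  [Ring R] [Algebra k R] [Ring C] [Algebra k C]

/-- The coaction on the algebra `R` is `B`-bilinear for `φ : B → R`. -/
structure BLinear (c : Coaction k H R) (φ : B →ₐ[k] R) : Prop where
  left : ∀ b r, c.ρ (φ b * r) = (LinearMap.mulLeft k (φ b)).rTensor H (c.ρ r)
  right : ∀ r b, c.ρ (r * φ b) = (LinearMap.mulRight k (φ b)).rTensor H (c.ρ r)

lemma BLinear.trivial (φ : B →ₐ[k] R) : BLinear (Coaction.trivial k H R) φ :=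
  ⟨fun b r => by simp [Coaction.trivial], fun r b => by simp [Coaction.trivial]⟩

lemma one_star (r : R) (u : R ⊗[k] H) :
    (r ⊗ₜ 1 : R ⊗[k] H) * u = (LinearMap.mulLeft k r).rTensor H u := by
  induction u with
  | zero => simp
  | add a b ha hb => simp only [map_add, mul_add, ha, hb]
  | tmul x h => simp

lemma star_one (r : R) (u : R ⊗[k] H) :
    u * (r ⊗ₜ 1 : R ⊗[k] H) = (LinearMap.mulRight k r).rTensor H u := by
  induction u with
  | zero => simp
  | add a b ha hb => simp only [map_add, add_mul, ha, hb]
  | tmul x h => simp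

lemma BLinear.of_inv (c : ComodAlg k H R) (φ : B →ₐ[k] R) (h : ∀ b, c.ρ (φ b) = φ b ⊗ₜ 1) :
    BLinear c.toCoaction φ :=
  ⟨fun b r => by rw [c.map_mul, h, one_star], fun r b => by rw [c.map_mul, h, star_one]⟩

/-- The algebra `R` as a right `B`-module through `φ : B → R`. -/
abbrev algMod (φ : B →ₐ[k] R) : RMod k B := (RMod.regular k R).resObj φ

variable {cR : Coaction k H R} {cC : Coaction k H C} {φ : B →ₐ[k] R} {ψ : B →ₐ[k] C}

/-- The algebra `R` as a `B`-bimodule right `H`-comodule through `φ : B → R`. -/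
def algBimod (hR : BLinear cR φ) : BimodComod k H B where
  toRMod := algMod φ
  lact := (leftAct φ : B →ₗ[k] R →ₗ[k] R)
  one_lact := fun (r : R) => by
    change φ 1 * r = r
    simp
  mul_lact := fun b c (r : R) => by
    change φ (b * c) * r = φ b * (φ c * r)
    rw [map_mul, mul_assoc]
  lact_act := fun b (r : R) c => (mul_assoc (φ b) r (φ c)).symm
  coaction := cR
  coaction_lact := hR.left
  coaction_act := hR.right

lemma BLinear.balanced (hC : BLinear cC ψ) (P : BimodComod k H B) (n : P.carrier) (b : B)
    (a : C) :
    star H (tmul ψ P.toRMod) (P.coaction.ρ (P.act n b)) (cC.ρ a) =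
      star H (tmul ψ P.toRMod) (P.coaction.ρ n) (cC.ρ (ψ b * a)) := by
  rw [hC.left, P.coaction_act]
  generalize P.coaction.ρ n = u
  generalize cC.ρ a = v
  induction u with
  | zero => simp
  | add a b ha hb => simp only [map_add, LinearMap.add_apply, ha, hb]
  | tmul x h =>
    induction v with
    | zero => simp
    | add a b ha hb => simp only [map_add, ha, hb]
    | tmul y g =>
      simp only [LinearMap.rTensor_tmul, star_tmul, LinearMap.flip_apply,
        LinearMap.mulLeft_apply, tmul_balanced]

/-- Left multiplication by `b`, as a map of right `B`-modules. -/
def lactHom (P : BimodComod k H B) (b : B) : P.toRMod ⟶ P.toRMod where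
  lin := P.lact b
  map_act x c := P.lact_act b x c

/-- The tensor product `P ⊗_B C` of a `B`-bimodule right `H`-comodule `P` and of an algebra `C`
with an algebra map from `B` and a `B`-bilinear coaction: `b (p ⊗ c) b̃ = b p ⊗ c b̃`, and the
coaction is diagonal, `(p ⊗ c)₀ ⊗ (p ⊗ c)₁ = (p₀ ⊗ c₀) ⊗ p₁ c₁`. -/
def tensorBimod (P : BimodComod k H B) (hC : BLinear cC ψ) : BimodComod k H B where
  toRMod := (P.toRMod.indObj ψ).resObj ψ
  lact :=
    { toFun := fun b => (RMod.indMap ψ (lactHom P b)).lin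
      map_add' := fun b c => indLin_ext (N := P.toRMod) fun n a => by
        refine (RMod.indMap_tmul ψ (lactHom P (b + c)) n a).trans ?_
        refine Eq.trans ?_ (congrArg₂ (· + ·) (RMod.indMap_tmul ψ (lactHom P b) n a)
          (RMod.indMap_tmul ψ (lactHom P c) n a)).symm
        simp [lactHom]
      map_smul' := fun r b => indLin_ext (N := P.toRMod) fun n a => by
        refine (RMod.indMap_tmul ψ (lactHom P (r • b)) n a).trans ?_
        refine Eq.trans ?_ (congrArg (r • ·) (RMod.indMap_tmul ψ (lactHom P b) n a)).symm
        simp [lactHom] }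
  one_lact m := by
    have : (RMod.indMap ψ (lactHom P 1)).lin = LinearMap.id := indLin_ext fun n a => by
      simp [lactHom, P.one_lact]
    exact LinearMap.congr_fun this m
  mul_lact b c m := by
    have : (RMod.indMap ψ (lactHom P (b * c))).lin =
        (RMod.indMap ψ (lactHom P b)).lin ∘ₗ (RMod.indMap ψ (lactHom P c)).lin :=
      indLin_ext fun n a => by simp [lactHom, P.mul_lact]
    exact LinearMap.congr_fun this m
  lact_act b m c := (RMod.indMap ψ (lactHom P b)).map_act m (ψ c)
  coaction := balCoaction ψ P.toRMod P.coaction cC (hC.balanced P)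
  coaction_lact b m := by
    have key : ∀ x : (P.toRMod.indObj ψ).carrier,
        (balCoaction ψ P.toRMod P.coaction cC (hC.balanced P)).ρ
          ((RMod.indMap ψ (lactHom P b)).lin x) =
        ((RMod.indMap ψ (lactHom P b)).lin).rTensor H
          ((balCoaction ψ P.toRMod P.coaction cC (hC.balanced P)).ρ x) := fun x => by
      induction x using ind_induction with
      | h0 => simp
      | ha x y hx hy => simp only [map_add, hx, hy]
      | hm r c =>
        rw [RMod.indMap_tmul, balCoaction_tmul, balCoaction_tmul]
        rw [star_rTensor (tmul ψ P.toRMod) (tmul ψ P.toRMod) (P.lact b)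
          LinearMap.id (RMod.indMap ψ (lactHom P b)).lin
          (fun x y => RMod.indMap_tmul ψ (lactHom P b) x y)]
        rw [LinearMap.rTensor_id, LinearMap.id_apply]
        exact congrArg (fun t => star H (tmul ψ P.toRMod) t (cC.ρ c)) (P.coaction_lact b r)
    exact key m
  coaction_act m b := by
    have key : ∀ x : (P.toRMod.indObj ψ).carrier,
        (balCoaction ψ P.toRMod P.coaction cC (hC.balanced P)).ρ
          ((P.toRMod.indObj ψ).act x (ψ b)) =
        ((P.toRMod.indObj ψ).act.flip (ψ b)).rTensor H
          ((balCoaction ψ P.toRMod P.coaction cC (hC.balanced P)).ρ x) := fun x => by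
      induction x using ind_induction with
      | h0 => simp
      | ha x y hx hy => simp only [map_add, LinearMap.add_apply, hx, hy]
      | hm r c =>
        rw [tmul_act, balCoaction_tmul, balCoaction_tmul]
        rw [star_rTensor (tmul ψ P.toRMod) (tmul ψ P.toRMod) LinearMap.id
          (LinearMap.mulRight k (ψ b)) ((P.toRMod.indObj ψ).act.flip (ψ b))
          (fun x y => tmul_act ψ P.toRMod x y (ψ b))]
        rw [LinearMap.rTensor_id, LinearMap.id_apply, hC.right]
    exact key m

end TensorBimod

section Main

variable {k H H' A A' B B' : Type u} [Field k] [Ring H] [HopfAlgebra k H]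
  [Ring H'] [HopfAlgebra k H'] [Ring A] [Algebra k A] [Ring A'] [Algebra k A']
  [Ring B] [Algebra k B] [Ring B'] [Algebra k B']
  {X : InvMap k H A B} {X' : InvMap k H' A' B'} (F : (X.Mor X' : Type u))

/-- The cotensor product `A' □^{H'} H`, as a subalgebra of `A' ⊗ H`: the multiplication is
`(Σ a'ᵢ ⊗ hᵢ) (Σ a'ⱼ ⊗ hⱼ) = Σ a'ᵢ a'ⱼ ⊗ hᵢ hⱼ`. -/
def cotAlg : Subalgebra k (A' ⊗[k] H) :=
  (cotensor (H := H) X'.comod.toCoaction F.χ).toSubalgebra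
    (tmul_one_mem_cotensor X'.comod.toCoaction F.χ
      ((mem_coinvSub X'.comod.toCoaction 1).2 X'.comod.map_one))
    (fun u v hu hv => by
      rw [← star_mul]
      exact star_mem_cotensor _ X'.comod.toCoaction X'.comod.toCoaction X'.comod.toCoaction F.χ
        (fun x y => by rw [LinearMap.mul_apply', X'.comod.map_mul, star_mul]) hu hv)

/-- The algebra map `b' ↦ b' 1 ⊗ 1` from `B'` to `A' □^{H'} H`. -/
def cotLeft : B' →ₐ[k] cotAlg F :=
  (Algebra.TensorProduct.includeLeft.comp X'.incl).codRestrict (cotAlg F)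
    (fun b => tmul_one_mem_cotensor X'.comod.toCoaction F.χ
      ((mem_coinvSub X'.comod.toCoaction (X'.incl b)).2 (X'.inv b)))

/-- A coaction on a comodule algebra, as an algebra map. -/
def ComodAlg.rhoHom (c : ComodAlg k H A) : A →ₐ[k] A ⊗[k] H :=
  AlgHom.ofLinearMap c.ρ c.map_one c.map_mul

/-- The algebra map `a ↦ α(a₀) ⊗ a₁` from `A` to `A' □^{H'} H`. -/
def cotRight : A →ₐ[k] cotAlg F :=
  ((Algebra.TensorProduct.map F.α (AlgHom.id k H)).comp X.comod.rhoHom).codRestrict (cotAlg F)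
    (fun a => (cotensorMap F.χ F.α.toLinearMap F.colin
      ⟨X.comod.ρ a, X.comod.toCoaction.rho_mem_cotensor F.χ a⟩).2)

lemma cotLeft_coe (b : B') : (cotLeft F b : A' ⊗[k] H) = X'.incl b ⊗ₜ 1 := rfl

lemma cotRight_coe (a : A) : (cotRight F a : A' ⊗[k] H) =
    F.α.toLinearMap.rTensor H (X.comod.ρ a) := rfl

lemma cotRight_incl (b : B) : cotRight F (X.incl b) = cotLeft F (F.β b) := by
  apply Subtype.ext
  rw [cotLeft_coe, cotRight_coe, X.inv, F.comm]
  rfl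

/-- The algebra map `Σ a' ⊗ h ↦ Σ a' ε(h)` from `A' □^{H'} H` to `A'`. -/
def cotEval : cotAlg F →ₐ[k] A' :=
  ((Algebra.TensorProduct.rid k k A').toAlgHom.comp
    (Algebra.TensorProduct.map (AlgHom.id k A') (Bialgebra.counitAlgHom k H))).comp
      (cotAlg F).val

/-- The `H`-coaction `Σ a' ⊗ h ↦ Σ (a' ⊗ h₁) ⊗ h₂` on `A' □^{H'} H`. -/
noncomputable def cotRho : cotAlg F →ₗ[k] cotAlg F ⊗[k] H :=
  (cotensorCoaction (H := H) X'.comod.toCoaction F.χ).ρ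

lemma cotRho_spec (x : cotAlg F) : (cotAlg F).val.toLinearMap.rTensor H (cotRho F x) =
    (Coaction.cofree k H A').ρ (x : A' ⊗[k] H) :=
  cotensorCoaction_spec (H := H) X'.comod.toCoaction F.χ x

lemma cotAlg_rTensor_injective : Function.Injective ((cotAlg F).val.toLinearMap.rTensor H) :=
  cotensor_rTensor_injective (H := H) X'.comod.toCoaction F.χ

lemma cofree_tmul_one (a : A') : (Coaction.cofree k H A').ρ (a ⊗ₜ 1) = (a ⊗ₜ 1) ⊗ₜ 1 := by
  simp [Coaction.cofree, Algebra.TensorProduct.one_def]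

lemma cotRho_cotLeft (b : B') : cotRho F (cotLeft F b) = cotLeft F b ⊗ₜ 1 := by
  apply cotAlg_rTensor_injective F
  rw [cotRho_spec, cotLeft_coe, cofree_tmul_one]
  rfl

lemma cotRho_mul (x y : cotAlg F) : cotRho F (x * y) = cotRho F x * cotRho F y := by
  apply cotAlg_rTensor_injective F
  rw [cotRho_spec, ← star_mul (cotRho F x),
    star_rTensor (LinearMap.mul k (cotAlg F)) (star H (LinearMap.mul k A'))
      (cotAlg F).val.toLinearMap (cotAlg F).val.toLinearMap (cotAlg F).val.toLinearMap
      (fun x y => (star_mul (x : A' ⊗[k] H) (y : A' ⊗[k] H)).symm),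
    cotRho_spec, cotRho_spec, ← cofree_star, star_mul]
  rfl

/-- The comodule algebra `A' □^{H'} H`. -/
noncomputable def cotComod : ComodAlg k H (cotAlg F) where
  ρ := cotRho F
  coassoc := (cotensorCoaction (H := H) X'.comod.toCoaction F.χ).coassoc
  counit := (cotensorCoaction (H := H) X'.comod.toCoaction F.χ).counit
  map_one := by
    have h := cotRho_cotLeft F 1
    rw [_root_.map_one] at h
    exact h
  map_mul := cotRho_mul F

/-- The `B`-bimodule right `H`-comodule `A' □^{H'} H`; `B` acts through
`b ↦ α(b) ⊗ 1`. -/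
noncomputable def bimodCot : BimodComod k H B :=
  algBimod (BLinear.of_inv (cotComod F) ((cotLeft F).comp F.β) fun b => cotRho_cotLeft F (F.β b))

/-- The `B`-bimodule right `H`-comodule `A ⊗_B B'`, where `B'` has the trivial coaction. -/
def bimodAB : BimodComod k H B :=
  tensorBimod (algBimod (BLinear.of_inv X.comod X.incl X.inv)) (BLinear.trivial (H := H) F.β)

/-- The `B`-bimodule right `H`-comodule `B' ⊗_B A`, where `B'` has the trivial coaction. -/
def bimodBA : BimodComod k H B :=
  tensorBimod (algBimod (BLinear.trivial (H := H) F.β)) (BLinear.of_inv X.comod X.incl X.inv)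

/-- `tmulAB F a b'` is `a ⊗_B b'`. -/
def tmulAB : A →ₗ[k] B' →ₗ[k] (bimodAB F).carrier := tmul F.β (algMod X.incl)

/-- `tmulBA F b' a` is `b' ⊗_B a`. -/
def tmulBA : B' →ₗ[k] A →ₗ[k] (bimodBA F).carrier := tmul X.incl (algMod F.β)

/-- The generalized canonical map
`κ : B' ⊗_B A → A' □^{H'} H`, `b' ⊗ a ↦ b' α(a₀) ⊗ a₁ = (b' 1 ⊗ 1) (α(a₀) ⊗ a₁)`. -/
def kappa : (bimodBA F).carrier →ₗ[k] cotAlg F :=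
  indLift (N := algMod F.β)
    ((LinearMap.mul k (cotAlg F)).compl₁₂ (cotLeft F).toLinearMap (cotRight F).toLinearMap)
    (fun (b' : B') b a => by
      change cotLeft F (b' * F.β b) * cotRight F a = cotLeft F b' * cotRight F (X.incl b * a)
      rw [map_mul, map_mul, cotRight_incl, mul_assoc])

/-- The map
`κ̃ : A ⊗_B B' → A' □^{H'} H`, `a ⊗ b' ↦ α(a₀) b' ⊗ a₁ = (α(a₀) ⊗ a₁) (b' 1 ⊗ 1)`. -/
def kappaTilde : (bimodAB F).carrier →ₗ[k] cotAlg F :=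
  indLift (N := algMod X.incl)
    ((LinearMap.mul k (cotAlg F)).compl₁₂ (cotRight F).toLinearMap (cotLeft F).toLinearMap)
    (fun (a : A) b b' => by
      change cotRight F (a * X.incl b) * cotLeft F b' = cotRight F a * cotLeft F (F.β b * b')
      rw [map_mul, map_mul, cotRight_incl, mul_assoc])

lemma kappa_tmulBA (b' : B') (a : A) : kappa F (tmulBA F b' a) = cotLeft F b' * cotRight F a :=
  indLift_tmul (N := algMod F.β) _ _ _ _

lemma kappaTilde_tmulAB (a : A) (b' : B') :
    kappaTilde F (tmulAB F a b') = cotRight F a * cotLeft F b' :=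
  indLift_tmul (N := algMod X.incl) _ _ _ _

/-- The map `φ = κ⁻¹ ∘ κ̃ : A ⊗_B B' → B' ⊗_B A`, for bijective `κ`. -/
noncomputable def flipMap (hκ : Function.Bijective (kappa F)) :
    (bimodAB F).carrier →ₗ[k] (bimodBA F).carrier :=
  (LinearEquiv.ofBijective (kappa F) hκ).symm.toLinearMap ∘ₗ kappaTilde F

/-- The map `b̃' ⊗ ã ↦ b' b̃' ⊗ ã a` from `B' ⊗_B A` to itself. -/
def sandwich (b' : B') (a : A) : (bimodBA F).carrier →ₗ[k] (bimodBA F).carrier :=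
  indLift (N := algMod F.β)
    ((tmulBA F).compl₁₂ (LinearMap.mulLeft k b') (LinearMap.mulRight k a))
    (fun (c : B') b d => by
      have h := tmul_balanced X.incl (algMod F.β) (b' * c : B') b (d * a)
      refine Eq.trans ?_ (h.trans ?_)
      · exact congrArg (fun t : B' => tmulBA F t (d * a)) (mul_assoc b' c (F.β b)).symm
      · exact congrArg (tmulBA F (b' * c)) (mul_assoc (X.incl b) d a).symm)

lemma sandwich_tmulBA (b' c : B') (a d : A) :
    sandwich F b' a (tmulBA F c d) = tmulBA F (b' * c) (d * a) :=
  indLift_tmul (N := algMod F.β) _ _ _ _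

/-- The map `b' ↦ n ⊗ b'` from `B'` to `N ⊗_B B'`. -/
def insLeft (N : RMod k B) (n : N.carrier) : algMod F.β ⟶ (N.indObj F.β).resObj F.β where
  lin := tmul F.β N n
  map_act := fun (b' : B') b => (tmul_act F.β N n b' (F.β b)).symm

/-- The map `b' ⊗ a ↦ (n ⊗ b') ⊗ a` from `B' ⊗_B A` to `(N ⊗_B B') ⊗_B A`. -/
def tmulLeft (N : RMod k B) (n : N.carrier) :
    (bimodBA F).carrier →ₗ[k] (((N.indObj F.β).resObj F.β).indObj X.incl).carrier :=
  (RMod.indMap X.incl (insLeft F N n)).lin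

/-- The inclusion of `(V ⊗ A)^{co H}` into `V ⊗ A`. -/
def coinvTensorVal (X : InvMap k H A B) (V : Type u) [AddCommGroup V] [Module k V]
    (cV : Coaction k H V) :
    (coinvObj X (RelHopf.tensor V cV X.comod)).carrier →ₗ[k] V ⊗[k] A :=
  (coinvSub (RelHopf.tensor V cV X.comod).coaction).subtype

lemma tmulLeft_tmulBA (N : RMod k B) (n : N.carrier) (b' : B') (a : A) :
    tmulLeft F N n (tmulBA F b' a) =
      tmul X.incl ((N.indObj F.β).resObj F.β) (tmul F.β N n b') a :=
  RMod.indMap_tmul X.incl (insLeft F N n) b' a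

end Main

end HopfInv

open HopfInv

/-! Everything about `φ` takes place inside the algebra `A' □^{H'} H`. It receives two algebra maps,
`cotRight` from `A` and `cotLeft` from `B'`, which agree on `B` (`cotRight_incl`). The canonical map
is the multiplication `b' ⊗ a ↦ b'·a` of their images, and `κ̃` is the multiplication `a ⊗ b' ↦
a·b'` in the opposite order. Bijectivity of `κ` says that each element of the algebra is uniquely a
sum of products `b'·a` balanced over `B`. So `φ = κ⁻¹κ̃` is the rule that rewrites `a·b'` with the
factor from `B'` on the left: a factorization of an algebra.

The required identities can then be checked after applying the injective map `κ`, where they become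
associativity, unit laws, or multiplicativity of the coaction. Transport along `κ` gives a product
`mulBA` on `B' ⊗_B A`, and `mulBA_tmul_tmul` identifies it with the twisted product `b' φ(a ⊗ c')
c`. The two multiplication axioms of the distributive law are `mulBA_flipMap_left` and
`mulBA_flipMap_right`, that is, associativity of triple products `a·c·b'` and `a·b'·c'`. The monoid
axioms, the comodule algebra structure and the commuting diagram are carried over in the same way.
The composite monad is compared with the monad of the monoid through the associativity isomorphism
`n ⊗ (b' ⊗ a) ↦ (n ⊗ b') ⊗ a`, and the multiplications match because both are given by `mulBA`
(`compMonad_mu_tmulLeft`).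

The antipode enters only in the statement about the mate. Computing the mate gives `m ⊗ b' ↦ m ⊗
φ_{A'}(b')` on coinvariants (`otherMate_tmul`). At `H ⊗ A` the element `a` corresponds to `S⁻¹(a₁) ⊗
a₀`, the mate yields `S⁻¹(a₁) ⊗ α(a₀)b'`, and the last identification applies `S` to the first leg,
which cancels `S⁻¹`. What needs proof is that the transporting maps are well defined and bijective.
For this, two identities suffice, `Δ(S⁻¹(h₂))(1 ⊗ h₁) = S⁻¹(h) ⊗ 1` and `Δ(S(h₁))(h₂ ⊗ 1) = 1 ⊗
S(h)`, together with `h₂ S⁻¹(h₁) = ε(h)`. -/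

namespace HopfInv

/-! ### Antipode identities, and the passage between coinvariants and cotensor products -/

section Antipode

open Coalgebra HopfAlgebra

variable {k H H' : Type u} [Field k] [Ring H] [HopfAlgebra k H] [Ring H'] [HopfAlgebra k H']

/-- `T` is an inverse of the antipode. -/
structure IsInvAntipode (T : H →ₗ[k] H) : Prop where
  left : ∀ h, T (antipode k h) = h
  right : ∀ h, antipode k (T h) = h

variable {T : H →ₗ[k] H}

lemma IsInvAntipode.of_bijective
    (hS : Function.Bijective (antipode k : H →ₗ[k] H)) :
    IsInvAntipode (LinearEquiv.ofBijective (antipode k : H →ₗ[k] H) hS).symm.toLinearMap where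
  left h := (LinearEquiv.ofBijective (antipode k : H →ₗ[k] H) hS).symm_apply_apply h
  right h := (LinearEquiv.ofBijective (antipode k : H →ₗ[k] H) hS).apply_symm_apply h

namespace IsInvAntipode

variable (hT : IsInvAntipode T)
include hT

lemma counit (h : H) : Coalgebra.counit (R := k) (T h) = Coalgebra.counit (R := k) h := by
  rw [← counit_antipode (R := k) (T h), hT.right]

lemma injective : Function.Injective (antipode k : H →ₗ[k] H) :=
  Function.LeftInverse.injective hT.left

/-- This is `T(h₂) h₁ = ε(h)`. Since `S` is injective and antimultiplicative, applying it to the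
left side gives `S(h₁) h₂`, which is an antipode axiom. -/
lemma mul_comul (h : H) :
    TensorProduct.lift ((LinearMap.mul k H).flip.compl₂ T) (comul (R := k) h) =
      algebraMap k H (Coalgebra.counit (R := k) h) := by
  apply hT.injective
  have e : ∀ s : H ⊗[k] H, antipode k (TensorProduct.lift ((LinearMap.mul k H).flip.compl₂ T) s) =
      LinearMap.mul' k H ((antipode k).rTensor H s) := by
    intro s
    induction s with
    | zero => simp
    | add a b ha hb => simp only [map_add, ha, hb]
    | tmul a b => simp [antipode_mul_antidistrib, hT.right]
  rw [e, mul_antipode_rTensor_comul_apply, Algebra.algebraMap_eq_smul_one, map_smul, antipode_one]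

/-- The companion identity `h₂ T(h₁) = ε(h)`; applying `S` turns it into `h₁ S(h₂) = ε(h)`. -/
lemma mul_comul' (h : H) :
    TensorProduct.lift ((LinearMap.mul k H).flip ∘ₗ T) (comul (R := k) h) =
      algebraMap k H (Coalgebra.counit (R := k) h) := by
  apply hT.injective
  have e : ∀ s : H ⊗[k] H, antipode k (TensorProduct.lift ((LinearMap.mul k H).flip ∘ₗ T) s) =
      LinearMap.mul' k H ((antipode k).lTensor H s) := by
    intro s
    induction s with
    | zero => simp
    | add a b ha hb => simp only [map_add, ha, hb]
    | tmul a b => simp [antipode_mul_antidistrib, hT.right]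
  rw [e, mul_antipode_lTensor_comul_apply, Algebra.algebraMap_eq_smul_one, map_smul, antipode_one]

end IsInvAntipode

/-- The map `a ⊗ b ↦ Δ(b) (f(a) ⊗ 1)`. -/
def comulMulLeft (f : H →ₗ[k] H) : H ⊗[k] H →ₗ[k] H ⊗[k] H :=
  TensorProduct.lift ((LinearMap.mul k (H ⊗[k] H)).flip.compl₁₂
    ((TensorProduct.mk k H H).flip 1 ∘ₗ f) comul)

@[simp] lemma comulMulLeft_tmul (f : H →ₗ[k] H) (a b : H) :
    comulMulLeft f (a ⊗ₜ b) = comul (R := k) b * (f a ⊗ₜ 1) := by simp [comulMulLeft]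

/-- The map `a ⊗ b ↦ Δ(a) (1 ⊗ f(b))`. -/
def comulMulRight (f : H →ₗ[k] H) : H ⊗[k] H →ₗ[k] H ⊗[k] H :=
  TensorProduct.lift ((LinearMap.mul k (H ⊗[k] H)).compl₁₂
    comul (TensorProduct.mk k H H 1 ∘ₗ f))

@[simp] lemma comulMulRight_tmul (f : H →ₗ[k] H) (a b : H) :
    comulMulRight f (a ⊗ₜ b) = comul (R := k) a * (1 ⊗ₜ f b) := by simp [comulMulRight]

/-- `h₂ T(h₁) ⊗ h₃ = 1 ⊗ h`. -/
lemma IsInvAntipode.comulMulLeft_comul (hT : IsInvAntipode T) (h : H) :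
    comulMulLeft T (comul (R := k) h) = 1 ⊗ₜ h := by
  -- `Q` contracts the first two of three legs by `a ⊗ b ↦ b T(a)`. Coassociativity puts `h₁, h₂`
  -- into these legs, where `mul_comul'` gives the counit.
  let Q : H ⊗[k] H ⊗[k] H →ₗ[k] H ⊗[k] H :=
    (TensorProduct.lift ((LinearMap.mul k H).flip ∘ₗ T)).rTensor H
  have e1 : ∀ s : H ⊗[k] H, comulMulLeft T s =
      Q ((TensorProduct.assoc k H H H).symm (comul.lTensor H s)) := by
    intro s
    induction s with
    | zero => simp
    | add a b ha hb => simp only [map_add, ha, hb]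
    | tmul a b =>
      simp only [comulMulLeft_tmul, LinearMap.lTensor_tmul]
      generalize comul (R := k) b = r
      induction r with
      | zero => simp
      | add a b ha hb => simp only [map_add, tmul_add, add_mul, ha, hb]
      | tmul c d => simp [Q]
  have e2 : ∀ s : H ⊗[k] H, Q (comul.rTensor H s) =
      1 ⊗ₜ TensorProduct.lid k H ((Coalgebra.counit (R := k)).rTensor H s) := by
    intro s
    induction s with
    | zero => simp
    | add a b ha hb => simp only [map_add, tmul_add, ha, hb]
    | tmul a b =>
      simp [Q, hT.mul_comul', Algebra.algebraMap_eq_smul_one, TensorProduct.smul_tmul]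
  rw [e1, coassoc_symm_apply, e2]
  simp

/-- `h₁ ⊗ h₂ S(h₃) = h ⊗ 1`. -/
lemma comulMulRight_comul (h : H) :
    comulMulRight (antipode k) (comul (R := k) h) = h ⊗ₜ 1 := by
  -- The mirror image: `Q` contracts the last two legs by `a ⊗ b ↦ a S(b)`.
  let Q : H ⊗[k] (H ⊗[k] H) →ₗ[k] H ⊗[k] H :=
    (LinearMap.mul' k H ∘ₗ (antipode k).lTensor H).lTensor H
  have e1 : ∀ s : H ⊗[k] H, comulMulRight (antipode k) s =
      Q (TensorProduct.assoc k H H H (comul.rTensor H s)) := by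
    intro s
    induction s with
    | zero => simp
    | add a b ha hb => simp only [map_add, ha, hb]
    | tmul a b =>
      simp only [comulMulRight_tmul, LinearMap.rTensor_tmul]
      generalize comul (R := k) a = r
      induction r with
      | zero => simp
      | add a b ha hb => simp only [map_add, add_tmul, add_mul, ha, hb]
      | tmul c d => simp [Q]
  have e2 : ∀ s : H ⊗[k] H, Q (comul.lTensor H s) =
      TensorProduct.rid k H ((Coalgebra.counit (R := k)).lTensor H s) ⊗ₜ 1 := by
    intro s
    induction s with
    | zero => simp
    | add a b ha hb => simp only [map_add, add_tmul, ha, hb]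
    | tmul a b =>
      simp [Q, mul_antipode_lTensor_comul_apply, Algebra.algebraMap_eq_smul_one,
        TensorProduct.smul_tmul]
  rw [e1, coassoc_apply, e2]
  simp

/-- The map `a ⊗ b ↦ Δ(T(b)) (1 ⊗ a)`. -/
def comulInvAntipode (T : H →ₗ[k] H) : H ⊗[k] H →ₗ[k] H ⊗[k] H :=
  TensorProduct.lift ((LinearMap.mul k (H ⊗[k] H)).flip.compl₁₂
    (TensorProduct.mk k H H 1) (comul ∘ₗ T))

@[simp] lemma comulInvAntipode_tmul (a b : H) :
    comulInvAntipode T (a ⊗ₜ b) = comul (R := k) (T b) * (1 ⊗ₜ a) := by simp [comulInvAntipode]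

/-- `Δ(T(h₂)) (1 ⊗ h₁) = T(h) ⊗ 1`. -/
lemma IsInvAntipode.comulInvAntipode_comul (hT : IsInvAntipode T) (h : H) :
    comulInvAntipode T (comul (R := k) h) = T h ⊗ₜ 1 := by
  -- Expand `1 ⊗ h₁` by `comulMulLeft_comul` as `Δ(h₂)(T(h₁) ⊗ 1)`. The expression becomes `Δ(T(h₃))
  -- Δ(h₂) (T(h₁) ⊗ 1) = Δ(T(h₃)h₂) (T(h₁) ⊗ 1)`, and `mul_comul` collapses the first factor. This
  -- way the anticomultiplicativity of `T` is never needed. `P` is this expression as a function of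
  -- three independent legs.
  let P : H ⊗[k] H ⊗[k] H →ₗ[k] H ⊗[k] H :=
    TensorProduct.lift ((LinearMap.mul k (H ⊗[k] H)).flip.compl₁₂ (comulMulLeft T) (comul ∘ₗ T))
  have hP : ∀ r c, P (r ⊗ₜ c) = comul (R := k) (T c) * comulMulLeft T r := fun r c => by simp [P]
  have e1 : ∀ s : H ⊗[k] H, P (comul.rTensor H s) = comulInvAntipode T s := by
    intro s
    induction s with
    | zero => simp
    | add a b ha hb => simp only [map_add, ha, hb]
    | tmul a b =>
      rw [LinearMap.rTensor_tmul, hP, hT.comulMulLeft_comul, comulInvAntipode_tmul]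
  have e2 : ∀ s : H ⊗[k] H, P ((TensorProduct.assoc k H H H).symm (comul.lTensor H s)) =
      T (TensorProduct.rid k H ((Coalgebra.counit (R := k)).lTensor H s)) ⊗ₜ 1 := by
    intro s
    induction s with
    | zero => simp
    | add a b ha hb => simp only [map_add, add_tmul, ha, hb]
    | tmul a b =>
      have e3 : ∀ r : H ⊗[k] H, P ((TensorProduct.assoc k H H H).symm (a ⊗ₜ r)) =
          comul (R := k) (TensorProduct.lift ((LinearMap.mul k H).flip.compl₂ T) r) *
            (T a ⊗ₜ 1) := by
        intro r
        induction r with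
        | zero => simp
        | add a b ha hb => simp only [map_add, tmul_add, add_mul, ha, hb]
        | tmul c d => simp [hP, mul_assoc]
      rw [LinearMap.lTensor_tmul, e3, hT.mul_comul]
      simp [Algebra.algebraMap_eq_smul_one, TensorProduct.smul_tmul']
  rw [← e1, ← coassoc_symm_apply, e2]
  simp

/-- The map `a ⊗ b ↦ Δ(S(a)) (b ⊗ 1)`. -/
def comulAntipode (k H : Type u) [Field k] [Ring H] [HopfAlgebra k H] :
    H ⊗[k] H →ₗ[k] H ⊗[k] H :=
  TensorProduct.lift ((LinearMap.mul k (H ⊗[k] H)).compl₁₂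
    (comul ∘ₗ antipode k) ((TensorProduct.mk k H H).flip 1))

@[simp] lemma comulAntipode_tmul (a b : H) :
    comulAntipode k H (a ⊗ₜ b) = comul (R := k) (antipode k a) * (b ⊗ₜ 1) := by
  simp [comulAntipode]

/-- `Δ(S(h₁)) (h₂ ⊗ 1) = 1 ⊗ S(h)`. -/
lemma comulAntipode_comul (h : H) :
    comulAntipode k H (comul (R := k) h) = 1 ⊗ₜ antipode k h := by
  -- Same device: `h₂ ⊗ 1` is expanded by `comulMulRight_comul` as `Δ(h₂)(1 ⊗ S(h₃))`, so that
  -- `Δ(S(h₁))Δ(h₂) = Δ(S(h₁)h₂)` collapses and `1 ⊗ S(h)` is left.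
  let P : H ⊗[k] (H ⊗[k] H) →ₗ[k] H ⊗[k] H :=
    TensorProduct.lift ((LinearMap.mul k (H ⊗[k] H)).compl₁₂ (comul ∘ₗ antipode k)
      (comulMulRight (antipode k)))
  have hP : ∀ r c, P (c ⊗ₜ r) = comul (R := k) (antipode k c) * comulMulRight (antipode k) r :=
    fun r c => by simp [P]
  have e1 : ∀ s : H ⊗[k] H, P (comul.lTensor H s) = comulAntipode k H s := by
    intro s
    induction s with
    | zero => simp
    | add a b ha hb => simp only [map_add, ha, hb]
    | tmul a b =>
      rw [LinearMap.lTensor_tmul, hP, comulMulRight_comul, comulAntipode_tmul]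
  have e2 : ∀ s : H ⊗[k] H, P (TensorProduct.assoc k H H H (comul.rTensor H s)) =
      1 ⊗ₜ antipode k (TensorProduct.lid k H ((Coalgebra.counit (R := k)).rTensor H s)) := by
    intro s
    induction s with
    | zero => simp
    | add a b ha hb => simp only [map_add, tmul_add, ha, hb]
    | tmul a b =>
      have e3 : ∀ r : H ⊗[k] H, P (TensorProduct.assoc k H H H (r ⊗ₜ b)) =
          comul (R := k) (LinearMap.mul' k H ((antipode k).rTensor H r)) *
            (1 ⊗ₜ antipode k b) := by
        intro r
        induction r with
        | zero => simp
        | add a b ha hb => simp only [map_add, add_tmul, add_mul, ha, hb]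
        | tmul c d => simp [hP, mul_assoc]
      rw [LinearMap.rTensor_tmul, e3, mul_antipode_rTensor_comul_apply]
      simp [Algebra.algebraMap_eq_smul_one, TensorProduct.tmul_smul]
  rw [← e1, ← coassoc_apply, e2]
  simp

variable {X : Type u} [AddCommGroup X] [Module k X]

@[simp] lemma Coaction.diag_tmul {Y : Type u} [AddCommGroup Y] [Module k Y]
    (cX : Coaction k H X) (cY : Coaction k H Y) (x : X) (y : Y) :
    (cX.diag cY).ρ (x ⊗ₜ y) = star H (TensorProduct.mk k X Y) (cX.ρ x) (cY.ρ y) := by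
  simp [Coaction.diag]

/-- If `Σ x ⊗ h` is in the cotensor product, then `Σ T(h) ⊗ x` is coinvariant. -/
lemma IsInvAntipode.mem_coinvSub (hT : IsInvAntipode T) (c : Coaction k H' X) (χ : H →ₐc[k] H')
    {u : X ⊗[k] H} (hu : u ∈ cotensor c χ) :
    TensorProduct.comm k X H (T.lTensor X u) ∈
      coinvSub (((Coaction.regular k H).push χ).diag c) := by
  rw [mem_cotensor] at hu
  let j : X →ₗ[k] H ⊗[k] H' →ₗ[k] (H ⊗[k] X) ⊗[k] H' :=
    (LinearMap.rTensorHom H') ∘ₗ (TensorProduct.mk k H X).flip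
  have hj : ∀ x a b, j x (a ⊗ₜ b) = (a ⊗ₜ x) ⊗ₜ b := fun x a b => by simp [j]
  -- `Λ` sends `x ⊗ g ⊗ h` to `T(h)₁ ⊗ x ⊗ χ(T(h)₂) g`. Applied to the two sides of the cotensor
  -- condition it gives the coaction of `Σ T(h) ⊗ x` and, by `comulInvAntipode_comul`, the element
  -- `Σ T(h) ⊗ x ⊗ 1`.
  let Λ : X ⊗[k] (H' ⊗[k] H) →ₗ[k] (H ⊗[k] X) ⊗[k] H' :=
    TensorProduct.lift (((LinearMap.llcomp k (H' ⊗[k] H) (H ⊗[k] H') ((H ⊗[k] X) ⊗[k] H')) ∘ₗ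
      j).flip (TensorProduct.lift ((LinearMap.mul k (H ⊗[k] H')).flip.compl₁₂
        (TensorProduct.mk k H H' 1) ((χ : H →ₗ[k] H').lTensor H ∘ₗ comul ∘ₗ T))))
  have hΛ : ∀ x g h, Λ (x ⊗ₜ (g ⊗ₜ h)) =
      j x ((χ : H →ₗ[k] H').lTensor H (comul (T h)) * (1 ⊗ₜ g)) := fun x g h => by simp [Λ]
  have e1 : ∀ u : X ⊗[k] H, (((Coaction.regular k H).push χ).diag c).ρ
      (TensorProduct.comm k X H (T.lTensor X u)) =
      Λ (TensorProduct.assoc k X H' H (c.ρ.rTensor H u)) := by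
    intro u
    induction u with
    | zero => simp
    | add a b ha hb => simp only [map_add, ha, hb]
    | tmul x h =>
      simp only [LinearMap.lTensor_tmul, TensorProduct.comm_tmul, LinearMap.rTensor_tmul,
        Coaction.diag_tmul, Coaction.push, Coaction.regular, LinearMap.comp_apply]
      generalize c.ρ x = s
      induction s with
      | zero => simp
      | add a b ha hb => simp only [map_add, add_tmul, ha, hb]
      | tmul y g =>
        rw [TensorProduct.assoc_tmul, hΛ]
        generalize (χ : H →ₗ[k] H').lTensor H (comul (T h)) = r
        induction r with
        | zero => simp
        | add a b ha hb => simp only [map_add, add_mul, LinearMap.add_apply, ha, hb]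
        | tmul a b => simp [hj]
  have e2 : ∀ u : X ⊗[k] H, Λ (((χ : H →ₗ[k] H').rTensor H ∘ₗ comul).lTensor X u) =
      TensorProduct.comm k X H (T.lTensor X u) ⊗ₜ 1 := by
    intro u
    induction u with
    | zero => simp
    | add a b ha hb => simp only [map_add, add_tmul, ha, hb]
    | tmul x h =>
      have e3 : ∀ s : H ⊗[k] H, Λ (x ⊗ₜ (χ : H →ₗ[k] H').rTensor H s) =
          j x ((χ : H →ₗ[k] H').lTensor H (comulInvAntipode T s)) := by
        intro s
        induction s with
        | zero => simp
        | add a b ha hb => simp only [map_add, tmul_add, ha, hb]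
        | tmul a b =>
          rw [LinearMap.rTensor_tmul, hΛ, comulInvAntipode_tmul]
          congr 1
          generalize comul (R := k) (T b) = r
          induction r with
          | zero => simp
          | add a b ha hb => simp only [map_add, add_mul, ha, hb]
          | tmul a b => simp
      rw [LinearMap.lTensor_tmul, LinearMap.comp_apply, e3, hT.comulInvAntipode_comul]
      simp [hj]
  rw [HopfInv.mem_coinvSub, e1, hu, e2]

/-- If `Σ h ⊗ x` is coinvariant, then `Σ x ⊗ S(h)` is in the cotensor product. -/
lemma antipode_mem_cotensor (c : Coaction k H' X) (χ : H →ₐc[k] H') {x : H ⊗[k] X}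
    (hx : x ∈ coinvSub (((Coaction.regular k H).push χ).diag c)) :
    TensorProduct.comm k H X ((antipode k).rTensor X x) ∈ cotensor c χ := by
  rw [HopfInv.mem_coinvSub] at hx
  -- `Ξ` sends `h ⊗ y ⊗ g` to `y ⊗ χ(S(h)₁) g ⊗ S(h)₂`. It carries the two sides of the coinvariance
  -- equation to the two sides of the cotensor condition.
  let Ξ : (H ⊗[k] X) ⊗[k] H' →ₗ[k] X ⊗[k] (H' ⊗[k] H) :=
    TensorProduct.lift (TensorProduct.lift (LinearMap.mk₂ k
      (fun h y => TensorProduct.mk k X (H' ⊗[k] H) y ∘ₗ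
        LinearMap.mulLeft k ((χ : H →ₗ[k] H').rTensor H (comul (antipode k h))) ∘ₗ
          (TensorProduct.mk k H' H).flip 1)
      (fun _ _ _ => by ext; simp [add_mul, tmul_add]) (fun _ _ _ => by ext; simp)
      (fun _ _ _ => by ext; simp) (fun _ _ _ => by ext; simp [smul_tmul'])))
  have hΞ : ∀ h y g, Ξ ((h ⊗ₜ y) ⊗ₜ g) =
      y ⊗ₜ ((χ : H →ₗ[k] H').rTensor H (comul (antipode k h)) * (g ⊗ₜ 1)) := fun h y g => by
    simp [Ξ]
  have e1 : ∀ x : H ⊗[k] X, Ξ (x ⊗ₜ 1) = ((χ : H →ₗ[k] H').rTensor H ∘ₗ comul).lTensor X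
      (TensorProduct.comm k H X ((antipode k).rTensor X x)) := by
    intro x
    induction x with
    | zero => simp
    | add a b ha hb => simp only [map_add, add_tmul, ha, hb]
    | tmul h y => simp [hΞ, ← Algebra.TensorProduct.one_def]
  have hmul : ∀ s t : H ⊗[k] H, (χ : H →ₗ[k] H').rTensor H (s * t) =
      (χ : H →ₗ[k] H').rTensor H s * (χ : H →ₗ[k] H').rTensor H t := fun s t =>
    map_mul (Algebra.TensorProduct.map (χ : H →ₐ[k] H') (AlgHom.id k H)) s t
  have e2 : ∀ x : H ⊗[k] X, Ξ ((((Coaction.regular k H).push χ).diag c).ρ x) =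
      TensorProduct.assoc k X H' H (c.ρ.rTensor H
        (TensorProduct.comm k H X ((antipode k).rTensor X x))) := by
    intro x
    induction x with
    | zero => simp
    | add a b ha hb => simp only [map_add, ha, hb]
    | tmul h y =>
      simp only [LinearMap.rTensor_tmul, TensorProduct.comm_tmul, Coaction.diag_tmul,
        Coaction.push, Coaction.regular, LinearMap.comp_apply]
      generalize c.ρ y = s
      induction s with
      | zero => simp
      | add a b ha hb => simp only [map_add, add_tmul, ha, hb]
      | tmul z g =>
        have e3 : ∀ t : H ⊗[k] H, Ξ (star H' (TensorProduct.mk k H X)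
            ((χ : H →ₗ[k] H').lTensor H t) (z ⊗ₜ g)) =
            z ⊗ₜ ((χ : H →ₗ[k] H').rTensor H (comulAntipode k H t) * (g ⊗ₜ 1)) := by
          intro t
          induction t with
          | zero => simp
          | add a b ha hb => simp only [map_add, add_mul, tmul_add, LinearMap.add_apply, ha, hb]
          | tmul a b => simp [hΞ, hmul, mul_assoc]
        -- Here the first leg is `χ(S(h₁)₁ h₂) g` and the second `S(h₁)₂`; the identity reduces them
        -- to `g ⊗ S(h)`.
        rw [e3, comulAntipode_comul]
        simp
  rw [mem_cotensor, ← e1, ← hx, e2]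

end Antipode

/-! ### Bijective morphisms are isomorphisms -/

section Isos

variable {k H A B : Type u} [Field k] [Ring H] [HopfAlgebra k H] [Ring A] [Algebra k A]
  [Ring B] [Algebra k B]

/-- A bijective map of right modules is an isomorphism. -/
noncomputable def RMod.isoOfBijective {M N : RMod k B} (f : M ⟶ N)
    (hf : Function.Bijective f.lin) : M ≅ N where
  hom := f
  inv :=
    { lin := (LinearEquiv.ofBijective f.lin hf).symm.toLinearMap
      map_act := fun n b => hf.1 (by
        have h := fun n => (LinearEquiv.ofBijective f.lin hf).apply_symm_apply n
        simp only [LinearEquiv.ofBijective_apply] at h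
        rw [f.map_act]
        simp only [LinearEquiv.coe_coe, h]) }
  hom_inv_id := RMod.hom_ext (LinearMap.ext fun m =>
    (LinearEquiv.ofBijective f.lin hf).symm_apply_apply m)
  inv_hom_id := RMod.hom_ext (LinearMap.ext fun n =>
    (LinearEquiv.ofBijective f.lin hf).apply_symm_apply n)

/-- The inverse of a bijective colinear map is colinear. -/
lemma IsColinear.symm {Y Z : Type u} [AddCommGroup Y] [Module k Y] [AddCommGroup Z] [Module k Z]
    {cY : Coaction k H Y} {cZ : Coaction k H Z} (e : Y ≃ₗ[k] Z)
    (he : IsColinear cY cZ e.toLinearMap) : IsColinear cZ cY e.symm.toLinearMap := fun z => by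
  obtain ⟨y, rfl⟩ := e.surjective z
  have h := he y
  simp only [LinearEquiv.coe_coe] at h ⊢
  rw [h, e.symm_apply_apply, ← LinearMap.comp_apply, ← LinearMap.rTensor_comp]
  simp

/-- A bijective map of relative Hopf modules is an isomorphism. -/
noncomputable def RelHopf.isoOfBijective {cA : ComodAlg k H A} {M N : RelHopf cA} (f : M ⟶ N)
    (hf : Function.Bijective f.hom.lin) : M ≅ N where
  hom := f
  inv :=
    { hom := (RMod.isoOfBijective f.hom hf).inv
      colin := IsColinear.symm (LinearEquiv.ofBijective f.hom.lin hf) f.colin }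
  hom_inv_id := RelHopf.hom_ext fun m =>
    (LinearEquiv.ofBijective f.hom.lin hf).symm_apply_apply m
  inv_hom_id := RelHopf.hom_ext fun n =>
    (LinearEquiv.ofBijective f.hom.lin hf).apply_symm_apply n

/-- A linear map out of `N ⊗_B A` is colinear if it is so on the elements `n ⊗ a`. -/
lemma isColinear_ind {φ : B →ₐ[k] A} {N : RMod k B} {Z : Type u} [AddCommGroup Z] [Module k Z]
    {c : Coaction k H (N.indObj φ).carrier} {cZ : Coaction k H Z}
    (f : (N.indObj φ).carrier →ₗ[k] Z)
    (h : ∀ n a, cZ.ρ (f (tmul φ N n a)) = f.rTensor H (c.ρ (tmul φ N n a))) :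
    IsColinear c cZ f := fun x => by
  have e : cZ.ρ ∘ₗ f = f.rTensor H ∘ₗ c.ρ := indLin_ext h
  exact LinearMap.congr_fun e x

end Isos

/-! ### Computation of the mate -/

section Mate

variable {k H H' A A' B B' : Type u} [Field k] [Ring H] [HopfAlgebra k H]
  [Ring H'] [HopfAlgebra k H'] [Ring A] [Algebra k A] [Ring A'] [Algebra k A']
  [Ring B] [Algebra k B] [Ring B'] [Algebra k B']
  {X : InvMap k H A B} {X' : InvMap k H' A' B'} (F : (X.Mor X' : Type u))

/-- The mate unfolded: unit of `f̃^* ⊣ f̃_*`, then the inverse of the square, then the counit of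
`f^* ⊣ f_*`. Here `f^*` is applied to the first two maps. -/
lemma otherMate_app (M : RelHopf X.comod) : (otherMate F).app M =
    RMod.indMap F.β ((coinv X).map (pushUnit F M)) ≫
      RMod.indMap F.β (squareIsoApp F (pullObj F M)).inv ≫
        RMod.indCounit F.β (coinvObj X' (pullObj F M)) := by
  simp [otherMate, mateEquiv]
  rfl

/-- The unit gives `(m₀ ⊗ 1) ⊗ m₁`, the inverse of the square evaluates the `H`-leg by `ε` and
returns `m ⊗ 1`, and the counit lets `b'` act through `φ_{A'}`. The inclusion of the coinvariants is
applied so that the formula can be stated in `M ⊗_A A'`. -/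
lemma otherMate_tmul (M : RelHopf X.comod) (m : coinvSub M.coaction) (b' : B') :
    (coinvSub (indCoaction F M)).subtype
        (((otherMate F).app M).lin (tmul F.β (coinvObj X M) m b')) =
      tmul F.α M.toRMod m (X'.incl b') := by
  rw [otherMate_app]
  have h1 : (RMod.indMap F.β (squareIsoApp F (pullObj F M)).inv).lin
      ((RMod.indMap F.β ((coinv X).map (pushUnit F M))).lin (tmul F.β (coinvObj X M) m b')) =
      tmul F.β ((coinvObj X' (pullObj F M)).resObj F.β)
        ((squareIsoApp F (pullObj F M)).inv.lin (((coinv X).map (pushUnit F M)).lin m)) b' := by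
    refine (congrArg _ (RMod.indMap_tmul F.β ((coinv X).map (pushUnit F M)) m b')).trans ?_
    exact RMod.indMap_tmul F.β _ _ _
  refine (congrArg (fun t => (coinvSub (indCoaction F M)).subtype
    ((RMod.indCounit F.β (coinvObj X' (pullObj F M))).lin t)) h1).trans ?_
  refine (congrArg (coinvSub (indCoaction F M)).subtype
    (RMod.indCounit_tmul F.β (coinvObj X' (pullObj F M)) _ b')).trans ?_
  have h2 : augment k H _ ((insOne F M).rTensor H (M.coaction.ρ m)) =
      tmul F.α M.toRMod m 1 := by
    rw [augment_rTensor, M.coaction.augment_rho, insOne_apply]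
  have h3 : (M.toRMod.indObj F.α).act
      (augment k H _ ((insOne F M).rTensor H (M.coaction.ρ m))) (X'.incl b') =
      tmul F.α M.toRMod m (X'.incl b') := by
    rw [h2, tmul_act, one_mul]
  exact h3

end Mate

/-! ### The three isomorphisms that transport the mate at `H ⊗ A` -/

section Transport

variable {k H H' A A' B B' : Type u} [Field k] [Ring H] [HopfAlgebra k H]
  [Ring H'] [HopfAlgebra k H'] [Ring A] [Algebra k A] [Ring A'] [Algebra k A']
  [Ring B] [Algebra k B] [Ring B'] [Algebra k B']
  {X : InvMap k H A B} {X' : InvMap k H' A' B'} (F : (X.Mor X' : Type u))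

lemma RelHopf.tensor_act (V : Type u) [AddCommGroup V] [Module k V] (cV : Coaction k H V)
    (cA : ComodAlg k H A) (x : V ⊗[k] A) (c : A) :
    (RelHopf.tensor V cV cA).act x c = (LinearMap.mulRight k c).lTensor V x :=
  LinearMap.congr_fun (TensorProduct.ext' (g := ((RelHopf.tensor V cV cA).act.flip c :
    V ⊗[k] A →ₗ[k] V ⊗[k] A)) (h := (LinearMap.mulRight k c).lTensor V) fun _ _ => rfl) x

lemma Coaction.push_id (c : Coaction k H A) (a : A) :
    (c.push (BialgHom.id k H)).ρ a = c.ρ a := by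
  change LinearMap.lTensor A LinearMap.id (c.ρ a) = c.ρ a
  rw [LinearMap.lTensor_id, LinearMap.id_apply]

variable {T : H →ₗ[k] H}

/-- The case `χ = id` of `IsInvAntipode.mem_coinvSub`, applied to `ρ(a)`, which lies in `A □^H H` by
coassociativity. -/
lemma IsInvAntipode.coaction_mem_coinvSub (hT : IsInvAntipode T) (c : Coaction k H A) (a : A) :
    TensorProduct.comm k A H (T.lTensor A (c.ρ a)) ∈
      coinvSub ((Coaction.regular k H).diag c) := by
  -- A coaction is determined by its map `ρ`, the other fields being propositions. So pushing along
  -- the identity changes nothing, and the result can be read with the original coactions.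
  have h1 : (Coaction.regular k H).push (BialgHom.id k H) = Coaction.regular k H := by
    have h : ((Coaction.regular k H).push (BialgHom.id k H)).ρ = (Coaction.regular k H).ρ :=
      LinearMap.ext fun x => Coaction.push_id _ x
    generalize (Coaction.regular k H).push (BialgHom.id k H) = d at h
    generalize Coaction.regular k H = d' at h
    cases d; cases d'; cases h; rfl
  have h2 : c.push (BialgHom.id k H) = c := by
    have h : (c.push (BialgHom.id k H)).ρ = c.ρ :=
      LinearMap.ext fun x => Coaction.push_id _ x
    generalize c.push (BialgHom.id k H) = d at h
    cases d; cases c; cases h; rfl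
  have h := hT.mem_coinvSub (c.push (BialgHom.id k H)) (BialgHom.id k H)
    (c.rho_mem_cotensor (BialgHom.id k H) a)
  rwa [h1, h2] at h

/-- The map `a ↦ T(a₁) ⊗ a₀` from `A` to `(H ⊗ A)^{co H}`. -/
def coinvTensorHom (X : InvMap k H A B) (hT : IsInvAntipode T) :
    algMod X.incl ⟶ coinvObj X (RelHopf.tensor H (Coaction.regular k H) X.comod) where
  lin := LinearMap.codRestrict (coinvSub ((Coaction.regular k H).diag X.comod.toCoaction))
    ((TensorProduct.comm k A H).toLinearMap ∘ₗ T.lTensor A ∘ₗ X.comod.ρ)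
    (hT.coaction_mem_coinvSub X.comod.toCoaction)
  map_act := fun (a : A) b => by
    apply Subtype.ext
    change TensorProduct.comm k A H (T.lTensor A (X.comod.ρ (a * X.incl b))) =
      (RelHopf.tensor H (Coaction.regular k H) X.comod).act
        (TensorProduct.comm k A H (T.lTensor A (X.comod.ρ a))) (X.incl b)
    rw [X.comod.map_mul, X.inv]
    refine Eq.trans ?_ (RelHopf.tensor_act H _ X.comod _ _).symm
    generalize X.comod.ρ a = u
    induction u with
    | zero => simp
    | add a b ha hb => simp only [map_add, add_mul, ha, hb]
    | tmul x h => simp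

/-- Since `ε ∘ T = ε`, evaluating the first leg by `ε` undoes `a ↦ T(a₁) ⊗ a₀`. This is the
injectivity of `coinvTensorHom`. -/
lemma counit_lid_comm (hT : IsInvAntipode T) (u : A ⊗[k] H) :
    TensorProduct.lid k A ((Coalgebra.counit (R := k) (A := H)).rTensor A
      (TensorProduct.comm k A H (T.lTensor A u))) = augment k H A u := by
  induction u with
  | zero => simp
  | add a b ha hb => simp only [map_add, ha, hb]
  | tmul x h => simp [hT.counit]

/-- Surjectivity of `coinvTensorHom`, with preimage given by `ε ⊗ id`. For `x = Σ h ⊗ y`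
coinvariant, applying `ε` to the first leg of `h₁ ⊗ y₀ ⊗ h₂y₁ = h ⊗ y ⊗ 1` gives `y₀ ⊗ h y₁ = ε(h) y
⊗ 1`. Now apply `y ⊗ g ↦ g T(y₁) ⊗ y₀` to both sides. The left becomes `h y₂ T(y₁) ⊗ y₀ = h ⊗ y`,
the right is the image of `ε(h) y`. -/
lemma coinv_eq (hT : IsInvAntipode T) (c : Coaction k H A) {x : H ⊗[k] A}
    (hx : x ∈ coinvSub ((Coaction.regular k H).diag c)) :
    TensorProduct.comm k A H (T.lTensor A (c.ρ
      (TensorProduct.lid k A ((Coalgebra.counit (R := k) (A := H)).rTensor A x)))) = x := by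
  rw [mem_coinvSub] at hx
  let R : A ⊗[k] H →ₗ[k] H ⊗[k] A := (TensorProduct.comm k A H).toLinearMap ∘ₗ
    TensorProduct.lift ((LinearMap.mul k (A ⊗[k] H)).flip.compl₁₂ (T.lTensor A ∘ₗ c.ρ)
      (TensorProduct.mk k A H 1))
  have hR : ∀ y g, R (y ⊗ₜ g) = TensorProduct.comm k A H ((1 ⊗ₜ g) * T.lTensor A (c.ρ y)) :=
    fun y g => by simp [R]
  have hR1 : ∀ y, R (y ⊗ₜ 1) = TensorProduct.comm k A H (T.lTensor A (c.ρ y)) := fun y => by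
    rw [hR, ← Algebra.TensorProduct.one_def, one_mul]
  let E : H ⊗[k] A →ₗ[k] A :=
    (TensorProduct.lid k A).toLinearMap ∘ₗ (Coalgebra.counit (R := k) (A := H)).rTensor A
  have e1 : ∀ (s : H ⊗[k] H) (v : A ⊗[k] H), E.rTensor H (star H (TensorProduct.mk k H A) s v) =
      (1 ⊗ₜ TensorProduct.lid k H ((Coalgebra.counit (R := k) (A := H)).rTensor H s)) * v := by
    intro s v
    induction s with
    | zero => simp
    | add a b ha hb => simp only [map_add, LinearMap.add_apply, tmul_add, add_mul, ha, hb]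
    | tmul a b =>
      induction v with
      | zero => simp
      | add a b ha hb => simp only [map_add, mul_add, ha, hb]
      | tmul y g => simp [E, smul_tmul']
  let Q : A ⊗[k] (H ⊗[k] H) →ₗ[k] A ⊗[k] H :=
    (TensorProduct.lift ((LinearMap.mul k H).flip ∘ₗ T)).lTensor A
  have e2 : ∀ (h : H) (v : A ⊗[k] H), R ((1 ⊗ₜ h) * v) = TensorProduct.comm k A H
      ((1 ⊗ₜ h) * Q (TensorProduct.assoc k A H H (c.ρ.rTensor H v))) := by
    intro h v
    induction v with
    | zero => simp
    | add a b ha hb => simp only [map_add, mul_add, ha, hb]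
    | tmul y g =>
      simp only [Algebra.TensorProduct.tmul_mul_tmul, one_mul, hR, LinearMap.rTensor_tmul]
      generalize c.ρ y = w
      induction w with
      | zero => simp
      | add a b ha hb => simp only [map_add, mul_add, add_tmul, ha, hb]
      | tmul z f => simp [Q, mul_assoc]
  have e3 : ∀ v : A ⊗[k] H, Q (Coalgebra.comul.lTensor A v) = augment k H A v ⊗ₜ 1 := by
    intro v
    induction v with
    | zero => simp
    | add a b ha hb => simp only [map_add, add_tmul, ha, hb]
    | tmul y g =>
      simp [Q, hT.mul_comul', Algebra.algebraMap_eq_smul_one, smul_tmul']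
  -- This holds for every `x`; coinvariance is used only afterwards, to replace the coaction of `x`
  -- by `x ⊗ 1`.
  have e4 : ∀ x : H ⊗[k] A, R (E.rTensor H (((Coaction.regular k H).diag c).ρ x)) = x := by
    intro x
    induction x with
    | zero => simp
    | add a b ha hb => simp only [map_add, ha, hb]
    | tmul h y =>
      rw [Coaction.diag_tmul, e1, e2, c.coassoc, e3, c.augment_rho]
      simp [Coaction.regular]
  have h := e4 x
  rw [hx, LinearMap.rTensor_tmul, hR1] at h
  exact h

lemma coinvTensorHom_bijective (X : InvMap k H A B) (hT : IsInvAntipode T) :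
    Function.Bijective (coinvTensorHom X hT).lin := by
  constructor
  · have h : ∀ a : A, TensorProduct.lid k A ((Coalgebra.counit (R := k) (A := H)).rTensor A
        (TensorProduct.comm k A H (T.lTensor A (X.comod.ρ a)))) = a := fun a => by
      rw [counit_lid_comm hT, X.comod.augment_rho]
    intro a b hab
    have hab' : TensorProduct.comm k A H (T.lTensor A (X.comod.ρ a)) =
        TensorProduct.comm k A H (T.lTensor A (X.comod.ρ b)) := congrArg Subtype.val hab
    exact (h a).symm.trans ((congrArg (fun t => TensorProduct.lid k A
      ((Coalgebra.counit (R := k) (A := H)).rTensor A t)) hab').trans (h b))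
  · intro x
    exact ⟨_, Subtype.ext (coinv_eq hT X.comod.toCoaction x.2)⟩

/-- The bilinear map `(h ⊗ a, a') ↦ h ⊗ α(a) a'`. -/
def pullTensorBil : H ⊗[k] A →ₗ[k] A' →ₗ[k] H ⊗[k] A' :=
  (LinearMap.lTensorHom H ∘ₗ (LinearMap.mul k A').flip).flip ∘ₗ F.α.toLinearMap.lTensor H

lemma pullTensorBil_tmul (h : H) (a : A) (a' : A') :
    pullTensorBil F (h ⊗ₜ a) a' = h ⊗ₜ (F.α a * a') := rfl

/-- The map `(h ⊗ a) ⊗ a' ↦ h ⊗ α(a) a'` of right `A'`-modules. -/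
def pullTensorModHom : (RelHopf.tensor H (Coaction.regular k H) X.comod).toRMod.indObj F.α ⟶
    (RelHopf.tensor H ((Coaction.regular k H).push F.χ) X'.comod).toRMod :=
  indLiftHom (N := (RelHopf.tensor H (Coaction.regular k H) X.comod).toRMod)
    (M := (RelHopf.tensor H ((Coaction.regular k H).push F.χ) X'.comod).toRMod)
    (pullTensorBil F)
    (fun (m : H ⊗[k] A) b y => by
      refine (congrArg (fun t => pullTensorBil F t y) (RelHopf.tensor_act H _ _ m b)).trans ?_
      change pullTensorBil F ((LinearMap.mulRight k b).lTensor H m) y =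
        pullTensorBil F m (F.α b * y)
      induction m with
      | zero => simp
      | add a b ha hb => simp only [map_add, LinearMap.add_apply, ha, hb]
      | tmul h a => simp [pullTensorBil_tmul, mul_assoc])
    (fun (m : H ⊗[k] A) a c => by
      refine Eq.trans ?_ (RelHopf.tensor_act H _ _ (pullTensorBil F m a) c).symm
      change pullTensorBil F m (a * c) =
        (LinearMap.mulRight k c).lTensor H (pullTensorBil F m a)
      induction m with
      | zero => simp
      | add a b ha hb => simp only [map_add, LinearMap.add_apply, ha, hb]
      | tmul h a => simp [pullTensorBil_tmul, mul_assoc])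

lemma pullTensorModHom_tmul (m : H ⊗[k] A) (a' : A') :
    (pullTensorModHom F).lin (tmul F.α (RelHopf.tensor H (Coaction.regular k H) X.comod).toRMod
      m a') = pullTensorBil F m a' :=
  indLiftHom_tmul (N := (RelHopf.tensor H (Coaction.regular k H) X.comod).toRMod)
    (M := (RelHopf.tensor H ((Coaction.regular k H).push F.χ) X'.comod).toRMod)
    (pullTensorBil F) _ _ m a'

/-- Colinearity before passing to the balanced quotient. As `α` is colinear, both sides are `(h₁ ⊗
α(a₀)a'₀) ⊗ χ(h₂)χ(a₁)a'₁`; the two bracketings of the last product are matched by `star_assoc`. -/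
lemma pullTensorBil_star (m : H ⊗[k] A) (a' : A') :
    (((Coaction.regular k H).push F.χ).diag X'.comod.toCoaction).ρ (pullTensorBil F m a') =
      star H' (pullTensorBil F) ((((Coaction.regular k H).diag X.comod.toCoaction).push F.χ).ρ m)
        (X'.comod.ρ a') := by
  induction m with
  | zero => simp
  | add a b ha hb => simp only [map_add, LinearMap.add_apply, ha, hb]
  | tmul h a =>
    rw [pullTensorBil_tmul, Coaction.diag_tmul, X'.comod.map_mul, F.rho_alpha]
    change _ = star H' (pullTensorBil F) ((F.χ : H →ₗ[k] H').lTensor (H ⊗[k] A)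
      (((Coaction.regular k H).diag X.comod.toCoaction).ρ (h ⊗ₜ a))) _
    rw [Coaction.diag_tmul, star_lTensor, ← star_mul]
    refine Eq.trans ?_ (star_assoc (pullTensorBil F) (TensorProduct.mk k H A)
      (TensorProduct.mk k H A') (LinearMap.mul k A' ∘ₗ F.α.toLinearMap)
      (fun h a c => pullTensorBil_tmul F h a c) _ _ _).symm
    have := star_rTensor (H := H') (LinearMap.mul k A' ∘ₗ F.α.toLinearMap) (LinearMap.mul k A')
      F.α.toLinearMap LinearMap.id LinearMap.id (fun _ _ => rfl) ((X.comod.push F.χ).ρ a)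
      (X'.comod.ρ a')
    simp only [LinearMap.rTensor_id, LinearMap.id_apply] at this
    rw [← this]
    rfl

/-- The map `(h ⊗ a) ⊗ a' ↦ h ⊗ α(a) a'` of relative Hopf modules. -/
def pullTensorHom : (pull F).obj (RelHopf.tensor H (Coaction.regular k H) X.comod) ⟶
    RelHopf.tensor H ((Coaction.regular k H).push F.χ) X'.comod where
  hom := pullTensorModHom F
  colin := by
    have key : IsColinear (indCoaction F (RelHopf.tensor H (Coaction.regular k H) X.comod))
        (((Coaction.regular k H).push F.χ).diag X'.comod.toCoaction) (pullTensorModHom F).lin :=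
      isColinear_ind (N := (RelHopf.tensor H (Coaction.regular k H) X.comod).toRMod)
        (Z := H ⊗[k] A') (pullTensorModHom F).lin fun m c => by
        rw [indCoaction_tmul]
        refine (congrArg _ (pullTensorModHom_tmul F m c)).trans ?_
        refine (pullTensorBil_star F m c).trans ?_
        refine Eq.trans ?_ (star_rTensor (tmul F.α
          (RelHopf.tensor H (Coaction.regular k H) X.comod).toRMod) (pullTensorBil F)
          LinearMap.id LinearMap.id (pullTensorModHom F).lin
          (fun x y => pullTensorModHom_tmul F x y) _ _).symm
        exact congrArg₂ (fun s t => star H' (pullTensorBil F) s t)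
          (LinearMap.congr_fun (LinearMap.rTensor_id H' _) _).symm
          (LinearMap.congr_fun (LinearMap.rTensor_id H' _) _).symm
    exact key

/-- The inverse is `h ⊗ c ↦ (h ⊗ 1) ⊗ c`, because `(h ⊗ a) ⊗ c = (h ⊗ 1)a ⊗ c = (h ⊗ 1) ⊗ α(a)c`
over `A`. -/
lemma pullTensorHom_bijective : Function.Bijective (pullTensorHom F).hom.lin := by
  let N := (RelHopf.tensor H (Coaction.regular k H) X.comod).toRMod
  let g : H ⊗[k] A' →ₗ[k] (N.indObj F.α).carrier :=
    TensorProduct.lift (tmul F.α N ∘ₗ (TensorProduct.mk k H A).flip 1)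
  have hg : ∀ h c, g (h ⊗ₜ c) = tmul F.α N (h ⊗ₜ[k] (1 : A)) c := fun h c => by
    simp only [g, TensorProduct.lift.tmul]; rfl
  have h1 : g ∘ₗ (pullTensorModHom F).lin = LinearMap.id :=
    indLin_ext (N := N) fun (m : H ⊗[k] A) c => by
      refine (congrArg g (pullTensorModHom_tmul F m c)).trans ?_
      change g (pullTensorBil F m c) = tmul F.α N m c
      induction m with
      | zero =>
        refine Eq.trans ?_ (congrArg (fun t => t c) (map_zero (tmul F.α N))).symm
        simp only [map_zero, LinearMap.zero_apply]
      | add a b ha hb =>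
        refine Eq.trans ?_ (congrArg (fun t => t c) (map_add (tmul F.α N) a b)).symm
        simp only [map_add, LinearMap.add_apply, ha, hb]
        rfl
      | tmul h a =>
        rw [pullTensorBil_tmul, hg]
        refine (tmul_balanced F.α N (h ⊗ₜ[k] (1 : A)) a c).symm.trans ?_
        congr 2
        exact (RelHopf.tensor_act H _ X.comod (h ⊗ₜ 1) a).trans (by simp; rfl)
  have h2 : (pullTensorModHom F).lin ∘ₗ g = LinearMap.id := TensorProduct.ext' fun h c => by
    rw [LinearMap.comp_apply, hg]
    refine (pullTensorModHom_tmul F (h ⊗ₜ[k] (1 : A)) c).trans ?_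
    rw [pullTensorBil_tmul, map_one, one_mul]
    rfl
  exact Function.bijective_iff_has_inverse.2
    ⟨g, fun x => LinearMap.congr_fun h1 x, fun x => LinearMap.congr_fun h2 x⟩

/-- The map `Σ h ⊗ a' ↦ Σ a' ⊗ S(h)` from `(H ⊗ A')^{co H'}` to `A' □^{H'} H`. -/
def coinvCotensorHom :
    coinvObj X' (RelHopf.tensor H ((Coaction.regular k H).push F.χ) X'.comod) ⟶
      algMod (cotLeft F) where
  lin := LinearMap.codRestrict (cotensor (H := H) X'.comod.toCoaction F.χ)
    ((TensorProduct.comm k H A').toLinearMap ∘ₗ (HopfAlgebra.antipode k).rTensor A' ∘ₗ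
      (coinvSub (((Coaction.regular k H).push F.χ).diag X'.comod.toCoaction)).subtype)
    (fun x => antipode_mem_cotensor X'.comod.toCoaction F.χ x.2)
  map_act := fun (x : coinvSub (((Coaction.regular k H).push F.χ).diag X'.comod.toCoaction))
      b => by
    apply Subtype.ext
    change TensorProduct.comm k H A' ((HopfAlgebra.antipode k).rTensor A'
      ((RelHopf.tensor H ((Coaction.regular k H).push F.χ) X'.comod).act x.1 (X'.incl b))) =
        TensorProduct.comm k H A' ((HopfAlgebra.antipode k).rTensor A' x.1) *
          (X'.incl b ⊗ₜ 1)
    refine (congrArg (fun t => TensorProduct.comm k H A'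
      ((HopfAlgebra.antipode k).rTensor A' t)) (RelHopf.tensor_act H _ X'.comod _ _)).trans ?_
    generalize x.1 = u
    change TensorProduct.comm k H A' ((HopfAlgebra.antipode k).rTensor A'
      ((LinearMap.mulRight k (X'.incl b)).lTensor H u)) = _
    induction u with
    | zero => simp
    | add a b ha hb => simp only [map_add, add_mul] at ha hb ⊢; rw [ha, hb]
    | tmul h a => simp

/-- The inverse is `a' ⊗ h ↦ T(h) ⊗ a'`. That it takes values in the coinvariants is
`IsInvAntipode.mem_coinvSub`; the two composites are identities already on the full tensor products.
-/
lemma coinvCotensorHom_bijective (hT : IsInvAntipode T) :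
    Function.Bijective (coinvCotensorHom F).lin := by
  have h1 : ∀ x : H ⊗[k] A', TensorProduct.comm k A' H (T.lTensor A'
      (TensorProduct.comm k H A' ((HopfAlgebra.antipode k).rTensor A' x))) = x := by
    intro x
    induction x with
    | zero => simp
    | add a b ha hb => simp only [map_add, ha, hb]
    | tmul h a => simp [hT.left]
  have h2 : ∀ x : A' ⊗[k] H, TensorProduct.comm k H A' ((HopfAlgebra.antipode k).rTensor A'
      (TensorProduct.comm k A' H (T.lTensor A' x))) = x := by
    intro x
    induction x with
    | zero => simp
    | add a b ha hb => simp only [map_add, ha, hb]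
    | tmul h a => simp [hT.right]
  constructor
  · intro x y hxy
    have h := congrArg (fun t => TensorProduct.comm k A' H (T.lTensor A' t))
      (congrArg (cotAlg F).val hxy)
    exact Subtype.ext ((h1 _).symm.trans (h.trans (h1 _)))
  · intro y
    exact ⟨⟨_, hT.mem_coinvSub X'.comod.toCoaction F.χ y.2⟩, Subtype.ext (h2 _)⟩

end Transport

/-! ### The maps `κ`, `κ̃` and `φ` as morphisms of bimodules and comodules -/

section Canonical

variable {k H H' A A' B B' : Type u} [Field k] [Ring H] [HopfAlgebra k H]
  [Ring H'] [HopfAlgebra k H'] [Ring A] [Algebra k A] [Ring A'] [Algebra k A']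
  [Ring B] [Algebra k B] [Ring B'] [Algebra k B']
  {X : InvMap k H A B} {X' : InvMap k H' A' B'} (F : (X.Mor X' : Type u))
  {T : H →ₗ[k] H}

/-- The mate at `H ⊗ A` induces `κ̃`. -/
lemma otherMate_tensor (hT : IsInvAntipode T) (z : (bimodAB F).carrier) :
    (coinvCotensorHom F).lin (((coinv X').map (pullTensorHom F)).lin
      (((otherMate F).app (RelHopf.tensor H (Coaction.regular k H) X.comod)).lin
        (((RMod.ind F.β).map (coinvTensorHom X hT)).lin z))) = kappaTilde F z := by
  have key : (coinvCotensorHom F).lin ∘ₗ ((coinv X').map (pullTensorHom F)).lin ∘ₗ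
      ((otherMate F).app (RelHopf.tensor H (Coaction.regular k H) X.comod)).lin ∘ₗ
        ((RMod.ind F.β).map (coinvTensorHom X hT)).lin = kappaTilde F := by
    refine indLin_ext (N := algMod X.incl) fun (a : A) b' => ?_
    refine Eq.trans ?_ (kappaTilde_tmulAB F a b').symm
    refine (congrArg (fun t => (coinvCotensorHom F).lin
      (((coinv X').map (pullTensorHom F)).lin
        (((otherMate F).app (RelHopf.tensor H (Coaction.regular k H) X.comod)).lin t)))
      (RMod.indMap_tmul F.β (coinvTensorHom X hT) a b')).trans ?_
    apply Subtype.ext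
    have h1 := otherMate_tmul F (RelHopf.tensor H (Coaction.regular k H) X.comod)
      ((coinvTensorHom X hT).lin a) b'
    have h2 := congrArg (pullTensorModHom F).lin h1
    have h3 := h2.trans (pullTensorModHom_tmul F _ _)
    have h4 := congrArg (fun t => TensorProduct.comm k H A'
      ((HopfAlgebra.antipode k).rTensor A' t)) h3
    refine h4.trans ?_
    -- All four maps have been evaluated at `a ⊗ b'`. It remains to see that `α(a₀)b' ⊗ S(T(a₁))`
    -- equals `α(a₀)b' ⊗ a₁`, which is `S ∘ T = id`.
    change TensorProduct.comm k H A' ((HopfAlgebra.antipode k).rTensor A'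
      (pullTensorBil F (TensorProduct.comm k A H (T.lTensor A (X.comod.ρ a))) (X'.incl b'))) =
        F.α.toLinearMap.rTensor H (X.comod.ρ a) * (X'.incl b' ⊗ₜ 1)
    generalize X.comod.ρ a = u
    induction u with
    | zero => simp
    | add a b ha hb => simp only [map_add, add_mul, LinearMap.add_apply, ha, hb]
    | tmul x h => simp [pullTensorBil_tmul, hT.right]
  exact LinearMap.congr_fun key z

lemma bimodBA_ext {P : Type u} [AddCommGroup P] [Module k P]
    {f g : (bimodBA F).carrier →ₗ[k] P}
    (h : ∀ b' a, f (tmulBA F b' a) = g (tmulBA F b' a)) : f = g :=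
  indLin_ext (N := algMod F.β) h

lemma bimodAB_ext {P : Type u} [AddCommGroup P] [Module k P]
    {f g : (bimodAB F).carrier →ₗ[k] P}
    (h : ∀ a b', f (tmulAB F a b') = g (tmulAB F a b')) : f = g :=
  indLin_ext (N := algMod X.incl) h

lemma bimodBA_lact (b : B) (b' : B') (a : A) :
    (bimodBA F).lact b (tmulBA F b' a) = tmulBA F (F.β b * b') a :=
  RMod.indMap_tmul X.incl
    (lactHom (algBimod (BLinear.trivial (H := H) F.β)) b) b' a

lemma bimodAB_lact (b : B) (a : A) (b' : B') :
    (bimodAB F).lact b (tmulAB F a b') = tmulAB F (X.incl b * a) b' :=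
  RMod.indMap_tmul F.β
    (lactHom (algBimod (BLinear.of_inv X.comod X.incl X.inv)) b) a b'

lemma bimodBA_act (b' : B') (a : A) (b : B) :
    (bimodBA F).act (tmulBA F b' a) b = tmulBA F b' (a * X.incl b) :=
  tmul_act X.incl (algMod F.β) b' a (X.incl b)

lemma bimodAB_act (a : A) (b' : B') (b : B) :
    (bimodAB F).act (tmulAB F a b') b = tmulAB F a (b' * F.β b) :=
  tmul_act F.β (algMod X.incl) a b' (F.β b)

lemma star_tmul_one {Y Z P : Type u} [AddCommGroup Y] [Module k Y] [AddCommGroup Z] [Module k Z]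
    [AddCommGroup P] [Module k P] (p : Y →ₗ[k] Z →ₗ[k] P) (z : Z) (u : Y ⊗[k] H) :
    star H p u (z ⊗ₜ 1) = (p.flip z).rTensor H u := by
  induction u with
  | zero => simp
  | add a b ha hb => simp only [map_add, LinearMap.add_apply, ha, hb]
  | tmul y h => simp

lemma tmul_one_star {Y Z P : Type u} [AddCommGroup Y] [Module k Y] [AddCommGroup Z] [Module k Z]
    [AddCommGroup P] [Module k P] (p : Y →ₗ[k] Z →ₗ[k] P) (y : Y) (u : Z ⊗[k] H) :
    star H p (y ⊗ₜ 1) u = (p y).rTensor H u := by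
  induction u with
  | zero => simp
  | add a b ha hb => simp only [map_add, ha, hb]
  | tmul y h => simp

/-- The coaction on `B'` is trivial, so the diagonal coaction moves only the factor from `A`. -/
lemma bimodBA_rho (b' : B') (a : A) :
    (bimodBA F).coaction.ρ (tmulBA F b' a) = (tmulBA F b').rTensor H (X.comod.ρ a) :=
  (balCoaction_tmul X.incl (algMod F.β) _ _ _ b' a).trans (tmul_one_star _ _ _)

lemma bimodAB_rho (a : A) (b' : B') :
    (bimodAB F).coaction.ρ (tmulAB F a b') = ((tmulAB F).flip b').rTensor H (X.comod.ρ a) :=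
  (balCoaction_tmul F.β (algMod X.incl) _ _ _ a b').trans (star_tmul_one _ _ _)

/-- The map `a ↦ α(a₀) ⊗ a₁` is colinear by coassociativity of `A`, in the form
`Coaction.cofree_rho`. The comparison is made in `(A' ⊗ H) ⊗ H`, into which `(A' □^{H'} H) ⊗ H`
embeds. -/
lemma cotRho_cotRight (a : A) :
    cotRho F (cotRight F a) = (cotRight F).toLinearMap.rTensor H (X.comod.ρ a) := by
  apply cotAlg_rTensor_injective F
  rw [cotRho_spec, cotRight_coe, ← LinearMap.rTensor_comp_apply]
  have e : (cotAlg F).val.toLinearMap ∘ₗ (cotRight F).toLinearMap =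
    F.α.toLinearMap.rTensor H ∘ₗ X.comod.ρ := rfl
  rw [e, LinearMap.rTensor_comp_apply, ← X.comod.cofree_rho]
  generalize X.comod.ρ a = u
  induction u with
  | zero => simp
  | add a b ha hb => simp only [map_add, ha, hb]
  | tmul m h =>
    simp only [Coaction.cofree, LinearMap.comp_apply, LinearMap.rTensor_tmul,
      LinearMap.lTensor_tmul, LinearEquiv.coe_coe]
    generalize Coalgebra.comul (R := k) h = s
    induction s with
    | zero => simp
    | add a b ha hb => simp only [map_add, tmul_add, ha, hb]
    | tmul a b => simp

/-- On generators `κ` is the product `cotLeft b' * cotRight a`. Bilinearity is associativity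
together with the agreement of the two factors on `B`. Colinearity holds because the coaction of `A'
□^{H'} H` is multiplicative, trivial on the image of `B'`, and induced from `A` on the image of `A`.
-/
lemma isHom_kappa : (bimodBA F).IsHom (bimodCot F) (kappa F) where
  map_lact b m := by
    have e : kappa F ∘ₗ (bimodBA F).lact b =
        LinearMap.mulLeft k (cotLeft F (F.β b)) ∘ₗ kappa F := bimodBA_ext F fun b' a => by
      rw [LinearMap.comp_apply, LinearMap.comp_apply, bimodBA_lact, kappa_tmulBA, kappa_tmulBA,
        map_mul, LinearMap.mulLeft_apply, mul_assoc]
    exact LinearMap.congr_fun e m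
  map_act m b := by
    have e : kappa F ∘ₗ (bimodBA F).act.flip b =
        LinearMap.mulRight k (cotLeft F (F.β b)) ∘ₗ kappa F := bimodBA_ext F fun b' a => by
      rw [LinearMap.comp_apply, LinearMap.comp_apply, LinearMap.flip_apply, bimodBA_act,
        kappa_tmulBA, kappa_tmulBA, map_mul, LinearMap.mulRight_apply, mul_assoc, cotRight_incl]
    exact LinearMap.congr_fun e m
  colin m := by
    have e : cotRho F ∘ₗ kappa F = (kappa F).rTensor H ∘ₗ (bimodBA F).coaction.ρ :=
      by
        refine bimodBA_ext F (P := cotAlg F ⊗[k] H) fun b' a => ?_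
        change cotRho F (kappa F (tmulBA F b' a)) =
          (kappa F).rTensor H ((bimodBA F).coaction.ρ (tmulBA F b' a))
        rw [bimodBA_rho, kappa_tmulBA, cotRho_mul, cotRho_cotLeft, cotRho_cotRight, one_star,
          ← LinearMap.rTensor_comp_apply, ← LinearMap.rTensor_comp_apply]
        congr 2
    exact LinearMap.congr_fun e m

lemma isHom_kappaTilde : (bimodAB F).IsHom (bimodCot F) (kappaTilde F) where
  map_lact b m := by
    have e : kappaTilde F ∘ₗ (bimodAB F).lact b =
        LinearMap.mulLeft k (cotLeft F (F.β b)) ∘ₗ kappaTilde F := bimodAB_ext F fun a b' => by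
      rw [LinearMap.comp_apply, LinearMap.comp_apply, bimodAB_lact, kappaTilde_tmulAB,
        kappaTilde_tmulAB, map_mul, LinearMap.mulLeft_apply, mul_assoc, cotRight_incl]
    exact LinearMap.congr_fun e m
  map_act m b := by
    have e : kappaTilde F ∘ₗ (bimodAB F).act.flip b =
        LinearMap.mulRight k (cotLeft F (F.β b)) ∘ₗ kappaTilde F := bimodAB_ext F fun a b' => by
      rw [LinearMap.comp_apply, LinearMap.comp_apply, LinearMap.flip_apply, bimodAB_act,
        kappaTilde_tmulAB, kappaTilde_tmulAB, map_mul, LinearMap.mulRight_apply, mul_assoc]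
    exact LinearMap.congr_fun e m
  colin m := by
    have e : cotRho F ∘ₗ kappaTilde F = (kappaTilde F).rTensor H ∘ₗ (bimodAB F).coaction.ρ :=
      by
        refine bimodAB_ext F (P := cotAlg F ⊗[k] H) fun a b' => ?_
        change cotRho F (kappaTilde F (tmulAB F a b')) =
          (kappaTilde F).rTensor H ((bimodAB F).coaction.ρ (tmulAB F a b'))
        rw [bimodAB_rho, kappaTilde_tmulAB, cotRho_mul, cotRho_cotLeft, cotRho_cotRight, star_one,
          ← LinearMap.rTensor_comp_apply, ← LinearMap.rTensor_comp_apply]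
        congr 2
    exact LinearMap.congr_fun e m

variable (hκ : Function.Bijective (kappa F))

lemma kappa_flipMap (z : (bimodAB F).carrier) : kappa F (flipMap F hκ z) = kappaTilde F z :=
  (LinearEquiv.ofBijective (kappa F) hκ).apply_symm_apply (kappaTilde F z)

/-- A map whose composite with an injective map of bimodules right comodules is such a map. -/
lemma BimodComod.IsHom.of_comp {M N P : BimodComod k H B} {g : N.carrier →ₗ[k] P.carrier}
    (hg : N.IsHom P g) (hi : Function.Injective g) {f : M.carrier →ₗ[k] N.carrier}
    {h : M.carrier →ₗ[k] P.carrier} (hh : M.IsHom P h) (e : ∀ x, g (f x) = h x) :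
    M.IsHom N f where
  map_lact b m := hi (by rw [hg.map_lact, e, e, hh.map_lact])
  map_act m b := hi (by rw [hg.map_act, e, e, hh.map_act])
  colin m := by
    -- Over a field, tensoring with `H` keeps `g` injective, so colinearity may also be tested after
    -- `g`.
    apply Module.Flat.rTensor_preserves_injective_linearMap (M := H) g hi
    have e' : g ∘ₗ f = h := LinearMap.ext e
    rw [← hg.colin, e, hh.colin, ← e', LinearMap.rTensor_comp, LinearMap.comp_apply]

lemma isHom_flipMap : (bimodAB F).IsHom (bimodBA F) (flipMap F hκ) :=
  (isHom_kappa F).of_comp hκ.1 (isHom_kappaTilde F) (kappa_flipMap F hκ)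

/-- Under `κ` the operator `sandwich` becomes multiplication by `b'` on the left and by `a` on the
right. This is how one-sided actions on `B' ⊗_B A` are converted into products. -/
lemma kappa_sandwich (b' : B') (a : A) (z : (bimodBA F).carrier) :
    kappa F (sandwich F b' a z) = cotLeft F b' * kappa F z * cotRight F a := by
  have e : kappa F ∘ₗ sandwich F b' a = LinearMap.mulRight k (cotRight F a) ∘ₗ
      LinearMap.mulLeft k (cotLeft F b') ∘ₗ kappa F := bimodBA_ext F fun c d => by
    simp only [LinearMap.comp_apply, sandwich_tmulBA, kappa_tmulBA, map_mul,
      LinearMap.mulRight_apply, LinearMap.mulLeft_apply, mul_assoc]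
  exact LinearMap.congr_fun e z

/-- First unit axiom of the distributive law: in `A' □^{H'} H` both sides are `1·b' = b'·1`. -/
lemma flipMap_one_left (b' : B') : flipMap F hκ (tmulAB F 1 b') = tmulBA F b' 1 := hκ.1 (by
  rw [kappa_flipMap, kappaTilde_tmulAB, kappa_tmulBA, map_one, one_mul, mul_one])

lemma flipMap_one_right (a : A) : flipMap F hκ (tmulAB F a 1) = tmulBA F 1 a := hκ.1 (by
  rw [kappa_flipMap, kappaTilde_tmulAB, kappa_tmulBA, map_one, one_mul, mul_one])

end Canonical

/-! ### Calculus of the monads given by tensoring over `B` -/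

section TensorMonad

variable {k A B C D : Type u} [Field k] [Ring B] [Algebra k B] [Ring A] [Algebra k A]
  [Ring C] [Algebra k C] [Ring D] [Algebra k D]
  {φ : B →ₐ[k] A} {ψ : B →ₐ[k] C} {θ : B →ₐ[k] D}

/-- The right `B`-module `N ⊗_B A`. -/
abbrev RMod.ten (φ : B →ₐ[k] A) (N : RMod k B) : RMod k B := (N.indObj φ).resObj φ

lemma tensorMonad_map_tmul {M N : RMod k B} (f : M ⟶ N) (m : M.carrier) (a : A) :
    RMod.Hom.lin ((tensorMonad φ).map f) (tmul φ M m a) = tmul φ N (f.lin m) a :=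
  RMod.indMap_tmul φ f m a

lemma tensorMonad_map_act {M N : RMod k B} (f : M ⟶ N) (m : (M.indObj φ).carrier) (a : A) :
    RMod.Hom.lin ((tensorMonad φ).map f) ((M.indObj φ).act m a) =
      (N.indObj φ).act (RMod.Hom.lin ((tensorMonad φ).map f) m) a :=
  (RMod.indMap φ f).map_act m a

/-- The multiplication of the monad is the counit of the adjunction at the induced module, hence it
is the `A`-action there. -/
lemma tensorMonad_mu_tmul (N : RMod k B) (m : (N.indObj φ).carrier) (a : A) :
    RMod.Hom.lin ((tensorMonad φ).μ.app N) (tmul φ (N.ten φ) m a) = (N.indObj φ).act m a :=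
  RMod.indCounit_tmul φ (N.indObj φ) m a

lemma ten_hom_ext {N M : RMod k B} {f g : N.ten φ ⟶ M}
    (h : ∀ n a, f.lin (tmul φ N n a) = g.lin (tmul φ N n a)) : f = g :=
  RMod.hom_ext (indLin_ext (N := N) h)

/-- Iterated balanced tensor products are generated by pure tensors. The outer element is frozen, so
that the inner generators can be tested as an equality of linear maps. -/
lemma ten_hom_ext₂ {N M : RMod k B} {f g : (N.ten φ).ten ψ ⟶ M}
    (h : ∀ n a c, f.lin (tmul ψ (N.ten φ) (tmul φ N n a) c) =
      g.lin (tmul ψ (N.ten φ) (tmul φ N n a) c)) : f = g :=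
  ten_hom_ext fun m c => by
    have e : f.lin ∘ₗ (tmul ψ (N.ten φ)).flip c = g.lin ∘ₗ (tmul ψ (N.ten φ)).flip c :=
      indLin_ext (N := N) fun n a => h n a c
    exact LinearMap.congr_fun e m

lemma ten_hom_ext₃ {N M : RMod k B} {f g : ((N.ten φ).ten ψ).ten θ ⟶ M}
    (h : ∀ n a c d, f.lin (tmul θ ((N.ten φ).ten ψ) (tmul ψ (N.ten φ) (tmul φ N n a) c) d) =
      g.lin (tmul θ ((N.ten φ).ten ψ) (tmul ψ (N.ten φ) (tmul φ N n a) c) d)) : f = g :=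
  ten_hom_ext₂ fun m c d => by
    have e : f.lin ∘ₗ (tmul θ ((N.ten φ).ten ψ)).flip d ∘ₗ (tmul ψ (N.ten φ)).flip c =
        g.lin ∘ₗ (tmul θ ((N.ten φ).ten ψ)).flip d ∘ₗ (tmul ψ (N.ten φ)).flip c :=
      indLin_ext (N := N) fun n a => h n a c d
    exact LinearMap.congr_fun e m

end TensorMonad

/-! ### The distributive law -/

section Distributive

variable {k H H' A A' B B' : Type u} [Field k] [Ring H] [HopfAlgebra k H]
  [Ring H'] [HopfAlgebra k H'] [Ring A] [Algebra k A] [Ring A'] [Algebra k A']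
  [Ring B] [Algebra k B] [Ring B'] [Algebra k B']
  {X : InvMap k H A B} {X' : InvMap k H' A' B'} (F : (X.Mor X' : Type u))

lemma tmulLeft_add (N : RMod k B) (m n : N.carrier) :
    tmulLeft F N (m + n) = tmulLeft F N m + tmulLeft F N n := bimodBA_ext F fun b' a => by
  simp only [LinearMap.add_apply, tmulLeft_tmulBA, map_add]
  exact LinearMap.map_add₂ _ _ _ _

lemma tmulLeft_smul (N : RMod k B) (r : k) (n : N.carrier) :
    tmulLeft F N (r • n) = r • tmulLeft F N n := bimodBA_ext F fun b' a => by
  simp only [LinearMap.smul_apply, tmulLeft_tmulBA, map_smul]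
  exact LinearMap.map_smul₂ _ _ _ _

/-- The pairing `(n, z) ↦ n ⊗ z` is balanced over `B`. Here and below `z` is arbitrary in `B' ⊗_B
A`, since values of `φ` are not pure tensors. -/
lemma tmulLeft_act (N : RMod k B) (n : N.carrier) (b : B) (z : (bimodBA F).carrier) :
    tmulLeft F N (N.act n b) z = tmulLeft F N n ((bimodBA F).lact b z) := by
  have e : tmulLeft F N (N.act n b) = tmulLeft F N n ∘ₗ (bimodBA F).lact b :=
    bimodBA_ext F fun b' a => by
      rw [LinearMap.comp_apply, bimodBA_lact, tmulLeft_tmulBA, tmulLeft_tmulBA, tmul_balanced]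
  exact LinearMap.congr_fun e z

/-- Right multiplication on the factor `A` commutes with `n ⊗ (-)`; in other words, `n ⊗ (-)` is
right `A`-linear. -/
lemma tmulLeft_sandwich_right (N : RMod k B) (n : N.carrier) (a : A) (z : (bimodBA F).carrier) :
    tmulLeft F N n (sandwich F 1 a z) =
      ((N.ten F.β).indObj X.incl).act (tmulLeft F N n z) a := by
  have e : tmulLeft F N n ∘ₗ sandwich F 1 a =
      ((N.ten F.β).indObj X.incl).act.flip a ∘ₗ tmulLeft F N n :=
    bimodBA_ext F fun b' c => by
      rw [LinearMap.comp_apply, LinearMap.comp_apply, sandwich_tmulBA, tmulLeft_tmulBA,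
        tmulLeft_tmulBA, LinearMap.flip_apply, one_mul]
      exact (tmul_act X.incl (N.ten F.β) (tmul F.β N n b') c a).symm
  exact LinearMap.congr_fun e z

lemma bimodBA_act_eq_sandwich (b : B) (z : (bimodBA F).carrier) :
    (bimodBA F).act z b = sandwich F 1 (X.incl b) z := by
  have e : (bimodBA F).act.flip b = sandwich F 1 (X.incl b) :=
    bimodBA_ext F fun b' c => by
      rw [LinearMap.flip_apply, sandwich_tmulBA, bimodBA_act, one_mul]
  exact LinearMap.congr_fun e z

lemma tmulLeft_naturality {M N : RMod k B} (f : M ⟶ N) (m : M.carrier)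
    (z : (bimodBA F).carrier) :
    RMod.Hom.lin ((tensorMonad X.incl).map ((tensorMonad F.β).map f)) (tmulLeft F M m z) =
      tmulLeft F N (f.lin m) z := by
  have e : RMod.Hom.lin ((tensorMonad X.incl).map ((tensorMonad F.β).map f)) ∘ₗ
      tmulLeft F M m = tmulLeft F N (f.lin m) :=
    bimodBA_ext F fun b' c => by
      refine (congrArg (RMod.Hom.lin ((tensorMonad X.incl).map ((tensorMonad F.β).map f)))
        (tmulLeft_tmulBA F M m b' c)).trans ?_
      refine (tensorMonad_map_tmul _ _ _).trans ?_
      refine (congrArg (fun t => tmul X.incl (N.ten F.β) t c)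
        (tensorMonad_map_tmul f m b')).trans ?_
      exact (tmulLeft_tmulBA F N (f.lin m) b' c).symm
  exact LinearMap.congr_fun e z

/-- The multiplication of the monad of `B'`, applied under `(-) ⊗_B A`, is absorbed as left
multiplication by `b'` on the factor `B'` of `z`. -/
lemma tmulLeft_mu (N : RMod k B) (n : N.carrier) (b' : B') (z : (bimodBA F).carrier) :
    RMod.Hom.lin ((tensorMonad X.incl).map ((tensorMonad F.β).μ.app N))
      (tmulLeft F (N.ten F.β) (tmul F.β N n b') z) = tmulLeft F N n (sandwich F b' 1 z) := by
  have e : RMod.Hom.lin ((tensorMonad X.incl).map ((tensorMonad F.β).μ.app N)) ∘ₗ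
      tmulLeft F (N.ten F.β) (tmul F.β N n b') = tmulLeft F N n ∘ₗ sandwich F b' 1 :=
    bimodBA_ext F fun c' c => by
      refine (congrArg (RMod.Hom.lin ((tensorMonad X.incl).map ((tensorMonad F.β).μ.app N)))
        (tmulLeft_tmulBA F (N.ten F.β) (tmul F.β N n b') c' c)).trans ?_
      refine (tensorMonad_map_tmul _ _ _).trans ?_
      refine (congrArg (fun t => tmul X.incl (N.ten F.β) t c)
        ((tensorMonad_mu_tmul N (tmul F.β N n b') c').trans (tmul_act F.β N n b' c'))).trans ?_
      refine (tmulLeft_tmulBA F N n (b' * c') c).symm.trans ?_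
      exact congrArg (tmulLeft F N n) ((sandwich_tmulBA F b' c' 1 c).trans
        (congrArg (tmulBA F (b' * c')) (mul_one c))).symm
  exact LinearMap.congr_fun e z

variable (hκ : Function.Bijective (kappa F))

/-- The bilinear map `(n ⊗ a, b') ↦ n ⊗ φ(a ⊗ b')`. -/
noncomputable def distribBil (N : RMod k B) :
    (N.indObj X.incl).carrier →ₗ[k] B' →ₗ[k] ((N.ten F.β).indObj X.incl).carrier :=
  indLift (LinearMap.mk₂ k
      (fun (n : N.carrier) (a : A) => tmulLeft F N n ∘ₗ flipMap F hκ ∘ₗ tmulAB F a)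
      (fun m n a => by rw [tmulLeft_add, LinearMap.add_comp])
      (fun r n a => by rw [tmulLeft_smul, LinearMap.smul_comp])
      (fun n a c => by rw [map_add, LinearMap.comp_add, LinearMap.comp_add])
      (fun r n a => by rw [map_smul, LinearMap.comp_smul, LinearMap.comp_smul]))
    (fun n b a => LinearMap.ext fun b' => by
      -- Balancing over `B` is the left `B`-linearity `φ(b a ⊗ b') = b φ(a ⊗ b')`.
      simp only [LinearMap.mk₂_apply, LinearMap.comp_apply]
      rw [tmulLeft_act, ← (isHom_flipMap F hκ).map_lact, bimodAB_lact])

lemma distribBil_tmul (N : RMod k B) (n : N.carrier) (a : A) (b' : B') :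
    distribBil F hκ N (tmul X.incl N n a) b' = tmulLeft F N n (flipMap F hκ (tmulAB F a b')) := by
  rw [distribBil, indLift_tmul]
  rfl

lemma distribBil_balanced (N : RMod k B) (m : (N.indObj X.incl).carrier) (b : B) (b' : B') :
    distribBil F hκ N ((N.indObj X.incl).act m (X.incl b)) b' =
      distribBil F hκ N m (F.β b * b') := by
  induction m using ind_induction with
  | h0 => simp
  | ha x y hx hy => simp only [map_add, LinearMap.add_apply, hx, hy]
  | hm n a =>
    rw [tmul_act, distribBil_tmul, distribBil_tmul]
    -- The relation already holds in the source `A ⊗_B B'` of `φ`, so no property of `φ` is needed.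
    have h : tmulAB F (a * X.incl b) b' = tmulAB F a (F.β b * b') :=
      tmul_balanced F.β (algMod X.incl) a b b'
    rw [h]

lemma distribBil_act (N : RMod k B) (m : (N.indObj X.incl).carrier) (b' : B') (b : B) :
    distribBil F hκ N m (b' * F.β b) =
      ((N.ten F.β).indObj X.incl).act (distribBil F hκ N m b') (X.incl b) := by
  induction m using ind_induction with
  | h0 => simp
  | ha x y hx hy => simp only [map_add, LinearMap.add_apply, hx, hy]
  | hm n a =>
    rw [distribBil_tmul, distribBil_tmul, ← bimodAB_act, (isHom_flipMap F hκ).map_act,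
      bimodBA_act_eq_sandwich, tmulLeft_sandwich_right]

/-- The map `(n ⊗ a) ⊗ b' ↦ n ⊗ φ(a ⊗ b')` of right `B`-modules. -/
noncomputable def distribHom (N : RMod k B) :
    (N.ten X.incl).ten F.β ⟶ (N.ten F.β).ten X.incl where
  lin := indLift (N := N.ten X.incl) (distribBil F hκ N) (distribBil_balanced F hκ N)
  map_act m b := by
    have e : indLift (N := N.ten X.incl) (distribBil F hκ N) (distribBil_balanced F hκ N) ∘ₗ
        ((N.ten X.incl).indObj F.β).act.flip (F.β b) =
        ((N.ten F.β).indObj X.incl).act.flip (X.incl b) ∘ₗ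
        indLift (N := N.ten X.incl) (distribBil F hκ N) (distribBil_balanced F hκ N) :=
      indLin_ext fun m b' => by
        rw [LinearMap.comp_apply, LinearMap.comp_apply, LinearMap.flip_apply,
          LinearMap.flip_apply, tmul_act]
        refine (indLift_tmul (N := N.ten X.incl) _ _ _ _).trans ?_
        refine (distribBil_act F hκ N m b' b).trans ?_
        exact congrArg (fun t => ((N.ten F.β).indObj X.incl).act t (X.incl b))
          (indLift_tmul (N := N.ten X.incl) (distribBil F hκ N) (distribBil_balanced F hκ N)
            m b').symm
    exact LinearMap.congr_fun e m

lemma distribHom_tmul (N : RMod k B) (m : (N.indObj X.incl).carrier) (b' : B') :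
    (distribHom F hκ N).lin (tmul F.β (N.ten X.incl) m b') = distribBil F hκ N m b' :=
  indLift_tmul (N := N.ten X.incl) (distribBil F hκ N) (distribBil_balanced F hκ N) m b'

lemma distribHom_tmul_tmul (N : RMod k B) (n : N.carrier) (a : A) (b' : B') :
    (distribHom F hκ N).lin (tmul F.β (N.ten X.incl) (tmul X.incl N n a) b') =
      tmulLeft F N n (flipMap F hκ (tmulAB F a b')) :=
  (distribHom_tmul F hκ N _ b').trans (distribBil_tmul F hκ N n a b')

/-- Since `κφ = κ̃` is a product with the factor from `A` on the left, a further factor from `A`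
comes out on the left. -/
lemma flipMap_mul_left (a c : A) (b' : B') :
    kappa F (flipMap F hκ (tmulAB F (a * c) b')) =
      cotRight F a * kappa F (flipMap F hκ (tmulAB F c b')) := by
  rw [kappa_flipMap, kappa_flipMap, kappaTilde_tmulAB, kappaTilde_tmulAB, map_mul, mul_assoc]

lemma flipMap_mul_right (a : A) (b' c' : B') :
    kappa F (flipMap F hκ (tmulAB F a (b' * c'))) =
      kappa F (flipMap F hκ (tmulAB F a b')) * cotLeft F c' := by
  rw [kappa_flipMap, kappa_flipMap, kappaTilde_tmulAB, kappaTilde_tmulAB, map_mul, mul_assoc]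

/-- The product of `B' ⊗_B A` transported along `κ`. -/
noncomputable def mulBA :
    (bimodBA F).carrier →ₗ[k] (bimodBA F).carrier →ₗ[k] (bimodBA F).carrier :=
  ((LinearMap.mul k (cotAlg F)).compl₁₂ (kappa F) (kappa F)).compr₂
    (LinearEquiv.ofBijective (kappa F) hκ).symm.toLinearMap

lemma kappa_mulBA (x y : (bimodBA F).carrier) :
    kappa F (mulBA F hκ x y) = kappa F x * kappa F y :=
  (LinearEquiv.ofBijective (kappa F) hκ).apply_symm_apply _

/-- The transported product is the one given by `φ`. Under `κ` the left side is `(b'·a)(c'·c)` and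
the right side is `b'·κ̃(a ⊗ c')·c`, with the same middle `a·c'`. -/
lemma mulBA_tmul_tmul (b' c' : B') (a c : A) :
    mulBA F hκ (tmulBA F b' a) (tmulBA F c' c) =
      sandwich F b' c (flipMap F hκ (tmulAB F a c')) := hκ.1 (by
  rw [kappa_mulBA, kappa_sandwich, kappa_flipMap, kappa_tmulBA, kappa_tmulBA, kappaTilde_tmulAB]
  simp only [mul_assoc])

/-- The axiom for the multiplication of `A`, reduced to `a·(c·b') = (a c)·b'`. -/
lemma mulBA_flipMap_left (a c : A) (b' : B') :
    mulBA F hκ (tmulBA F 1 a) (flipMap F hκ (tmulAB F c b')) =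
      flipMap F hκ (tmulAB F (a * c) b') := hκ.1 (by
  rw [kappa_mulBA, flipMap_mul_left, kappa_tmulBA, map_one, one_mul])

/-- The axiom for the multiplication of `B'`, reduced to `(a·b')·c' = a·(b'c')`. -/
lemma mulBA_flipMap_right (a : A) (b' c' : B') :
    mulBA F hκ (flipMap F hκ (tmulAB F a b')) (tmulBA F c' 1) =
      flipMap F hκ (tmulAB F a (b' * c')) := hκ.1 (by
  rw [kappa_mulBA, flipMap_mul_right, kappa_tmulBA, map_one, mul_one])

/-- The last two arrows of the axiom `mul_left`, evaluated on `(n ⊗ a) ⊗ z`. Moving `a` past the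
`B'`-factor of `z` by `φ` and then multiplying in `A` is left multiplication by `1 ⊗ a`. -/
lemma distribHom_mul_left_apply (N : RMod k B) (n : N.carrier) (a : A)
    (z : (bimodBA F).carrier) :
    RMod.Hom.lin ((tensorMonad X.incl).μ.app (N.ten F.β))
      (RMod.Hom.lin ((tensorMonad X.incl).map (distribHom F hκ N))
        (tmulLeft F (N.ten X.incl) (tmul X.incl N n a) z)) =
      tmulLeft F N n (mulBA F hκ (tmulBA F 1 a) z) := by
  have e : RMod.Hom.lin ((tensorMonad X.incl).μ.app (N.ten F.β)) ∘ₗ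
      RMod.Hom.lin ((tensorMonad X.incl).map (distribHom F hκ N)) ∘ₗ
        tmulLeft F (N.ten X.incl) (tmul X.incl N n a) =
      tmulLeft F N n ∘ₗ mulBA F hκ (tmulBA F 1 a) := bimodBA_ext F fun c' c => by
    refine (congrArg (fun t => RMod.Hom.lin ((tensorMonad X.incl).μ.app (N.ten F.β))
      (RMod.Hom.lin ((tensorMonad X.incl).map (distribHom F hκ N)) t))
      (tmulLeft_tmulBA F (N.ten X.incl) (tmul X.incl N n a) c' c)).trans ?_
    refine (congrArg (RMod.Hom.lin ((tensorMonad X.incl).μ.app (N.ten F.β)))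
      (tensorMonad_map_tmul (distribHom F hκ N) _ c)).trans ?_
    refine (tensorMonad_mu_tmul (N.ten F.β) _ c).trans ?_
    refine (congrArg (fun t => ((N.ten F.β).indObj X.incl).act t c)
      (distribHom_tmul_tmul F hκ N n a c')).trans ?_
    refine (tmulLeft_sandwich_right F N n c _).symm.trans ?_
    exact congrArg (tmulLeft F N n) (mulBA_tmul_tmul F hκ 1 c' a c).symm
  exact LinearMap.congr_fun e z

/-- The counterpart for `mul_right`: moving the `A`-factor of `z` past `c'` and then multiplying in
`B'` is right multiplication by `c' ⊗ 1`. -/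
lemma distribHom_mul_right_apply (N : RMod k B) (n : N.carrier) (c' : B')
    (z : (bimodBA F).carrier) :
    RMod.Hom.lin ((tensorMonad X.incl).map ((tensorMonad F.β).μ.app N))
      ((distribHom F hκ (N.ten F.β)).lin
        (tmul F.β ((N.ten F.β).ten X.incl) (tmulLeft F N n z) c')) =
      tmulLeft F N n (mulBA F hκ z (tmulBA F c' 1)) := by
  have e : RMod.Hom.lin ((tensorMonad X.incl).map ((tensorMonad F.β).μ.app N)) ∘ₗ
      (distribHom F hκ (N.ten F.β)).lin ∘ₗ (tmul F.β ((N.ten F.β).ten X.incl)).flip c' ∘ₗ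
        tmulLeft F N n =
      tmulLeft F N n ∘ₗ (mulBA F hκ).flip (tmulBA F c' 1) := bimodBA_ext F fun b' a => by
    refine (congrArg (fun t =>
      RMod.Hom.lin ((tensorMonad X.incl).map ((tensorMonad F.β).μ.app N))
      ((distribHom F hκ (N.ten F.β)).lin (tmul F.β ((N.ten F.β).ten X.incl) t c')))
      (tmulLeft_tmulBA F N n b' a)).trans ?_
    refine (congrArg (RMod.Hom.lin ((tensorMonad X.incl).map ((tensorMonad F.β).μ.app N)))
      (distribHom_tmul_tmul F hκ (N.ten F.β) (tmul F.β N n b') a c')).trans ?_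
    refine (tmulLeft_mu F N n b' _).trans ?_
    exact congrArg (tmulLeft F N n) (mulBA_tmul_tmul F hκ b' c' a 1).symm
  exact LinearMap.congr_fun e z

/-- The distributive law given by `φ`. -/
noncomputable def distribLaw : DistribLaw (tensorMonad X.incl) (tensorMonad F.β) where
  nat :=
    { app := fun N => distribHom F hκ N
      naturality := fun M N f => ten_hom_ext₂ (N := M) (φ := X.incl) (ψ := F.β) fun m a b' => by
        refine (congrArg (distribHom F hκ N).lin ((tensorMonad_map_tmul
          ((tensorMonad X.incl).map f) (tmul X.incl M m a) b').trans
          (congrArg (fun t => tmul F.β (N.ten X.incl) t b')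
            (tensorMonad_map_tmul f m a)))).trans ?_
        refine (distribHom_tmul_tmul F hκ N (f.lin m) a b').trans ?_
        refine Eq.trans ?_ (congrArg (RMod.Hom.lin ((tensorMonad X.incl).map
          ((tensorMonad F.β).map f))) (distribHom_tmul_tmul F hκ M m a b')).symm
        exact (tmulLeft_naturality F f m _).symm }
  unit_left N := ten_hom_ext (N := N) (φ := F.β) fun n b' => by
    refine (congrArg (distribHom F hκ N).lin
      (tensorMonad_map_tmul ((tensorMonad X.incl).η.app N) n b')).trans ?_
    refine (distribHom_tmul_tmul F hκ N n 1 b').trans ?_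
    rw [flipMap_one_left, tmulLeft_tmulBA]
    rfl
  unit_right N := ten_hom_ext (N := N) (φ := X.incl) fun n a => by
    refine (distribHom_tmul_tmul F hκ N n a 1).trans ?_
    rw [flipMap_one_right, tmulLeft_tmulBA]
    exact (tensorMonad_map_tmul ((tensorMonad F.β).η.app N) n a).symm
  mul_left N := ten_hom_ext₃ (N := N) (φ := X.incl) (ψ := X.incl) (θ := F.β) fun n a c b' => by
    refine (congrArg (distribHom F hκ N).lin ((tensorMonad_map_tmul
      ((tensorMonad X.incl).μ.app N) _ b').trans (congrArg
        (fun t => tmul F.β (N.ten X.incl) t b') ((tensorMonad_mu_tmul N _ c).trans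
          (tmul_act X.incl N n a c))))).trans ?_
    refine (distribHom_tmul_tmul F hκ N n (a * c) b').trans ?_
    -- Rewrite `φ(ac ⊗ b')` as `(1 ⊗ a) φ(c ⊗ b')`. The other side of the axiom is the same product
    -- with `z = φ(c ⊗ b')`.
    rw [← mulBA_flipMap_left]
    refine (distribHom_mul_left_apply F hκ N n a _).symm.trans ?_
    exact congrArg (fun t => RMod.Hom.lin ((tensorMonad X.incl).μ.app (N.ten F.β))
      (RMod.Hom.lin ((tensorMonad X.incl).map (distribHom F hκ N)) t))
      (distribHom_tmul_tmul F hκ (N.ten X.incl) (tmul X.incl N n a) c b').symm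
  mul_right N := ten_hom_ext₃ (N := N) (φ := X.incl) (ψ := F.β) (θ := F.β) fun n a b' c' => by
    refine (congrArg (distribHom F hκ N).lin ((tensorMonad_mu_tmul (N.ten X.incl) _ c').trans
      (tmul_act F.β (N.ten X.incl) (tmul X.incl N n a) b' c'))).trans ?_
    refine (distribHom_tmul_tmul F hκ N n a (b' * c')).trans ?_
    -- Rewrite `φ(a ⊗ b'c')` as `φ(a ⊗ b')(c' ⊗ 1)`, which is the other side with `z = φ(a ⊗ b')`.
    rw [← mulBA_flipMap_right]
    refine (distribHom_mul_right_apply F hκ N n c' _).symm.trans ?_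
    exact congrArg (fun t => RMod.Hom.lin ((tensorMonad X.incl).map ((tensorMonad F.β).μ.app N))
      ((distribHom F hκ (N.ten F.β)).lin t))
      ((tensorMonad_map_tmul (distribHom F hκ N) (tmul F.β (N.ten X.incl) (tmul X.incl N n a) b')
        c').trans (congrArg (fun t => tmul F.β ((N.ten F.β).ten X.incl) t c')
          (distribHom_tmul_tmul F hκ N n a b'))).symm

end Distributive

/-! ### The monoid `B' ⊗_B A`, the isomorphism of comodule algebras and the diagram -/

section Monoid

variable {k H H' A A' B B' : Type u} [Field k] [Ring H] [HopfAlgebra k H]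
  [Ring H'] [HopfAlgebra k H'] [Ring A] [Algebra k A] [Ring A'] [Algebra k A']
  [Ring B] [Algebra k B] [Ring B'] [Algebra k B']
  {X : InvMap k H A B} {X' : InvMap k H' A' B'} (F : (X.Mor X' : Type u))

lemma kappa_lact (b : B) (x : (bimodBA F).carrier) :
    kappa F ((bimodBA F).lact b x) = cotLeft F (F.β b) * kappa F x :=
  (isHom_kappa F).map_lact b x

lemma kappa_act (x : (bimodBA F).carrier) (b : B) :
    kappa F ((bimodBA F).act x b) = kappa F x * cotLeft F (F.β b) :=
  (isHom_kappa F).map_act x b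

lemma kappa_rho (x : (bimodBA F).carrier) :
    cotRho F (kappa F x) = (kappa F).rTensor H ((bimodBA F).coaction.ρ x) :=
  (isHom_kappa F).colin x

lemma kappa_tmulBA_one (b' : B') : kappa F (tmulBA F b' 1) = cotLeft F b' := by
  rw [kappa_tmulBA, map_one, mul_one]

lemma kappa_one_tmulBA (a : A) : kappa F (tmulBA F 1 a) = cotRight F a := by
  rw [kappa_tmulBA, map_one, one_mul]

variable (hκ : Function.Bijective (kappa F))

/-- Both sides become `κ(x)·b·κ(y)`, where `b` denotes its image in `A' □^{H'} H`; so the product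
descends to the tensor product over `B`. -/
lemma mulBA_balanced (x : (bimodBA F).carrier) (b : B) (y : (bimodBA F).carrier) :
    mulBA F hκ ((bimodBA F).act x b) y = mulBA F hκ x ((bimodBA F).lact b y) := hκ.1 (by
  rw [kappa_mulBA, kappa_mulBA, kappa_act, kappa_lact, mul_assoc])

/-- Compatibility with the coaction is tested after `κ ⊗ H`, which is injective. There it is
multiplicativity of the coaction of `A' □^{H'} H`, as `κ` is colinear and multiplicative. -/
lemma mulBA_rho (x y : (bimodBA F).carrier) : (bimodBA F).coaction.ρ (mulBA F hκ x y) =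
    star H (mulBA F hκ) ((bimodBA F).coaction.ρ x) ((bimodBA F).coaction.ρ y) := by
  apply Module.Flat.rTensor_preserves_injective_linearMap (M := H) (kappa F) hκ.1
  rw [← kappa_rho, kappa_mulBA, cotRho_mul, kappa_rho, kappa_rho, ← star_mul]
  exact (star_rTensor (mulBA F hκ) (LinearMap.mul k (cotAlg F)) (kappa F) (kappa F) (kappa F)
    (kappa_mulBA F hκ) _ _).symm

/-- The monoid structure on `B' ⊗_B A`. -/
noncomputable def monBA : (bimodBA F).Mon where
  mul := Bal.lift (mulBA F hκ) (mulBA_balanced F hκ)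
  one := (tmulBA F).flip 1 ∘ₗ F.β.toLinearMap
  mul_lact b x y := hκ.1 (by
    rw [Bal.lift_mk, Bal.lift_mk, kappa_lact, kappa_mulBA, kappa_mulBA, kappa_lact, mul_assoc])
  mul_act x y b := hκ.1 (by
    rw [Bal.lift_mk, Bal.lift_mk, kappa_act, kappa_mulBA, kappa_mulBA, kappa_act, mul_assoc])
  coaction_mul x y := by
    rw [Bal.lift_mk, mulBA_rho]
    rfl
  one_lact b c := hκ.1 (by
    simp only [LinearMap.comp_apply, LinearMap.flip_apply, AlgHom.toLinearMap_apply]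
    rw [kappa_lact, kappa_tmulBA_one, kappa_tmulBA_one, map_mul, map_mul])
  one_act b c := hκ.1 (by
    simp only [LinearMap.comp_apply, LinearMap.flip_apply, AlgHom.toLinearMap_apply]
    rw [kappa_act, kappa_tmulBA_one, kappa_tmulBA_one, map_mul, map_mul])
  coaction_one b := by
    simp only [LinearMap.comp_apply, LinearMap.flip_apply, AlgHom.toLinearMap_apply]
    rw [bimodBA_rho, X.comod.map_one, Algebra.TensorProduct.one_def, LinearMap.rTensor_tmul]
  mul_assoc x y z := hκ.1 (by
    simp only [Bal.lift_mk, kappa_mulBA, _root_.mul_assoc])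
  one_mul b x := hκ.1 (by
    simp only [Bal.lift_mk, LinearMap.comp_apply, LinearMap.flip_apply,
      AlgHom.toLinearMap_apply]
    rw [kappa_mulBA, kappa_tmulBA_one, kappa_lact])
  mul_one x b := hκ.1 (by
    simp only [Bal.lift_mk, LinearMap.comp_apply, LinearMap.flip_apply,
      AlgHom.toLinearMap_apply]
    rw [kappa_mulBA, kappa_tmulBA_one, kappa_act])

lemma monBA_mul (x y : (monBA F hκ).Alg) : x * y = mulBA F hκ x y :=
  Bal.lift_mk (mulBA F hκ) (mulBA_balanced F hκ) x y

lemma monBA_unitHom (b : B) : (monBA F hκ).unitHom b = tmulBA F (F.β b) 1 := rfl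

lemma monBA_unitHom_mul (b : B) (x : (monBA F hκ).Alg) :
    (monBA F hκ).unitHom b * x = (bimodBA F).lact b x := (monBA F hκ).one_mul b x

/-- The map `κ` as an isomorphism of algebras. -/
noncomputable def kappaEquiv : (monBA F hκ).Alg ≃ₐ[k] cotAlg F :=
  AlgEquiv.ofBijective (AlgHom.ofLinearMap (kappa F : (monBA F hκ).Alg →ₗ[k] cotAlg F)
    -- The unit element of the monoid is by definition `β(1) ⊗ 1`, so two maps have to be evaluated
    -- at `1`.
    ((kappa_tmulBA_one F (F.β 1)).trans (by rw [map_one, map_one]))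
    (fun x y => (congrArg (kappa F) (monBA_mul F hκ x y)).trans (kappa_mulBA F hκ x y))) hκ

/-- The algebra map `a ↦ 1 ⊗ a` from `A` to `B' ⊗_B A`. -/
noncomputable def inclA : A →ₐ[k] (monBA F hκ).Alg :=
  ((kappaEquiv F hκ).symm : cotAlg F →ₐ[k] (monBA F hκ).Alg).comp (cotRight F)

/-- With `inclA` defined as `κ⁻¹` after `cotRight`, multiplicativity comes for free; the explicit
formula follows from `κ(1 ⊗ a) = cotRight a`. -/
lemma inclA_apply (a : A) : inclA F hκ a = tmulBA F 1 a :=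
  hκ.1 (((kappaEquiv F hκ).apply_symm_apply _).trans (kappa_one_tmulBA F a).symm)

/-- The algebra map `b' ↦ b' ⊗ 1` from `B'` to `B' ⊗_B A`. -/
noncomputable def inclB : B' →ₐ[k] (monBA F hκ).Alg :=
  ((kappaEquiv F hκ).symm : cotAlg F →ₐ[k] (monBA F hκ).Alg).comp (cotLeft F)

lemma inclB_apply (b' : B') : inclB F hκ b' = tmulBA F b' 1 :=
  hκ.1 (((kappaEquiv F hκ).apply_symm_apply _).trans (kappa_tmulBA_one F b').symm)

lemma inclA_colinear : IsColinear X.comod.toCoaction (monBA F hκ).comodAlg.toCoaction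
    (inclA F hκ).toLinearMap := fun a => by
  have e : (inclA F hκ).toLinearMap = tmulBA F 1 := LinearMap.ext (inclA_apply F hκ)
  rw [e]
  exact bimodBA_rho F 1 a

lemma bimodBA_rho_tmulBA_one (b' : B') :
    (bimodBA F).coaction.ρ (tmulBA F b' 1) = tmulBA F b' 1 ⊗ₜ 1 := by
  rw [bimodBA_rho, X.comod.map_one, Algebra.TensorProduct.one_def, LinearMap.rTensor_tmul]

lemma inclB_colinear : IsColinear (Coaction.trivial k H B') (monBA F hκ).comodAlg.toCoaction
    (inclB F hκ).toLinearMap := fun b' => by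
  have e : (inclB F hκ).toLinearMap = (tmulBA F).flip 1 := LinearMap.ext (inclB_apply F hκ)
  rw [e]
  exact bimodBA_rho_tmulBA_one F b'

lemma unitHom_colinear : IsColinear (Coaction.trivial k H B) (monBA F hκ).comodAlg.toCoaction
    (monBA F hκ).unitHom.toLinearMap := fun b => bimodBA_rho_tmulBA_one F (F.β b)

/-- This is `1 ⊗ φ_A(b) = β(b) ⊗ 1`, seen after `κ` as the agreement of `cotRight` and `cotLeft` on
`B`. -/
lemma inclA_comp_incl : (inclA F hκ).comp X.incl = (monBA F hκ).unitHom :=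
  AlgHom.ext fun b => hκ.1 (by
    refine (congrArg (kappa F) (inclA_apply F hκ (X.incl b))).trans ?_
    rw [kappa_one_tmulBA, cotRight_incl]
    exact (kappa_tmulBA_one F (F.β b)).symm)

lemma inclB_comp_beta : (inclB F hκ).comp F.β = (monBA F hκ).unitHom :=
  AlgHom.ext fun b => inclB_apply F hκ (F.β b)

lemma cotEval_apply (x : cotAlg F) : cotEval F x = augment k H A' (x : A' ⊗[k] H) := by
  change Algebra.TensorProduct.rid k k A' (Algebra.TensorProduct.map (AlgHom.id k A')
    (Bialgebra.counitAlgHom k H) (x : A' ⊗[k] H)) = _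
  generalize (x : A' ⊗[k] H) = u
  induction u with
  | zero => simp
  | add a b ha hb => simp only [map_add, ha, hb]
  | tmul a h => simp

lemma cotEval_comp_cotRight : (cotEval F).comp (cotRight F) = F.α := AlgHom.ext fun a => by
  rw [AlgHom.comp_apply, cotEval_apply, cotRight_coe, augment_rTensor, X.comod.augment_rho]
  rfl

lemma cotEval_comp_cotLeft : (cotEval F).comp (cotLeft F) = X'.incl := AlgHom.ext fun b' => by
  rw [AlgHom.comp_apply, cotEval_apply, cotLeft_coe]
  simp

/-- For `x` in the cotensor product, applying `ε` to the `H`-leg of the defining condition shows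
that the `A'`-coaction of its evaluation is `(id ⊗ χ)(x)` (`rho_augment`). On the other side,
evaluating the first leg of the coaction of `x` returns `x` by the counit axiom. -/
lemma cotEval_colinear : IsColinear ((cotComod F).push F.χ) X'.comod.toCoaction
    (cotEval F).toLinearMap := fun x => by
  have e : (cotEval F).toLinearMap = augment k H A' ∘ₗ (cotAlg F).val.toLinearMap :=
    LinearMap.ext (cotEval_apply F)
  have h1 : ∀ u : cotAlg F ⊗[k] H, (augment k H A' ∘ₗ (cotAlg F).val.toLinearMap).rTensor H'
      ((F.χ : H →ₗ[k] H').lTensor _ u) = (F.χ : H →ₗ[k] H').lTensor _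
        ((augment k H A' ∘ₗ (cotAlg F).val.toLinearMap).rTensor H u) := by
    intro u
    induction u with
    | zero => simp
    | add a b ha hb => simp only [map_add, ha, hb]
    | tmul x h => simp
  rw [e]
  refine (rho_augment X'.comod.toCoaction F.χ x.2).trans ?_
  refine Eq.trans ?_ (h1 (cotRho F x)).symm
  rw [LinearMap.rTensor_comp_apply, cotRho_spec, augment_cofree]

end Monoid

/-! ### The composite monad is the monad of the monoid -/

section CompositeMonad

variable {k H H' A A' B B' : Type u} [Field k] [Ring H] [HopfAlgebra k H]
  [Ring H'] [HopfAlgebra k H'] [Ring A] [Algebra k A] [Ring A'] [Algebra k A']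
  [Ring B] [Algebra k B] [Ring B'] [Algebra k B']
  {X : InvMap k H A B} {X' : InvMap k H' A' B'} (F : (X.Mor X' : Type u))
  (hκ : Function.Bijective (kappa F))

/-- The bilinear map `(n, b' ⊗ a) ↦ (n ⊗ b') ⊗ a`. -/
def tmulLeftBil (N : RMod k B) :
    N.carrier →ₗ[k] (bimodBA F).carrier →ₗ[k] ((N.ten F.β).indObj X.incl).carrier where
  toFun n := tmulLeft F N n
  map_add' := tmulLeft_add F N
  map_smul' := tmulLeft_smul F N

/-- The bilinear map `(n, b' ⊗ a) ↦ (n ⊗ b') ⊗ a` on the algebra `B' ⊗_B A`. -/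
noncomputable def tmulLeftAlg (N : RMod k B) :
    N.carrier →ₗ[k] (monBA F hκ).Alg →ₗ[k] ((N.ten F.β).indObj X.incl).carrier :=
  tmulLeftBil F N

/-- The bilinear map `(b', a) ↦ b' ⊗ a` to the algebra `B' ⊗_B A`. -/
noncomputable def tmulAlg : B' →ₗ[k] A →ₗ[k] (monBA F hκ).Alg := tmulBA F

/-- The left `B`-action of the bimodule is multiplication by the unit map of the monoid, so
`tmulLeft_act` also gives balancing for the algebra `B' ⊗_B A`. -/
lemma tmulLeftAlg_balanced (N : RMod k B) (n : N.carrier) (b : B) (x : (monBA F hκ).Alg) :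
    tmulLeftAlg F hκ N (N.act n b) x =
      tmulLeftAlg F hκ N n ((monBA F hκ).unitHom b * x) :=
  (tmulLeft_act F N n b x).trans
    (congrArg (tmulLeft F N n) (monBA_unitHom_mul F hκ b x).symm)

lemma tmulLeftAlg_mul (N : RMod k B) (n : N.carrier) (x : (monBA F hκ).Alg) (b : B) :
    tmulLeftAlg F hκ N n (x * (monBA F hκ).unitHom b) =
      ((N.ten F.β).indObj X.incl).act (tmulLeftAlg F hκ N n x) (X.incl b) := by
  refine Eq.trans ?_ (tmulLeft_sandwich_right F N n (X.incl b) x)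
  exact congrArg (tmulLeft F N n) (((monBA F hκ).mul_one x b).trans
    (bimodBA_act_eq_sandwich F b x))

/-- The map `n ⊗ (b' ⊗ a) ↦ (n ⊗ b') ⊗ a` of right `B`-modules. -/
noncomputable def compHom (N : RMod k B) :
    N.ten (monBA F hκ).unitHom ⟶ (N.ten F.β).ten X.incl where
  lin := indLift (tmulLeftAlg F hκ N) (tmulLeftAlg_balanced F hκ N)
  map_act m b := by
    have e : indLift (tmulLeftAlg F hκ N) (tmulLeftAlg_balanced F hκ N) ∘ₗ
        (N.indObj (monBA F hκ).unitHom).act.flip ((monBA F hκ).unitHom b) =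
        ((N.ten F.β).indObj X.incl).act.flip (X.incl b) ∘ₗ
        indLift (tmulLeftAlg F hκ N) (tmulLeftAlg_balanced F hκ N) :=
      indLin_ext fun n x => by
        rw [LinearMap.comp_apply, LinearMap.comp_apply, LinearMap.flip_apply,
          LinearMap.flip_apply, tmul_act, indLift_tmul, indLift_tmul, tmulLeftAlg_mul]
    exact LinearMap.congr_fun e m

lemma compHom_tmul (N : RMod k B) (n : N.carrier) (x : (monBA F hκ).Alg) :
    (compHom F hκ N).lin (tmul (monBA F hκ).unitHom N n x) = tmulLeft F N n x :=
  indLift_tmul (tmulLeftAlg F hκ N) (tmulLeftAlg_balanced F hκ N) n x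

/-- The bilinear map `(n ⊗ b', a) ↦ n ⊗ (b' ⊗ a)`. -/
noncomputable def compInvBil (N : RMod k B) :
    (N.indObj F.β).carrier →ₗ[k] A →ₗ[k] (N.indObj (monBA F hκ).unitHom).carrier :=
  indLift (LinearMap.mk₂ k
      (fun (n : N.carrier) (b' : B') => tmul (monBA F hκ).unitHom N n ∘ₗ tmulAlg F hκ b')
      (fun m n b' => by rw [map_add]; rfl)
      (fun r n b' => by rw [map_smul]; rfl)
      (fun n b' c' => by rw [map_add, LinearMap.comp_add])
      (fun r n b' => by rw [map_smul, LinearMap.comp_smul]))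
    (fun n b b' => LinearMap.ext fun a => by
      refine (tmul_balanced (monBA F hκ).unitHom N n b (tmulBA F b' a)).trans ?_
      exact congrArg (tmul (monBA F hκ).unitHom N n) ((monBA_unitHom_mul F hκ b _).trans
        (bimodBA_lact F b b' a)))

lemma compInvBil_tmul (N : RMod k B) (n : N.carrier) (b' : B') (a : A) :
    compInvBil F hκ N (tmul F.β N n b') a =
      tmul (monBA F hκ).unitHom N n (tmulBA F b' a : (monBA F hκ).Alg) := by
  rw [compInvBil, indLift_tmul]
  rfl

lemma compInvBil_balanced (N : RMod k B) (m : (N.indObj F.β).carrier) (b : B) (a : A) :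
    compInvBil F hκ N ((N.indObj F.β).act m (F.β b)) a =
      compInvBil F hκ N m (X.incl b * a) := by
  induction m using ind_induction with
  | h0 => simp
  | ha x y hx hy => simp only [map_add, LinearMap.add_apply, hx, hy]
  | hm n b' =>
    rw [tmul_act, compInvBil_tmul, compInvBil_tmul]
    exact congrArg (tmul (monBA F hκ).unitHom N n)
      (tmul_balanced X.incl (algMod F.β) b' b a)

/-- The linear map `(n ⊗ b') ⊗ a ↦ n ⊗ (b' ⊗ a)`. -/
noncomputable def compInv (N : RMod k B) : ((N.ten F.β).indObj X.incl).carrier →ₗ[k]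
    (N.indObj (monBA F hκ).unitHom).carrier :=
  indLift (N := N.ten F.β) (compInvBil F hκ N) (compInvBil_balanced F hκ N)

lemma compInv_tmul (N : RMod k B) (m : (N.indObj F.β).carrier) (a : A) :
    compInv F hκ N (tmul X.incl (N.ten F.β) m a) = compInvBil F hκ N m a :=
  indLift_tmul (N := N.ten F.β) (compInvBil F hκ N) (compInvBil_balanced F hκ N) m a

lemma compInv_tmulLeft (N : RMod k B) (n : N.carrier) (x : (bimodBA F).carrier) :
    compInv F hκ N (tmulLeft F N n x) =
      tmul (monBA F hκ).unitHom N n (x : (monBA F hκ).Alg) := by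
  have e : compInv F hκ N ∘ₗ tmulLeft F N n =
      (tmul (monBA F hκ).unitHom N n : (bimodBA F).carrier →ₗ[k] _) :=
    bimodBA_ext F fun b' a => by
      refine (congrArg (compInv F hκ N) (tmulLeft_tmulBA F N n b' a)).trans ?_
      exact (compInv_tmul F hκ N _ a).trans (compInvBil_tmul F hκ N n b' a)
  exact LinearMap.congr_fun e x

/-- `compHom` is the associativity map of tensor products over `B`, and `compInv` is its inverse.
Both composites are checked on generators. -/
lemma compHom_bijective (N : RMod k B) : Function.Bijective (compHom F hκ N).lin := by
  have h1 : compInv F hκ N ∘ₗ (compHom F hκ N).lin = LinearMap.id :=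
    indLin_ext (φ := (monBA F hκ).unitHom) (N := N) fun n x => by
      refine (congrArg (compInv F hκ N) (compHom_tmul F hκ N n x)).trans ?_
      exact compInv_tmulLeft F hκ N n x
  have h2 : (compHom F hκ N).lin ∘ₗ compInv F hκ N = LinearMap.id :=
    indLin_ext (φ := X.incl) (N := N.ten F.β) fun m a => by
      have e : (compHom F hκ N).lin ∘ₗ compInv F hκ N ∘ₗ (tmul X.incl (N.ten F.β)).flip a =
          (tmul X.incl (N.ten F.β)).flip a := indLin_ext (N := N) fun n b' => by
        refine (congrArg (compHom F hκ N).lin ((compInv_tmul F hκ N (tmul F.β N n b') a).trans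
          (compInvBil_tmul F hκ N n b' a))).trans ?_
        exact (compHom_tmul F hκ N n _).trans (tmulLeft_tmulBA F N n b' a)
      exact LinearMap.congr_fun e m
  exact Function.bijective_iff_has_inverse.2
    ⟨compInv F hκ N, fun x => LinearMap.congr_fun h1 x, fun x => LinearMap.congr_fun h2 x⟩

lemma sandwich_sandwich (b' : B') (c : A) (z : (bimodBA F).carrier) :
    sandwich F 1 c (sandwich F b' 1 z) = sandwich F b' c z := by
  have e : sandwich F 1 c ∘ₗ sandwich F b' 1 = sandwich F b' c := bimodBA_ext F fun d' d => by
    rw [LinearMap.comp_apply, sandwich_tmulBA, sandwich_tmulBA, sandwich_tmulBA, one_mul, mul_one]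
  exact LinearMap.congr_fun e z

/-- Only the case `x = b' ⊗ a` needs computation. There the composite multiplication applies `φ` to
`a ⊗ c'`, then multiplies by `c` on the right and by `b'` on the left, which is the product of
`mulBA_tmul_tmul`. -/
lemma compMonad_mu_tmul (N : RMod k B) (n : N.carrier) (x : (bimodBA F).carrier) (c' : B')
    (c : A) :
    RMod.Hom.lin ((distribLaw F hκ).compMonad.μ.app N)
      (tmul X.incl (((N.ten F.β).ten X.incl).ten F.β)
        (tmul F.β ((N.ten F.β).ten X.incl) (tmulLeft F N n x) c') c) =
      tmulLeft F N n (mulBA F hκ x (tmulBA F c' c)) := by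
  have e : RMod.Hom.lin ((distribLaw F hκ).compMonad.μ.app N) ∘ₗ
      (tmul X.incl (((N.ten F.β).ten X.incl).ten F.β)).flip c ∘ₗ
        (tmul F.β ((N.ten F.β).ten X.incl)).flip c' ∘ₗ tmulLeft F N n =
      tmulLeft F N n ∘ₗ (mulBA F hκ).flip (tmulBA F c' c) := bimodBA_ext F fun b' a => by
    -- The three factors of the composite multiplication: `M₁` is the distributive law, `M₂` the
    -- multiplication of `A`, `M₃` that of `B'`.
    let M₁ := RMod.Hom.lin ((tensorMonad X.incl).map (distribHom F hκ (N.ten F.β)))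
    let M₂ := RMod.Hom.lin ((tensorMonad X.incl).μ.app ((N.ten F.β).ten F.β))
    let M₃ := RMod.Hom.lin ((tensorMonad X.incl).map ((tensorMonad F.β).μ.app N))
    change M₃ (M₂ (M₁ (tmul X.incl (((N.ten F.β).ten X.incl).ten F.β)
        (tmul F.β ((N.ten F.β).ten X.incl) (tmulLeft F N n (tmulBA F b' a)) c') c))) =
      tmulLeft F N n (mulBA F hκ (tmulBA F b' a) (tmulBA F c' c))
    refine (congrArg (fun t => M₃ (M₂ (M₁ (tmul X.incl (((N.ten F.β).ten X.incl).ten F.β)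
        (tmul F.β ((N.ten F.β).ten X.incl) t c') c)))) (tmulLeft_tmulBA F N n b' a)).trans ?_
    refine (congrArg (fun t => M₃ (M₂ t))
      (tensorMonad_map_tmul (distribHom F hκ (N.ten F.β)) _ c)).trans ?_
    refine (congrArg M₃ (tensorMonad_mu_tmul ((N.ten F.β).ten F.β) _ c)).trans ?_
    -- `M₃` is right `A`-linear, so the factor `c` can be pulled out before the multiplication of
    -- `B'` is computed.
    refine (tensorMonad_map_act ((tensorMonad F.β).μ.app N) _ c).trans ?_
    refine (congrArg (fun t => ((N.ten F.β).indObj X.incl).act (M₃ t) c)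
      (distribHom_tmul_tmul F hκ (N.ten F.β) (tmul F.β N n b') a c')).trans ?_
    refine (congrArg (fun t => ((N.ten F.β).indObj X.incl).act t c)
      (tmulLeft_mu F N n b' _)).trans ?_
    rw [mulBA_tmul_tmul, ← sandwich_sandwich F b' c]
    exact (tmulLeft_sandwich_right F N n c _).symm
  exact LinearMap.congr_fun e x

/-- The previous formula extended linearly from `c' ⊗ c` to all `y`. In this form the composite
multiplication is visibly induced by the product on `B' ⊗_B A`. -/
lemma compMonad_mu_tmulLeft (N : RMod k B) (n : N.carrier) (x y : (bimodBA F).carrier) :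
    RMod.Hom.lin ((distribLaw F hκ).compMonad.μ.app N)
      (tmulLeft F ((N.ten F.β).ten X.incl) (tmulLeft F N n x) y) =
      tmulLeft F N n (mulBA F hκ x y) := by
  have e : RMod.Hom.lin ((distribLaw F hκ).compMonad.μ.app N) ∘ₗ
      tmulLeft F ((N.ten F.β).ten X.incl) (tmulLeft F N n x) =
      tmulLeft F N n ∘ₗ mulBA F hκ x := bimodBA_ext F fun c' c => by
    refine (congrArg (RMod.Hom.lin ((distribLaw F hκ).compMonad.μ.app N))
      (tmulLeft_tmulBA F ((N.ten F.β).ten X.incl) (tmulLeft F N n x) c' c)).trans ?_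
    exact compMonad_mu_tmul F hκ N n x c' c
  exact LinearMap.congr_fun e y

/-- The functors `- ⊗_B (B' ⊗_B A)` and `(- ⊗_B B') ⊗_B A` are isomorphic. -/
noncomputable def compNatIso : (tensorMonad (monBA F hκ).unitHom).toFunctor ≅
    (distribLaw F hκ).compMonad.toFunctor :=
  NatIso.ofComponents (fun N => RMod.isoOfBijective (compHom F hκ N) (compHom_bijective F hκ N))
    (fun {M N} f => ten_hom_ext (φ := (monBA F hκ).unitHom) (N := M) fun m x => by
      refine (congrArg (compHom F hκ N).lin
        (tensorMonad_map_tmul (φ := (monBA F hκ).unitHom) f m x)).trans ?_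
      refine (compHom_tmul F hκ N (f.lin m) x).trans ?_
      refine (tmulLeft_naturality F f m x).symm.trans ?_
      exact congrArg (RMod.Hom.lin ((tensorMonad X.incl).map ((tensorMonad F.β).map f)))
        (compHom_tmul F hκ M m x).symm)

/-- The monad given by the monoid `B' ⊗_B A` is the composite monad. -/
noncomputable def compMonadIso :
    tensorMonad (monBA F hκ).unitHom ≅ (distribLaw F hκ).compMonad :=
  MonadIso.mk (compNatIso F hκ)
    (fun N => RMod.hom_ext (LinearMap.ext fun n => by
      refine (compHom_tmul F hκ N n 1).trans ?_
      refine (tmulLeft_tmulBA F N n (F.β 1) 1).trans ?_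
      exact congrArg (fun t => tmul X.incl (N.ten F.β) (tmul F.β N n t) 1) (map_one F.β)))
    (fun N => ten_hom_ext₂ (φ := (monBA F hκ).unitHom) (ψ := (monBA F hκ).unitHom) (N := N)
      fun n x y => by
        refine (congrArg (compHom F hκ N).lin
          ((tensorMonad_mu_tmul (φ := (monBA F hκ).unitHom) N _ y).trans
            (tmul_act (monBA F hκ).unitHom N n x y))).trans ?_
        refine (compHom_tmul F hκ N n (x * y)).trans ?_
        rw [monBA_mul]
        refine (compMonad_mu_tmulLeft F hκ N n x y).symm.trans ?_
        -- The comparison map applied twice, once inside and once outside, takes `(n ⊗ x) ⊗ y` to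
        -- its counterpart in the composite functor. Compatibility with multiplication then reads `n
        -- ⊗ xy` on both sides.
        have e : (compHom F hκ ((N.ten F.β).ten X.incl)).lin
            (RMod.Hom.lin ((tensorMonad (monBA F hκ).unitHom).map (compHom F hκ N))
              (tmul (monBA F hκ).unitHom (N.ten (monBA F hκ).unitHom)
                (tmul (monBA F hκ).unitHom N n x) y)) =
            tmulLeft F ((N.ten F.β).ten X.incl) (tmulLeft F N n x) y := by
          refine (congrArg (compHom F hκ ((N.ten F.β).ten X.incl)).lin
            (tensorMonad_map_tmul (φ := (monBA F hκ).unitHom) (compHom F hκ N)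
              (tmul (monBA F hκ).unitHom N n x) y)).trans ?_
          refine (compHom_tmul F hκ ((N.ten F.β).ten X.incl) _ y).trans ?_
          exact congrArg (fun t => tmulLeft F ((N.ten F.β).ten X.incl) t y)
            (compHom_tmul F hκ N n x)
        exact congrArg (RMod.Hom.lin ((distribLaw F hκ).compMonad.μ.app N)) e.symm)

lemma compMonadIso_tmul (N : RMod k B) (n : N.carrier) (x : (bimodBA F).carrier) :
    RMod.Hom.lin ((compMonadIso F hκ).hom.toNatTrans.app N)
      (tmul (monBA F hκ).unitHom N n (x : (monBA F hκ).Alg)) = tmulLeft F N n x :=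
  compHom_tmul F hκ N n x

end CompositeMonad

end HopfInv

/-! ### The main theorem -/

theorem mainTheorem3 {k H H' A A' B B' : Type u} [Field k] [Ring H] [HopfAlgebra k H]
    [Ring H'] [HopfAlgebra k H'] [Ring A] [Algebra k A] [Ring A'] [Algebra k A']
    [Ring B] [Algebra k B] [Ring B'] [Algebra k B']
    {X : InvMap k H A B} {X' : InvMap k H' A' B'} (F : X.Mor X')
    (hχ : LeftCoflat F.χ)
    (hS : Function.Bijective (HopfAlgebra.antipode k : H →ₗ[k] H))
    (hκ : Function.Bijective (kappa F)) :
    -- the other mate induces `κ̃`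
    (∃ (e₁ : algMod X.incl ≅ coinvObj X (RelHopf.tensor H (Coaction.regular k H) X.comod))
      (e₂ : (pull F).obj (RelHopf.tensor H (Coaction.regular k H) X.comod) ≅
        RelHopf.tensor H ((Coaction.regular k H).push F.χ) X'.comod)
      (e₃ : coinvObj X' (RelHopf.tensor H ((Coaction.regular k H).push F.χ) X'.comod) ≅
        algMod (cotLeft F)),
      (∀ a : A, coinvTensorVal X H (Coaction.regular k H) (e₁.hom.lin a) =
        TensorProduct.comm k A H
          ((LinearEquiv.ofBijective (HopfAlgebra.antipode k : H →ₗ[k] H)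
            hS).symm.toLinearMap.lTensor A (X.comod.ρ a))) ∧
      (∀ (h : H) (a : A) (a' : A'),
        e₂.hom.hom.lin (tmul F.α (RelHopf.tensor H (Coaction.regular k H) X.comod).toRMod
          (h ⊗ₜ[k] a) a') = h ⊗ₜ[k] (F.α a * a')) ∧
      (∀ x, (cotAlg F).val (e₃.hom.lin x) =
        TensorProduct.comm k H A' ((HopfAlgebra.antipode k : H →ₗ[k] H).rTensor A'
          (coinvTensorVal X' H ((Coaction.regular k H).push F.χ) x))) ∧
      ∀ z : (bimodAB F).carrier,
        e₃.hom.lin (((coinv X').map e₂.hom).lin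
          (((otherMate F).app (RelHopf.tensor H (Coaction.regular k H) X.comod)).lin
            (((RMod.ind F.β).map e₁.hom).lin z))) = kappaTilde F z) ∧
    (bimodBA F).IsHom (bimodCot F) (kappa F) ∧
    (bimodAB F).IsHom (bimodCot F) (kappaTilde F) ∧
    (bimodAB F).IsHom (bimodBA F) (flipMap F hκ) ∧
    (∀ z, kappa F (flipMap F hκ z) = kappaTilde F z) ∧
    -- `φ` is a distributive law
    ∃ d : DistribLaw (tensorMonad X.incl) (tensorMonad F.β),
      (∀ (N : RMod k B) (n : N.carrier) (a : A) (b' : B'),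
        (d.nat.app N).lin (tmul F.β ((N.indObj X.incl).resObj X.incl) (tmul X.incl N n a) b') =
          tmulLeft F N n (flipMap F hκ (tmulAB F a b'))) ∧
    -- the composite monad gives a monoid structure on `B' ⊗_B A`
    ∃ S : (bimodBA F).Mon,
      (∃ e : tensorMonad S.unitHom ≅ d.compMonad,
        ∀ (N : RMod k B) (n : N.carrier) (x : (bimodBA F).carrier),
          (e.hom.toNatTrans.app N).lin (tmul S.unitHom N n x) = tmulLeft F N n x) ∧
      (∀ (b' c' : B') (a c : A),
        S.mulBil (tmulBA F b' a) (tmulBA F c' c) =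
          sandwich F b' c (flipMap F hκ (tmulAB F a c'))) ∧
      (∀ b : B, S.unitHom b = tmulBA F (F.β b) 1) ∧
    -- `κ` is an isomorphism of comodule algebras and the diagram commutes
      ∃ (K : S.Alg ≃ₐ[k] cotAlg F) (iA : A →ₐ[k] S.Alg) (iB : B' →ₐ[k] S.Alg),
        (∀ x : (bimodBA F).carrier, K x = kappa F x) ∧
        IsColinear S.comodAlg.toCoaction (cotComod F).toCoaction K.toLinearMap ∧
        (∀ a, iA a = tmulBA F 1 a) ∧
        (∀ b', iB b' = tmulBA F b' 1) ∧
        IsColinear X.comod.toCoaction S.comodAlg.toCoaction iA.toLinearMap ∧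
        IsColinear (Coaction.trivial k H B') S.comodAlg.toCoaction iB.toLinearMap ∧
        IsColinear (Coaction.trivial k H B) S.comodAlg.toCoaction S.unitHom.toLinearMap ∧
        IsColinear X.comod.toCoaction (cotComod F).toCoaction (cotRight F).toLinearMap ∧
        IsColinear (Coaction.trivial k H B') (cotComod F).toCoaction (cotLeft F).toLinearMap ∧
        IsColinear ((cotComod F).push F.χ) X'.comod.toCoaction (cotEval F).toLinearMap ∧
        (K : S.Alg →ₐ[k] cotAlg F).comp iA = cotRight F ∧
        (K : S.Alg →ₐ[k] cotAlg F).comp iB = cotLeft F ∧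
        iA.comp X.incl = S.unitHom ∧
        iB.comp F.β = S.unitHom ∧
        (cotEval F).comp (cotRight F) = F.α ∧
        (cotEval F).comp (cotLeft F) = X'.incl := by
  have hT := IsInvAntipode.of_bijective hS
  refine ⟨⟨RMod.isoOfBijective (coinvTensorHom X hT) (coinvTensorHom_bijective X hT),
      RelHopf.isoOfBijective (pullTensorHom F) (pullTensorHom_bijective F),
      RMod.isoOfBijective (coinvCotensorHom F) (coinvCotensorHom_bijective F hT),
      fun _ => rfl, fun h a a' => ?_, fun _ => rfl, otherMate_tensor F hT⟩,
    isHom_kappa F, isHom_kappaTilde F, isHom_flipMap F hκ, kappa_flipMap F hκ,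
    distribLaw F hκ, distribHom_tmul_tmul F hκ, monBA F hκ,
    ⟨compMonadIso F hκ, compMonadIso_tmul F hκ⟩, fun b' c' a c => ?_, fun _ => rfl,
    kappaEquiv F hκ, inclA F hκ, inclB F hκ, fun _ => rfl, kappa_rho F, inclA_apply F hκ,
    inclB_apply F hκ, inclA_colinear F hκ, inclB_colinear F hκ, unitHom_colinear F hκ,
    cotRho_cotRight F, cotRho_cotLeft F, cotEval_colinear F, ?_, ?_, inclA_comp_incl F hκ,
    inclB_comp_beta F hκ, cotEval_comp_cotRight F, cotEval_comp_cotLeft F⟩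
  · exact (pullTensorModHom_tmul F (h ⊗ₜ[k] a) a').trans (pullTensorBil_tmul F h a a')
  · exact (monBA_mul F hκ _ _).trans (mulBA_tmul_tmul F hκ b' c' a c)
  -- The inclusions of `A` and `B'` were defined as `κ⁻¹` after `cotRight` and `cotLeft`, so
  -- composing with `κ` cancels.
  · exact AlgHom.ext fun a => (kappaEquiv F hκ).apply_symm_apply (cotRight F a)
  · exact AlgHom.ext fun b' => (kappaEquiv F hκ).apply_symm_apply (cotLeft F b')
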